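/- All graphs are finite, simple and undirected; $N(v)$ and $N[v]$ denote open and closed neighbourhoods. **Framework.** A weight set $(W,\preceq,\oplus)$ is a totally ordered set with a maximum element and a commutative, associative, monotone operation $\oplus$ that has a neutral element and for which the maximum is absorbing. A locally checkable problem with $q$ colours on $G$ consists of a set $\{a_1,\dots,a_q\}$ of colours, a weight set, a check function $check(v,a,\ell_1,\dots,\ell_q)\in\{\mathrm{True},\mathrm{False}\}$, a weight function $\mathrm{w}(v,a,\ell_1,\dots,\ell_q)\in W$, and optionally a set $\mathcal K$ of allowed tuples of colour class sizes. A colouring $c$ is proper if $check(v,c(v),k_1,\dots,k_q)$ holds for every $v$, where $k_j=|\{u\in N(v):c(u)=a_j\}|$; its weight is $\bigoplus_v \mathrm{w}(v,c(v),k_1,\dots,k_q)$. The value of the problem is the minimum weight of a proper colouring whose tuple of class sizes is in $\mathcal K$ (the maximum of $W$ if there is none). The check (weight) function is $d$-stable if, for every $v$ and every colouring $c$, replacing each $k_j$ by $\min(d,k_j)$ does not change its value at $(v,c(v),k_1,\dots,k_q)$; the problem is $d$-stable if both functions are. **Problems.** Let $k\ge 1$ be a fixed integer. * A $[k]$-Roman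 dominating function is $f:V(G)\to\{0,\dots,k+1\}$ such that $f(v)<k$ implies $\sum_{u\in N[v]}f(u)\ge|\{u\in N(v):f(u)\ge1\}|+k$; $\gamma_{[kR]}(G)$ is the minimum of $\sum_v f(v)$ over all of them. * A CFON (CFCN) $k$-colouring is $c:V(G)\to\{1,\dots,k\}$ such that every vertex $v$ has some $u$ in $N(v)$ (in $N[v]$) whose colour is given to no other vertex of $N(v)$ (of $N[v]$). A CFON$^*$ (CFCN$^*$) $k$-colouring is $c:V(G)\to\{0,\dots,k\}$ with the same property where in addition $c(u)\ne0$. * A b-colouring with $k$ colours is $f:V(G)\to\{1,\dots,k\}$ such that adjacent vertices have different colours and every colour class contains a vertex with neighbours in all the other colour classes. **Theorem.** For every graph $G$: 1. The problem with colours $0,\dots,k+1$, weights $(\mathbb N\cup\{\infty\},\le,+)$, $\mathrm w(v,a,\ell)=a$ and $check(v,a,\ell)=\bigl(a+\sum_{j=0}^{k+1}j\ell_j\ge k+\sum_{j=1}^{k+1}\ell_j\bigr)$ is $k$-stable (its weight function is even $1$-stable). Its proper colourings are exactly the $[k]$-Roman dominating functions $f$, with weight $\sum_v f(v)$, and its value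 is $\gamma_{[kR]}(G)$. 2. For each of the four conflict-free variants, the problem with colours $\{1,\dots,k\}$ (CFON, CFCN) or $\{0,\dots,k\}$ (CFON$^*$, CFCN$^*$), weights $(\{0,1\},\le,\max)$, $\mathrm w=0$, where $check(v,a,\ell)$ says that for some colour $j$ (with $j\neq 0$ in the starred variants) $\ell_j=1$ (open neighbourhoods) or $\ell_j+[a=j]=1$ (closed neighbourhoods), is $2$-stable. Its proper colourings are exactly the $k$-colourings of this variant, and its value is $0$ if and only if $G$ has one. 3. The problem with the $2k$ colours $\pm1,\dots,\pm k$, weights $(\{0,1\},\le,\max)$, $\mathrm w=0$, and, for $a\in\{1,\dots,k\}$, $check(v,a,\ell)=(\ell_a+\ell_{-a}=0)$, $check(v,-a,\ell)=(\ell_a+\ell_{-a}=0\ \wedge\ \ell_i+\ell_{-i}\ge1\text{ for all }i\in\{1,\dots,k\}\setminus\{a\})$, and the size constraints that each of the colours $-1,\dots,-k$ is used, is $1$-stable. A map $f:V(G)\to\{1,\dots,k\}$ is a b-colouring with $k$ colours if and only if $f=|c|$ for some proper colouring $c$ that satisfies the size constraints; hence the value is $0$ if and only if $G$ has a b-colouring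 with $k$ colours. A binary decomposition tree $T$ of $G$ is a rooted tree in which every non-leaf node has two children, with a bijection between $V(G)$ and its leaves. Its mim-width is the maximum, over the nodes $t$ of $T$, of the maximum size of an induced matching in the bipartite graph of the edges of $G$ between $S$ and $V(G)\setminus S$, where $S$ is the set of vertices at the leaves below $t$. 4. For each of the following there is an algorithm that, given a graph $G$ with $n$ vertices and a binary decomposition tree $T$ of $G$, solves the problem, and whose running time is, for every $w$, bounded by a polynomial in $n$ (depending on $k$ and $w$) on all inputs where $T$ has mim-width at most $w$: * computing $\gamma_{[kR]}(G)$; * for each of the four conflict-free variants, deciding whether $G$ has such a $k$-colouring, and computing the smallest $j$ such that $G$ has such a $j$-colouring if this $j$ is at most $k$ (and otherwise reporting that it is not); * deciding whether $G$ has a b-colouring with $k$ colours. -/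

import Mathlib

namespace LC

/-! ## Locally checkable problems -/

section Framework

variable {V : Type*} [Fintype V]

open Classical in
/-- The open neighbourhood of `v` in `G`. -/
noncomputable def nbrs (G : SimpleGraph V) (v : V) : Finset V :=
  Finset.univ.filter (fun u => G.Adj v u)

open Classical in
/-- The closed neighbourhood of `v` in `G`. -/
noncomputable def closedNbrs (G : SimpleGraph V) (v : V) : Finset V :=
  insert v (nbrs G v)

open Classical in
/-- The number of neighbours of `v` that have colour `a` under the colouring `c`. -/
noncomputable def colorCount {C : Type*} (G : SimpleGraph V) (c : V → C) (v : V) (a : C) : ℕ :=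
  ((nbrs G v).filter (fun u => c u = a)).card

/-- `(W, ≤, op)` is a weight set: a total order with a maximum element, and a commutative,
associative, monotone operation with neutral element `e`, for which the maximum is absorbing. -/
structure IsWeightSet (W : Type) [LinearOrder W] [OrderTop W] (op : W → W → W) (e : W) : Prop where
  comm : ∀ s t, op s t = op t s
  assoc : ∀ s t r, op (op s t) r = op s (op t r)
  neutral : ∀ s, op e s = s
  absorbing : ∀ s, op ⊤ s = ⊤
  mono : ∀ s₁ s₂ s₃, s₁ ≤ s₂ → op s₁ s₃ ≤ op s₂ s₃

/-- A (colour-counting) locally checkable problem on the vertex set `V`, with colour set `C`,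
weights in the weight set `(W, ≤, op)`, and size constraints. The tuple `(k_a)_{a ∈ C}` of numbers
of neighbours of each colour is a function `C → ℕ`. -/
structure LCP (V : Type*) [Fintype V] (C : Type) [Fintype C] (W : Type) [LinearOrder W]
    [OrderTop W] where
  op : W → W → W
  e : W
  isWeightSet : IsWeightSet W op e
  weight : V → C → (C → ℕ) → W
  check : V → C → (C → ℕ) → Prop
  sizes : Set (C → ℕ)
  sizes_sum : ∀ K ∈ sizes, ∑ a, K a = Fintype.card V

namespace LCP

variable {C : Type} [Fintype C] {W : Type} [LinearOrder W] [OrderTop W]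

/-- The check function is `d`-stable on `G`. -/
def CheckStable (P : LCP V C W) (G : SimpleGraph V) (d : ℕ) : Prop :=
  ∀ (v : V) (c : V → C),
    P.check v (c v) (colorCount G c v) ↔
      P.check v (c v) (fun a => min d (colorCount G c v a))

/-- The weight function is `d`-stable on `G`. -/
def WeightStable (P : LCP V C W) (G : SimpleGraph V) (d : ℕ) : Prop :=
  ∀ (v : V) (c : V → C),
    P.weight v (c v) (colorCount G c v) =
      P.weight v (c v) (fun a => min d (colorCount G c v a))

/-- The problem is a `d`-stable locally checkable problem on `G`. -/
def IsStable (P : LCP V C W) (G : SimpleGraph V) (d : ℕ) : Prop :=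
  P.CheckStable G d ∧ P.WeightStable G d

/-- Proper colourings. -/
def IsProper (P : LCP V C W) (G : SimpleGraph V) (c : V → C) : Prop :=
  ∀ v, P.check v (c v) (colorCount G c v)

open Classical in
/-- The tuple of sizes of the colour classes satisfies the size constraints. -/
def SatisfiesSizes (P : LCP V C W) (c : V → C) : Prop :=
  (fun a => (Finset.univ.filter (fun v => c v = a)).card) ∈ P.sizes

/-- The weight of a colouring: the `op`-sum of the weights of all vertices. -/
noncomputable def coloringWeight (P : LCP V C W) (G : SimpleGraph V) (c : V → C) : W :=
  haveI : Std.Commutative P.op := ⟨P.isWeightSet.comm⟩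
  haveI : Std.Associative P.op := ⟨P.isWeightSet.assoc⟩
  Finset.univ.fold P.op P.e (fun v => P.weight v (c v) (colorCount G c v))

open Classical in
/-- The minimum weight of a proper colouring that satisfies the size constraints; it is the maximum
element of the weight set if there is no such colouring. -/
noncomputable def opt (P : LCP V C W) (G : SimpleGraph V) : W :=
  (Finset.univ.filter (fun c : V → C => P.IsProper G c ∧ P.SatisfiesSizes c)).inf
    (P.coloringWeight G)

end LCP

/-- `(ℕ ∪ {∞}, ≤, +)` is a weight set. -/
theorem isWeightSet_enat : IsWeightSet ℕ∞ (· + ·) 0 where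
  comm := add_comm
  assoc := add_assoc
  neutral := zero_add
  absorbing := fun _ => top_add _
  mono := fun _ _ _ h => by gcongr

/-- `({0, 1}, ≤, max)` is a weight set. -/
theorem isWeightSet_fin_two : IsWeightSet (Fin 2) max 0 where
  comm := max_comm
  assoc := max_assoc
  neutral := by decide
  absorbing := by decide
  mono := by decide

/-! ## `[k]`-Roman domination -/

/-- `f` is a `[k]`-Roman dominating function on `G`. -/
def IsRoman (k : ℕ) (G : SimpleGraph V) (f : V → Fin (k + 2)) : Prop :=
  ∀ v, (f v : ℕ) < k →
    ((nbrs G v).filter (fun u => 1 ≤ (f u : ℕ))).card + k ≤ ∑ u ∈ closedNbrs G v, (f u : ℕ)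

/-- The `[k]`-Roman domination number. -/
noncomputable def romanNumber (k : ℕ) (G : SimpleGraph V) : ℕ :=
  sInf {s | ∃ f : V → Fin (k + 2), IsRoman k G f ∧ s = ∑ v, (f v : ℕ)}

/-- `[k]`-Roman domination as a locally checkable problem with colours `0, …, k + 1`. -/
def romanLCP (V : Type*) [Fintype V] (k : ℕ) : LCP V (Fin (k + 2)) ℕ∞ where
  op := (· + ·)
  e := 0
  isWeightSet := isWeightSet_enat
  weight := fun _ a _ => ((a : ℕ) : ℕ∞)
  check := fun _ a l =>
    k + ∑ j ∈ Finset.univ.filter (fun j : Fin (k + 2) => 1 ≤ (j : ℕ)), l j ≤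
      (a : ℕ) + ∑ j : Fin (k + 2), (j : ℕ) * l j
  sizes := {K | ∑ a, K a = Fintype.card V}
  sizes_sum := fun _ h => h

/-! ## Conflict-free colouring -/

/-- The four variants of conflict-free `k`-colouring: with open or closed neighbourhoods, and
(`star`) with or without an additional colour `0` that is never the conflict-free one. -/
inductive CFVariant
  | CFON
  | CFCN
  | CFONstar
  | CFCNstar

namespace CFVariant

/-- The number of colours: `k` (colour set `[k]`, identified with `Fin k`) for CFON and CFCN,
and `k + 1` (colour set `{0, …, k}`) for the starred variants. -/
def numColors : CFVariant → ℕ → ℕ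
  | CFON, k => k
  | CFCN, k => k
  | CFONstar, k => k + 1
  | CFCNstar, k => k + 1

/-- The colours that may witness conflict-freeness: all of them, except for the colour `0` in the
starred variants. -/
def Usable : CFVariant → ℕ → Prop
  | CFON, _ => True
  | CFCN, _ => True
  | CFONstar, j => j ≠ 0
  | CFCNstar, j => j ≠ 0

/-- Whether the variant is about closed neighbourhoods. -/
def closed : CFVariant → Bool
  | CFON => false
  | CFCN => true
  | CFONstar => false
  | CFCNstar => true

/-- The open or closed neighbourhood, according to the variant. -/
noncomputable def nbhd (X : CFVariant) (G : SimpleGraph V) (v : V) : Finset V :=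
  if X.closed then closedNbrs G v else nbrs G v

/-- `c` is a conflict-free `k`-colouring of `G` (of the variant `X`). -/
def IsColoring (X : CFVariant) (k : ℕ) (G : SimpleGraph V) (c : V → Fin (X.numColors k)) : Prop :=
  ∀ v, ∃ u ∈ X.nbhd G v, X.Usable (c u) ∧ ∀ u' ∈ X.nbhd G v, u' ≠ u → c u' ≠ c u

/-- `G` has a conflict-free `k`-colouring (of the variant `X`). -/
def Colorable (X : CFVariant) (k : ℕ) (G : SimpleGraph V) : Prop :=
  ∃ c : V → Fin (X.numColors k), X.IsColoring k G c

open Classical in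
/-- The smallest `j` such that `G` has a conflict-free `j`-colouring if this is at most `k`,
and `none` if `G` has no conflict-free `j`-colouring for any `j ≤ k`. -/
noncomputable def numberUpTo (X : CFVariant) (k : ℕ) (G : SimpleGraph V) : Option ℕ :=
  if ∃ j ≤ k, X.Colorable j G then some (sInf {j | X.Colorable j G}) else none

/-- Conflict-free `k`-colouring as a locally checkable problem: some usable colour occurs exactly
once in the neighbourhood. -/
def toLCP (X : CFVariant) (V : Type*) [Fintype V] (k : ℕ) :
    LCP V (Fin (X.numColors k)) (Fin 2) where
  op := max
  e := 0
  isWeightSet := isWeightSet_fin_two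
  weight := fun _ _ _ => 0
  check := fun _ a l =>
    ∃ j : Fin (X.numColors k), X.Usable j ∧ l j + (if X.closed = true ∧ a = j then 1 else 0) = 1
  sizes := {K | ∑ a, K a = Fintype.card V}
  sizes_sum := fun _ h => h

end CFVariant

/-! ## b-colouring -/

/-- `f` is a b-colouring of `G` with `k` colours: adjacent vertices have different colours, and
every colour class contains a vertex with neighbours in all the other colour classes. -/
def IsBColoring (k : ℕ) (G : SimpleGraph V) (f : V → Fin k) : Prop :=
  (∀ u v, G.Adj u v → f u ≠ f v) ∧
    ∀ a : Fin k, ∃ v, f v = a ∧ ∀ b, b ≠ a → ∃ u, G.Adj v u ∧ f u = b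

/-- The check function of b-colouring. The colour set is `{1, …, k} ∪ {-1, …, -k}`: the colour `a`
is `Sum.inl a`, the colour `-a` is `Sum.inr a`. -/
def bCheck (k : ℕ) (l : Fin k ⊕ Fin k → ℕ) : Fin k ⊕ Fin k → Prop
  | Sum.inl a => l (Sum.inl a) + l (Sum.inr a) = 0
  | Sum.inr a => l (Sum.inl a) + l (Sum.inr a) = 0 ∧
      ∀ i, i ≠ a → 1 ≤ l (Sum.inl i) + l (Sum.inr i)

/-- b-colouring with `k` colours as a locally checkable problem with `2 k` colours and size
constraints: each of the colours `-1, …, -k` is used. -/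
def bLCP (V : Type*) [Fintype V] (k : ℕ) : LCP V (Fin k ⊕ Fin k) (Fin 2) where
  op := max
  e := 0
  isWeightSet := isWeightSet_fin_two
  weight := fun _ _ _ => 0
  check := fun _ a l => bCheck k l a
  sizes := {K | ∑ a, K a = Fintype.card V ∧ ∀ a : Fin k, 1 ≤ K (Sum.inr a)}
  sizes_sum := fun _ h => h.1

/-- The colour `a` of a signed colour `a` or `-a`. -/
def absColor {k : ℕ} : Fin k ⊕ Fin k → Fin k
  | Sum.inl a => a
  | Sum.inr a => a

/-! ## Binary decomposition trees and mim-width -/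

/-- `mim(G, S)`: the maximum number of edges of an induced matching in the bipartite graph
`G[S, V ∖ S]`. -/
noncomputable def mim (G : SimpleGraph V) (S : Set V) : ℕ :=
  sSup {m | ∃ M : (G.between S Sᶜ).Subgraph, M.IsMatching ∧ M.IsInduced ∧ m = M.edgeSet.ncard}

end Framework

/-- Rooted binary trees (every node that is not a leaf has two children) with labelled leaves. -/
inductive DTree (V : Type*)
  | leaf (v : V)
  | node (l r : DTree V)

namespace DTree

/-- The labels of the leaves, from left to right. -/
def leaves {V : Type*} : DTree V → List V
  | leaf v => [v]
  | node l r => l.leaves ++ r.leaves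

/-- `T` is a binary decomposition tree: its leaves are in bijection with `V`. -/
def IsDecomposition {V : Type*} (T : DTree V) : Prop :=
  T.leaves.Nodup ∧ ∀ v, v ∈ T.leaves

/-- The mim-width of a binary decomposition tree: the maximum over all its nodes `t` of
`mim(G, S)`, where `S` is the set of labels of the leaves below `t`. -/
noncomputable def mimWidth {V : Type*} [Fintype V] (G : SimpleGraph V) : DTree V → ℕ
  | leaf v => mim G {v}
  | node l r =>
      max (mim G {v | v ∈ (node l r).leaves}) (max (l.mimWidth G) (r.mimWidth G))

end DTree

/-! ## Computation model

Programs work on LISP-style data (binary trees, represented in memory by pointers), and every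
elementary operation takes one step. This is the WHILE language, whose polynomial-time computable
functions are those of Turing machines, in a variable-free form. -/

/-- Data: `nil` or a pair. -/
inductive Data
  | nil
  | cons (x y : Data)

namespace Data

/-- The first component (`nil` for `nil`). -/
def hd : Data → Data
  | nil => nil
  | cons x _ => x

/-- The second component (`nil` for `nil`). -/
def tl : Data → Data
  | nil => nil
  | cons _ y => y

/-- Lists as data. -/
def ofList : List Data → Data
  | [] => nil
  | x :: xs => cons x (ofList xs)

/-- Natural numbers as data, in unary. -/
def ofNat : ℕ → Data
  | 0 => nil
  | n + 1 => cons nil (ofNat n)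

open Classical in
/-- Truth values as data. -/
noncomputable def ofProp (p : Prop) : Data := if p then cons nil nil else nil

/-- Optional natural numbers as data. -/
def ofOption : Option ℕ → Data
  | none => nil
  | some j => cons nil (ofNat j)

/-- A graph with vertices `0, …, n - 1` as data: its adjacency matrix, row by row. -/
noncomputable def ofGraph {n : ℕ} (G : SimpleGraph (Fin n)) : Data :=
  ofList (List.ofFn fun i => ofList (List.ofFn fun j => ofProp (G.Adj i j)))

/-- A decomposition tree as data: nodes are pairs of a tag and the contents. -/
def ofTree {n : ℕ} : DTree (Fin n) → Data
  | DTree.leaf v => cons nil (ofNat v)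
  | DTree.node l r => cons (cons nil nil) (cons (ofTree l) (ofTree r))

end Data

/-- Programs. Each of them describes a partial function from data to data. -/
inductive Prog
  | nil
  | id
  | hd
  | tl
  | cons (f g : Prog)
  | comp (g f : Prog)
  | ite (b f g : Prog)
  | loop (b f : Prog)

/-- `Runs P x y t`: on input `x` the program `P` halts after exactly `t` steps with output `y`. -/
inductive Runs : Prog → Data → Data → ℕ → Prop
  | nil (x : Data) : Runs Prog.nil x Data.nil 1
  | id (x : Data) : Runs Prog.id x x 1
  | hd (x : Data) : Runs Prog.hd x x.hd 1
  | tl (x : Data) : Runs Prog.tl x x.tl 1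
  /-- The pair of the results of `f` and `g` on the same input. -/
  | cons {f g : Prog} {x y z : Data} {s t : ℕ} :
      Runs f x y s → Runs g x z t → Runs (Prog.cons f g) x (Data.cons y z) (s + t + 1)
  /-- First `f`, then `g` on the result. -/
  | comp {f g : Prog} {x y z : Data} {s t : ℕ} :
      Runs f x y s → Runs g y z t → Runs (Prog.comp g f) x z (s + t + 1)
  /-- If `b` does not return `nil` then `f`, else `g`. -/
  | ite_true {b f g : Prog} {x u w y : Data} {s t : ℕ} :
      Runs b x (Data.cons u w) s → Runs f x y t → Runs (Prog.ite b f g) x y (s + t + 1)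
  | ite_false {b f g : Prog} {x y : Data} {s t : ℕ} :
      Runs b x Data.nil s → Runs g x y t → Runs (Prog.ite b f g) x y (s + t + 1)
  /-- While `b` does not return `nil`, replace the input by the result of `f`. -/
  | loop_true {b f : Prog} {x u w y z : Data} {r s t : ℕ} :
      Runs b x (Data.cons u w) r → Runs f x y s → Runs (Prog.loop b f) y z t →
        Runs (Prog.loop b f) x z (r + s + t + 1)
  | loop_false {b f : Prog} {x : Data} {s : ℕ} :
      Runs b x Data.nil s → Runs (Prog.loop b f) x x (s + 1)

/-- The problem of computing `ans G` for a graph `G` is solvable in polynomial time on graphs of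
bounded mim-width, given a binary decomposition tree: there is a program that computes `ans G`
from `G` and a binary decomposition tree `T` of `G`, and for every `w` its number of steps is
bounded by a polynomial in the number of vertices if `T` has mim-width at most `w`. -/
def PolyTimeOnBoundedMimWidth (ans : {n : ℕ} → SimpleGraph (Fin n) → Data) : Prop :=
  ∃ P : Prog, ∀ w : ℕ, ∃ p : Polynomial ℕ,
    ∀ (n : ℕ) (G : SimpleGraph (Fin n)) (T : DTree (Fin n)),
      T.IsDecomposition → T.mimWidth G ≤ w →
        ∃ t ≤ p.eval n, Runs P (Data.cons (Data.ofGraph G) (Data.ofTree T)) (ans G) t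

end LC

/-! The translations into locally checkable problems are counting arguments. The Roman condition is
a lower bound `k` on a sum with non-negative coefficients, so counts above `k` are as good as `k`.
"Exactly one" is not affected by truncation at 2. In a b-colouring, one vertex per class that sees
all other classes is marked by the negative colour.

The algorithms are instances of one dynamic programme for `d`-stable problems with `q` colours. For
a set `S` of vertices below a node of the tree, a colouring of `S` influences the rest only through
its signature: for each vertex outside and each colour, the number of neighbours in `S` of that
colour, truncated at `d`. Symmetrically, the constraints at the vertices of `S` need from the rest
only its signature on `S`. A table therefore stores the triples of inner signature, outer signature
and a vector of additive weights that stem from colourings satisfying all constraints inside `S`.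
Truncated counts can be added, so tables for disjoint sets can be joined (`isTable_leafItem`,
`isTable_joinItem`). At the root the weight vectors are those of the proper colourings
(`mem_stats`): one component gives the Roman weight, `k` components count the colours `-1, …, -k`,
none is needed for conflict-free colouring.

The tables are small because of mim-width. A minimal subset of a colour class with the same
neighbours across the cut has a private neighbour for each of its elements, which is an induced
matching; so it has at most `w` elements (`MatchingLE.exists_dominating`). Taking such subsets `d`
times yields at most `d * w` vertices with the same truncated counts
(`MatchingLE.exists_representative`). A signature is thus determined by `q` sets of at most `d * w`
vertices, which leaves polynomially many (`exists_signatures_finset`).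

For the running time, `Ctx.Comp` says that one program computes a function in polynomial time with
output of polynomial size. The polynomials may depend on `w`, the program may not. This notion is
closed under the usual constructions, and under folds over lists as long as the intermediate results
stay polynomial (`Ctx.Comp.foldl`). The tree is flattened to postorder and evaluated by a stack
machine, which is such a fold (`Ctx.Comp.treeItem`). -/

namespace LC

/-! ## Polynomial-time computability relative to a family of inputs -/

/-- The number of pairs in a datum. -/
def Data.size : Data → ℕ
  | nil => 0
  | cons x y => x.size + y.size + 1

/-- Encodings of types as data. -/
class Enc (α : Type) where
  enc : α → Data

open Enc (enc)

instance : Enc Data := ⟨fun x => x⟩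
instance : Enc Unit := ⟨fun _ => Data.nil⟩
instance : Enc Bool := ⟨fun b => if b then Data.cons Data.nil Data.nil else Data.nil⟩
instance : Enc ℕ := ⟨Data.ofNat⟩
instance {α β : Type} [Enc α] [Enc β] : Enc (α × β) := ⟨fun p => Data.cons (enc p.1) (enc p.2)⟩
instance {α : Type} [Enc α] : Enc (List α) := ⟨fun l => Data.ofList (l.map enc)⟩

@[simp] theorem enc_data (x : Data) : enc x = x := rfl
theorem enc_pair {α β : Type} [Enc α] [Enc β] (x : α) (y : β) :
    enc (x, y) = Data.cons (enc x) (enc y) := rfl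
@[simp] theorem enc_true : enc true = Data.cons Data.nil Data.nil := rfl
@[simp] theorem enc_false : enc false = Data.nil := rfl
@[simp] theorem enc_nil {α : Type} [Enc α] : enc ([] : List α) = Data.nil := rfl
theorem enc_cons {α : Type} [Enc α] (x : α) (l : List α) :
    enc (x :: l) = Data.cons (enc x) (enc l) := rfl
@[simp] theorem enc_zero : enc 0 = Data.nil := rfl
theorem enc_succ (n : ℕ) : enc (n + 1) = Data.cons Data.nil (enc n) := rfl

/-- Unary numbers and lists of units are the same data, so iterating a number of times is a fold
over a list. -/
theorem enc_nat (n : ℕ) : enc n = enc (List.replicate n ()) := by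
  induction n with
  | zero => rfl
  | succ n ih => rw [enc_succ, ih]; rfl

theorem size_enc_list {α : Type} [Enc α] (l : List α) :
    (enc l).size = (l.map fun x => (enc x).size + 1).sum := by
  induction l with
  | nil => rfl
  | cons x l ih => rw [enc_cons, Data.size, ih]; simp; ring

theorem length_le_size {α : Type} [Enc α] (l : List α) : l.length ≤ (enc l).size := by
  induction l with
  | nil => simp
  | cons x l ih => rw [enc_cons, Data.size]; simp; omega

theorem size_le_of_mem {α : Type} [Enc α] {l : List α} {x : α} (h : x ∈ l) :
    (enc x).size ≤ (enc l).size := by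
  induction l with
  | nil => simp at h
  | cons y l ih =>
    rw [enc_cons, Data.size]
    rcases List.mem_cons.1 h with rfl | h
    · omega
    · have := ih h; omega

theorem size_enc_list_le {α : Type} [Enc α] (l : List α) (m : ℕ)
    (h : ∀ x ∈ l, (enc x).size ≤ m) : (enc l).size ≤ l.length * (m + 1) := by
  rw [size_enc_list]
  have := List.sum_le_card_nsmul (l.map fun x => (enc x).size + 1) (m + 1) (by
    intro y hy
    obtain ⟨x, hx, rfl⟩ := List.mem_map.1 hy
    have := h x hx
    omega)
  simpa using this

theorem size_enc_nat (n : ℕ) : (enc n).size = n := by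
  induction n with
  | zero => rfl
  | succ n ih => rw [enc_succ, Data.size, ih]; simp [Data.size]

/-- A family of inputs `inp i` of programs. The bounds on the resources are polynomials in `sz i`,
which may depend on the parameter `w` as long as `i` lies in the domain for `w`. -/
structure Ctx (I : Type) where
  dom : ℕ → I → Prop
  sz : I → ℕ
  inp : I → Data

namespace Ctx

variable {I : Type} (Γ : Ctx I)

/-- `f` is bounded by a polynomial in the size, for every `w`. -/
def Bdd (f : I → ℕ) : Prop :=
  ∀ w, ∃ p : Polynomial ℕ, ∀ i, Γ.dom w i → f i ≤ p.eval (Γ.sz i)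

/-- `P` computes `b i` from `a i` in polynomial time. -/
def Timed (P : Prog) (a b : I → Data) : Prop :=
  ∀ w, ∃ p : Polynomial ℕ, ∀ i, Γ.dom w i → ∃ t ≤ p.eval (Γ.sz i), Runs P (a i) (b i) t

/-- Extend the input by a local variable that satisfies `Q`. -/
def push {α : Type} [Enc α] (Q : I → α → Prop) : Ctx (I × α) where
  dom w p := Γ.dom w p.1 ∧ Q p.1 p.2
  sz p := Γ.sz p.1
  inp p := Data.cons (enc p.2) (Γ.inp p.1)

/-- Restrict the domain to the inputs that satisfy `D`. -/
def restrict (D : I → Prop) : Ctx I where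
  dom w i := Γ.dom w i ∧ D i
  sz := Γ.sz
  inp := Γ.inp

variable {Γ}

theorem Bdd.mono {f g : I → ℕ} (hg : Γ.Bdd g) (h : ∀ w i, Γ.dom w i → f i ≤ g i) : Γ.Bdd f := by
  intro w
  obtain ⟨p, hp⟩ := hg w
  exact ⟨p, fun i hi => (h w i hi).trans (hp i hi)⟩

theorem Bdd.const (n : ℕ) : Γ.Bdd fun _ => n := fun _ => ⟨Polynomial.C n, fun i _ => by simp⟩

theorem Bdd.sz : Γ.Bdd Γ.sz := fun _ => ⟨Polynomial.X, fun i _ => by simp⟩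

theorem Bdd.add {f g : I → ℕ} (hf : Γ.Bdd f) (hg : Γ.Bdd g) : Γ.Bdd fun i => f i + g i := by
  intro w
  obtain ⟨p, hp⟩ := hf w
  obtain ⟨q, hq⟩ := hg w
  refine ⟨p + q, fun i hi => ?_⟩
  rw [Polynomial.eval_add]
  exact add_le_add (hp i hi) (hq i hi)

theorem Bdd.mul {f g : I → ℕ} (hf : Γ.Bdd f) (hg : Γ.Bdd g) : Γ.Bdd fun i => f i * g i := by
  intro w
  obtain ⟨p, hp⟩ := hf w
  obtain ⟨q, hq⟩ := hg w
  refine ⟨p * q, fun i hi => ?_⟩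
  rw [Polynomial.eval_mul]
  exact Nat.mul_le_mul (hp i hi) (hq i hi)

theorem Bdd.push {α : Type} [Enc α] {Q : I → α → Prop} {f : I → ℕ} (hf : Γ.Bdd f) :
    (Γ.push Q).Bdd fun p => f p.1 := by
  intro w
  obtain ⟨p, hp⟩ := hf w
  exact ⟨p, fun i hi => hp i.1 hi.1⟩

/-- A bound in an extended context is a bound that is uniform in the local variable. -/
theorem Bdd.uniform {α : Type} [Enc α] {Q : I → α → Prop} {f : I → α → ℕ} {F : I → ℕ}
    (hf : (Γ.push Q).Bdd fun p => f p.1 p.2)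
    (h : ∀ w i m, Γ.dom w i → (∀ x, Q i x → f i x ≤ m) → F i ≤ m) : Γ.Bdd F := by
  intro w
  obtain ⟨p, hp⟩ := hf w
  exact ⟨p, fun i hi => h w i _ hi fun x hx => hp (i, x) ⟨hi, hx⟩⟩

theorem Timed.push {α : Type} [Enc α] {Q : I → α → Prop} {P : Prog} {a b : I → Data}
    (h : Γ.Timed P a b) : (Γ.push Q).Timed P (fun p => a p.1) (fun p => b p.1) := by
  intro w
  obtain ⟨p, hp⟩ := h w
  exact ⟨p, fun i hi => hp i.1 hi.1⟩

theorem Timed.of_const {P : Prog} {a b : I → Data} (m : ℕ) (h : ∀ i, Runs P (a i) (b i) m) :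
    Γ.Timed P a b :=
  fun _ => ⟨Polynomial.C m, fun i _ => ⟨m, by simp, h i⟩⟩

theorem Timed.id (a : I → Data) : Γ.Timed Prog.id a a := .of_const 1 fun _ => .id _
theorem Timed.hd (a : I → Data) : Γ.Timed Prog.hd a fun i => (a i).hd :=
  .of_const 1 fun _ => .hd _
theorem Timed.tl (a : I → Data) : Γ.Timed Prog.tl a fun i => (a i).tl :=
  .of_const 1 fun _ => .tl _
theorem Timed.nil (a : I → Data) : Γ.Timed Prog.nil a fun _ => Data.nil :=
  .of_const 1 fun _ => .nil _

theorem Timed.cons {P Q : Prog} {a b c : I → Data} (hP : Γ.Timed P a b) (hQ : Γ.Timed Q a c) :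
    Γ.Timed (Prog.cons P Q) a fun i => Data.cons (b i) (c i) := by
  intro w
  obtain ⟨p, hp⟩ := hP w
  obtain ⟨q, hq⟩ := hQ w
  refine ⟨p + q + 1, fun i hi => ?_⟩
  obtain ⟨s, hs, h1⟩ := hp i hi
  obtain ⟨t, ht, h2⟩ := hq i hi
  exact ⟨s + t + 1, by simp; omega, h1.cons h2⟩

theorem Timed.comp {P Q : Prog} {a b c : I → Data} (hP : Γ.Timed P a b) (hQ : Γ.Timed Q b c) :
    Γ.Timed (Prog.comp Q P) a c := by
  intro w
  obtain ⟨p, hp⟩ := hP w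
  obtain ⟨q, hq⟩ := hQ w
  refine ⟨p + q + 1, fun i hi => ?_⟩
  obtain ⟨s, hs, h1⟩ := hp i hi
  obtain ⟨t, ht, h2⟩ := hq i hi
  exact ⟨s + t + 1, by simp; omega, h1.comp h2⟩

/-- Branching, where each branch has to be correct only where it is taken. -/
theorem Timed.ite {B P Q : Prog} {a b c : I → Data} (hB : Γ.Timed B a b)
    (hP : (Γ.restrict fun i => b i ≠ Data.nil).Timed P a c)
    (hQ : (Γ.restrict fun i => b i = Data.nil).Timed Q a c) :
    Γ.Timed (Prog.ite B P Q) a c := by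
  intro w
  obtain ⟨r, hr⟩ := hB w
  obtain ⟨p, hp⟩ := hP w
  obtain ⟨q, hq⟩ := hQ w
  refine ⟨r + p + q + 1, fun i hi => ?_⟩
  obtain ⟨s, hs, h0⟩ := hr i hi
  rcases hb : b i with _ | ⟨x, y⟩
  · obtain ⟨t, ht, h1⟩ := hq i ⟨hi, hb⟩
    rw [hb] at h0
    change t ≤ q.eval (Γ.sz i) at ht
    exact ⟨s + t + 1, by simp at *; omega, h0.ite_false h1⟩
  · obtain ⟨t, ht, h1⟩ := hp i ⟨hi, by simp [hb]⟩
    rw [hb] at h0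
    change t ≤ p.eval (Γ.sz i) at ht
    exact ⟨s + t + 1, by simp at *; omega, h0.ite_true h1⟩

/-- `f i` can be computed in polynomial time from the input, and has polynomial size. -/
def Comp (Γ : Ctx I) {α : Type} [Enc α] (f : I → α) : Prop :=
  Γ.Bdd (fun i => (enc (f i)).size) ∧ ∃ P, Γ.Timed P Γ.inp fun i => enc (f i)

variable {α β γ : Type} [Enc α] [Enc β] [Enc γ]

/-- Programs see only encodings, so a change of type that leaves the encoding alone costs nothing.
Successors, list constructors and tree destructors are obtained in this way. -/
theorem Comp.of_enc {f : I → α} {g : I → β} (hf : Γ.Comp f)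
    (h : ∀ w i, Γ.dom w i → enc (g i) = enc (f i)) : Γ.Comp g := by
  obtain ⟨hs, P, hP⟩ := hf
  refine ⟨hs.mono fun w i hi => by rw [h w i hi], P, fun w => ?_⟩
  obtain ⟨p, hp⟩ := hP w
  exact ⟨p, fun i hi => by simpa only [h w i hi] using hp i hi⟩

theorem Comp.congr {f g : I → α} (hf : Γ.Comp f) (h : ∀ w i, Γ.dom w i → g i = f i) :
    Γ.Comp g :=
  hf.of_enc fun w i hi => by rw [h w i hi]

theorem Comp.restrict {f : I → α} {D : I → Prop} (hf : Γ.Comp f) : (Γ.restrict D).Comp f := by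
  obtain ⟨hs, P, hP⟩ := hf
  refine ⟨fun w => ?_, P, fun w => ?_⟩
  · obtain ⟨p, hp⟩ := hs w
    exact ⟨p, fun i hi => hp i hi.1⟩
  · obtain ⟨p, hp⟩ := hP w
    exact ⟨p, fun i hi => hp i hi.1⟩

theorem Comp.const (c : α) : Γ.Comp fun _ => c := by
  refine ⟨Bdd.const _, ?_⟩
  suffices ∀ d : Data, ∃ P, Γ.Timed P Γ.inp fun _ => d from this _
  intro d
  induction d with
  | nil => exact ⟨_, Timed.nil _⟩
  | cons x y hx hy =>
    obtain ⟨P, hP⟩ := hx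
    obtain ⟨Q, hQ⟩ := hy
    exact ⟨_, hP.cons hQ⟩

theorem Comp.pair {f : I → α} {g : I → β} (hf : Γ.Comp f) (hg : Γ.Comp g) :
    Γ.Comp fun i => (f i, g i) := by
  obtain ⟨hs, P, hP⟩ := hf
  obtain ⟨ht, Q, hQ⟩ := hg
  exact ⟨(hs.add ht).add (Bdd.const 1), _, hP.cons hQ⟩

theorem Comp.cons {f : I → α} {g : I → List α} (hf : Γ.Comp f) (hg : Γ.Comp g) :
    Γ.Comp fun i => f i :: g i :=
  (hf.pair hg).of_enc fun _ _ _ => rfl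

theorem Comp.succ {f : I → ℕ} (hf : Γ.Comp f) : Γ.Comp fun i => f i + 1 :=
  ((Comp.const ()).pair hf).of_enc fun _ _ _ => rfl

theorem Comp.fst {f : I → α × β} (hf : Γ.Comp f) : Γ.Comp fun i => (f i).1 := by
  obtain ⟨hs, P, hP⟩ := hf
  exact ⟨hs.mono fun w i _ => by
    change (enc (f i).1).size ≤ (enc (f i).1).size + (enc (f i).2).size + 1
    omega, _, hP.comp (Timed.hd _)⟩

theorem Comp.snd {f : I → α × β} (hf : Γ.Comp f) : Γ.Comp fun i => (f i).2 := by
  obtain ⟨hs, P, hP⟩ := hf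
  exact ⟨hs.mono fun w i _ => by
    change (enc (f i).2).size ≤ (enc (f i).1).size + (enc (f i).2).size + 1
    omega, _, hP.comp (Timed.tl _)⟩

theorem Comp.weaken {Q : I → β → Prop} {f : I → α} (hf : Γ.Comp f) :
    (Γ.push Q).Comp fun p => f p.1 := by
  obtain ⟨hs, P, hP⟩ := hf
  exact ⟨hs.push, _, (Timed.tl (Γ := Γ.push Q) (Γ.push Q).inp).comp hP.push⟩

/-- Reading the local variable is a single step; the only thing to supply is a bound on its size,
which has to come from `Q`. -/
theorem Comp.var {Q : I → α → Prop} (h : (Γ.push Q).Bdd fun p => (enc p.2).size) :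
    (Γ.push Q).Comp fun p => p.2 :=
  ⟨h, _, Timed.hd _⟩

/-- This is a `let`: the value of `a` is put in front of the input and the body is run on the pair.
The body has to be correct only for values with the property `Q`. -/
theorem Comp.bind {Q : I → α → Prop} {a : I → α} {f : I → α → β} (ha : Γ.Comp a)
    (hQ : ∀ w i, Γ.dom w i → Q i (a i)) (hf : (Γ.push Q).Comp fun p => f p.1 p.2) :
    Γ.Comp fun i => f i (a i) := by
  obtain ⟨hs, P, hP⟩ := ha
  obtain ⟨ht, R, hR⟩ := hf
  have aux : Γ.Timed R (fun i => Data.cons (enc (a i)) (Γ.inp i)) fun i => enc (f i (a i)) := by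
    intro w
    obtain ⟨p, hp⟩ := hR w
    exact ⟨p, fun i hi => hp (i, a i) ⟨hi, hQ w i hi⟩⟩
  refine ⟨?_, _, (hP.cons (Timed.id _)).comp aux⟩
  exact ht.uniform (f := fun i x => (enc (f i x)).size) fun w i m hi h => h _ (hQ w i hi)

/-- Substitute a term in an extended context for the local variable of a body. -/
theorem Comp.subst {Q : I → α → Prop} {R : I → γ → Prop} {f : I → α → β} {a : I × γ → α}
    (hf : (Γ.push Q).Comp fun p => f p.1 p.2) (ha : (Γ.push R).Comp a)
    (hQ : ∀ w i x, Γ.dom w i → R i x → Q i (a (i, x))) :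
    (Γ.push R).Comp fun p => f p.1 (a p) := by
  refine Comp.bind (Q := fun p x => Q p.1 x) (f := fun p x => f p.1 x) ha
    (fun w p hp => hQ w p.1 p.2 hp.1 hp.2) ?_
  obtain ⟨hs, P, hP⟩ := hf
  -- The input is nested as `(value of a, (local variable, input))`; the program removes the
  -- variable in the middle, which the body does not expect.
  refine ⟨fun w => ?_, Prog.comp P (Prog.cons Prog.hd (Prog.comp Prog.tl Prog.tl)),
    Timed.comp ((Timed.hd _).cons ((Timed.tl _).comp (Timed.tl _))) fun w => ?_⟩
  · obtain ⟨p, hp⟩ := hs w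
    exact ⟨p, fun i hi => hp (i.1.1, i.2) ⟨hi.1.1, hi.2⟩⟩
  · obtain ⟨p, hp⟩ := hP w
    exact ⟨p, fun i hi => hp (i.1.1, i.2) ⟨hi.1.1, hi.2⟩⟩

/-- Branching, where each branch has to be computable only where it is taken. -/
theorem Comp.iteRestrict {b : I → Bool} {f g : I → α} (hb : Γ.Comp b)
    (hf : (Γ.restrict fun i => b i = true).Comp f)
    (hg : (Γ.restrict fun i => b i = false).Comp g) :
    Γ.Comp fun i => if b i then f i else g i := by
  obtain ⟨-, B, hB⟩ := hb
  obtain ⟨hs, P, hP⟩ := hf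
  obtain ⟨ht, R, hR⟩ := hg
  refine ⟨fun w => ?_, _, hB.ite (P := P) (Q := R) (fun w => ?_) fun w => ?_⟩
  · obtain ⟨p, hp⟩ := hs w
    obtain ⟨q, hq⟩ := ht w
    refine ⟨p + q, fun i hi => ?_⟩
    rw [Polynomial.eval_add]
    cases h : b i
    · simp only [h, Bool.false_eq_true, if_false]
      exact (hq i ⟨hi, h⟩).trans (Nat.le_add_left _ _)
    · simp only [h, if_true]
      exact (hp i ⟨hi, h⟩).trans (Nat.le_add_right _ _)
  · obtain ⟨p, hp⟩ := hP w
    refine ⟨p, fun i hi => ?_⟩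
    have : b i = true := by
      cases h : b i
      · exact absurd (by simp [h]) hi.2
      · rfl
    simp only [this, if_true]
    exact hp i ⟨hi.1, this⟩
  · obtain ⟨p, hp⟩ := hR w
    refine ⟨p, fun i hi => ?_⟩
    have : b i = false := by
      cases h : b i
      · rfl
      · exact absurd hi.2 (by simp [h])
    simp only [this, Bool.false_eq_true, if_false]
    exact hp i ⟨hi.1, this⟩

theorem Comp.ite {b : I → Bool} {f g : I → α} (hb : Γ.Comp b) (hf : Γ.Comp f) (hg : Γ.Comp g) :
    Γ.Comp fun i => if b i then f i else g i :=
  hb.iteRestrict hf.restrict hg.restrict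

/-- Case distinction on whether a datum is `nil`. -/
theorem Comp.dataCases {a : I → α} {Q : I → β → Prop} {f : I → γ}
    (ha : Γ.Comp a)
    (h0 : (Γ.restrict fun i => enc (a i) = Data.nil).Comp f)
    {h : I → β → γ} (h1 : (Γ.push Q).Comp fun p => h p.1 p.2)
    (hQ : ∀ w i, Γ.dom w i → enc (a i) ≠ Data.nil → ∃ x, Q i x ∧ enc x = enc (a i) ∧ f i = h i x) :
    Γ.Comp f := by
  obtain ⟨hs, A, hA⟩ := ha
  obtain ⟨hs0, P, hP⟩ := h0
  obtain ⟨hs1, R, hR⟩ := h1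
  -- In the branch where the datum is not `nil`, it is itself pushed as the local variable: by `hQ`
  -- it is also the encoding of some `x` of type `β`.
  refine ⟨?_, _, hA.ite (P := Prog.comp R (Prog.cons A Prog.id)) (Q := P) ?_ hP⟩
  · intro w
    obtain ⟨p, hp⟩ := hs0 w
    obtain ⟨q, hq⟩ := hs1 w
    refine ⟨p + q, fun i hi => ?_⟩
    rw [Polynomial.eval_add]
    by_cases hn : enc (a i) = Data.nil
    · exact (hp i ⟨hi, hn⟩).trans (Nat.le_add_right _ _)
    · obtain ⟨x, hx, -, he⟩ := hQ w i hi hn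
      beta_reduce
      rw [he]
      exact (hq (i, x) ⟨hi, hx⟩).trans (Nat.le_add_left _ _)
  · refine Timed.comp (b := fun i => Data.cons (enc (a i)) (Γ.inp i)) (Timed.cons ?_ (Timed.id _)) ?_
    · intro w
      obtain ⟨p, hp⟩ := hA w
      exact ⟨p, fun i hi => hp i hi.1⟩
    · intro w
      obtain ⟨p, hp⟩ := hR w
      refine ⟨p, fun i hi => ?_⟩
      obtain ⟨x, hx, hxe, he⟩ := hQ w i hi.1 hi.2
      have := hp (i, x) ⟨hi.1, hx⟩
      simp only [he, ← hxe]
      exact this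

theorem Comp.listCases {l : I → List α} {f : I → β} {g : I → α × List α → β} (hl : Γ.Comp l)
    (hf : Γ.Comp f) (hg : (Γ.push fun i (p : α × List α) => l i = p.1 :: p.2).Comp
      fun p => g p.1 p.2) :
    Γ.Comp fun i => match l i with
      | [] => f i
      | x :: xs => g i (x, xs) := by
  refine Comp.dataCases hl (h := g) (hf.restrict.congr ?_) hg ?_
  · rintro w i ⟨-, h⟩
    rcases hi : l i with _ | ⟨x, xs⟩
    · rfl
    · rw [hi, enc_cons] at h; cases h
  · intro w i _ h
    rcases hi : l i with _ | ⟨x, xs⟩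
    · rw [hi] at h; exact absurd rfl h
    · exact ⟨(x, xs), by simp, rfl, rfl⟩

/-- The encoding of `x + 1` is that of the pair `((), x)`, so this is a case distinction on data
with a local variable of type `Unit × ℕ`. -/
theorem Comp.natCases {m : I → ℕ} {f : I → β} {g : I → ℕ → β} (hm : Γ.Comp m)
    (hf : Γ.Comp f) (hg : (Γ.push fun i x => m i = x + 1).Comp fun p => g p.1 p.2) :
    Γ.Comp fun i => match m i with
      | 0 => f i
      | x + 1 => g i x := by
  have hg' : (Γ.push fun i (p : Unit × ℕ) => m i = p.2 + 1).Comp fun p => g p.1 p.2.2 := by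
    have hv : (Γ.push fun i (p : Unit × ℕ) => m i = p.2 + 1).Comp fun p => p.2.2 := by
      refine Comp.snd (Comp.var ((hm.1.push (Q := fun i (p : Unit × ℕ) => m i = p.2 + 1)).mono ?_))
      rintro w ⟨i, u, x⟩ ⟨-, h⟩
      simp only at h ⊢
      rw [h, enc_succ, enc_pair]
      exact le_rfl
    exact hg.subst hv fun w i x _ h => h
  refine Comp.dataCases hm (h := fun i (p : Unit × ℕ) => g i p.2) (hf.restrict.congr ?_) hg' ?_
  · rintro w i ⟨-, h⟩
    rcases hi : m i with _ | x
    · rfl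
    · rw [hi, enc_succ] at h; cases h
  · intro w i _ h
    rcases hi : m i with _ | x
    · rw [hi] at h; exact absurd rfl h
    · exact ⟨((), x), by simp, rfl, rfl⟩

end Ctx

/-- The program that folds over a list: the state is `(accumulator, remaining list, environment)`,
and `P` maps `((accumulator, element), environment)` to the new accumulator. -/
def foldProg (P : Prog) : Prog :=
  .loop (.comp .hd .tl)
    (.cons (.comp P (.cons (.cons .hd (.comp .hd (.comp .hd .tl))) (.comp .tl .tl)))
      (.cons (.comp .tl (.comp .hd .tl)) (.comp .tl .tl)))

/-- The body must be correct and fast only at the states that the fold really reaches, that is,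
after prefixes of the list; this lets invariants bound its cost. The 30 covers the bookkeeping of
one round and the 4 the final test. -/
theorem runs_foldProg {α β : Type} [Enc α] [Enc β] {P : Prog} {env : Data} {f : β → α → β} {m : ℕ}
    (l : List α) (s : β)
    (h : ∀ pre x post, l = pre ++ x :: post → ∃ t ≤ m,
      Runs P (Data.cons (enc (pre.foldl f s, x)) env) (enc (f (pre.foldl f s) x)) t) :
    ∃ t ≤ l.length * (m + 30) + 4,
      Runs (foldProg P) (Data.cons (enc s) (Data.cons (enc l) env))
        (Data.cons (enc (l.foldl f s)) (Data.cons Data.nil env)) t := by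
  induction l generalizing s with
  | nil =>
    refine ⟨_, ?_, .loop_false (.comp (.tl _) (.hd _))⟩
    omega
  | cons x l ih =>
    obtain ⟨t, ht, hr⟩ := ih (f s x) fun pre y post hp => h (x :: pre) y post (by simp [hp])
    obtain ⟨t', ht', hr'⟩ := h [] x l rfl
    refine ⟨_, ?_, .loop_true (.comp (.tl _) (.hd _))
      (.cons (.comp (.cons (.cons (.hd _) (.comp (.comp (.tl _) (.hd _)) (.hd _)))
        (.comp (.tl _) (.tl _))) hr')
        (.cons (.comp (.comp (.tl _) (.hd _)) (.tl _)) (.comp (.tl _) (.tl _)))) hr⟩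
    simp only [List.length_cons]
    ring_nf at ht ⊢
    omega

namespace Ctx

variable {I : Type} {Γ : Ctx I} {α β γ : Type} [Enc α] [Enc β] [Enc γ]

/-- The state of a fold after a prefix of the list, together with the next element. -/
def FoldState (l : List α) (s : β) (f : β → α → β) (p : β × α) : Prop :=
  ∃ pre post, l = pre ++ p.2 :: post ∧ p.1 = pre.foldl f s

/-- The number of rounds is at most the size of the list. The result is either the start value or an
output of the body at a state with property `Q`, so its size is bounded without further assumptions;
the sizes of the intermediate states are accounted for by the computability of the body under `Q`.
-/
theorem Comp.foldl {l : I → List α} {s : I → β} {f : I → β → α → β} {Q : I → β × α → Prop}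
    (hl : Γ.Comp l) (hs : Γ.Comp s)
    (hf : (Γ.push Q).Comp fun p => f p.1 p.2.1 p.2.2)
    (hQ : ∀ w i p, Γ.dom w i → FoldState (l i) (s i) (f i) p → Q i p) :
    Γ.Comp fun i => (l i).foldl (f i) (s i) := by
  obtain ⟨hsl, L, hL⟩ := hl
  obtain ⟨hss, S, hS⟩ := hs
  obtain ⟨hsf, F, hF⟩ := hf
  constructor
  · intro w
    obtain ⟨p, hp⟩ := hss w
    obtain ⟨q, hq⟩ := hsf w
    refine ⟨p + q, fun i hi => ?_⟩
    rw [Polynomial.eval_add]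
    rcases List.eq_nil_or_concat (l i) with h | ⟨pre, x, h⟩
    · beta_reduce
      rw [h]
      exact (hp i hi).trans (Nat.le_add_right _ _)
    · refine le_trans ?_ (Nat.le_add_left _ _)
      have := hq (i, (pre.foldl (f i) (s i), x)) ⟨hi, hQ w i _ hi ⟨pre, [], by simp [h], rfl⟩⟩
      simp only [h, List.concat_eq_append, List.foldl_append, List.foldl_cons, List.foldl_nil]
      exact this
  · refine ⟨_, ((hS.cons (hL.cons (Timed.id _))).comp (Q := foldProg F)
      (c := fun i => Data.cons (enc ((l i).foldl (f i) (s i))) (Data.cons Data.nil (Γ.inp i))) ?_).comp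
      (Timed.hd _)⟩
    intro w
    obtain ⟨p, hp⟩ := hF w
    obtain ⟨q, hq⟩ := hsl w
    refine ⟨q * (p + 30) + 4, fun i hi => ?_⟩
    obtain ⟨t, ht, hr⟩ := runs_foldProg (P := F) (env := Γ.inp i) (f := f i)
      (m := p.eval (Γ.sz i)) (l i) (s i) (by
        intro pre x post h
        exact hp (i, (pre.foldl (f i) (s i), x)) ⟨hi, hQ w i _ hi ⟨pre, post, h, rfl⟩⟩)
    refine ⟨t, ht.trans ?_, hr⟩
    have h1 := (length_le_size (l i)).trans (hq i hi)
    simp only [Polynomial.eval_add, Polynomial.eval_mul, Polynomial.eval_ofNat]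
    gcongr

end Ctx
end LC

/-! ### List operations and arithmetic in polynomial time. -/

open LC.Enc (enc)
namespace LC
namespace Ctx

variable {I : Type} {Γ : Ctx I} {α β γ : Type} [Enc α] [Enc β] [Enc γ]

theorem Comp.varMem {l : I → List α} (hl : Γ.Comp l) :
    (Γ.push fun i x => x ∈ l i).Comp fun p => p.2 :=
  Comp.var (hl.1.push.mono fun _ _ h => size_le_of_mem h.2)

theorem Comp.varCons {l : I → List α} (hl : Γ.Comp l) :
    (Γ.push fun i (p : α × List α) => l i = p.1 :: p.2).Comp fun p => p.2 :=
  Comp.var (hl.1.push.mono fun _ p h => by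
    rw [show l p.1 = p.2.1 :: p.2.2 from h.2]
    exact le_rfl)

theorem Comp.varPred {m : I → ℕ} (hm : Γ.Comp m) :
    (Γ.push fun i x => m i = x + 1).Comp fun p => p.2 :=
  Comp.var (hm.1.push.mono fun _ p h => by
    rw [show m p.1 = p.2 + 1 from h.2]
    simp only [size_enc_nat]
    omega)

/-- What is known about the accumulator and the current element in a fold with accumulators of size
at most `S`. -/
def FoldQ (l : I → List α) (S : I → ℕ) (i : I) (p : β × α) : Prop :=
  (enc p.1).size ≤ S i ∧ p.2 ∈ l i

theorem Comp.varFold {l : I → List α} {S : I → ℕ} (hl : Γ.Comp l) (hS : Γ.Bdd S) :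
    (Γ.push (FoldQ (β := β) l S)).Comp fun p => p.2 :=
  Comp.var (((hS.add hl.1).add (Bdd.const 1)).push.mono fun _ p h => by
    have h1 : (enc p.2.1).size ≤ S p.1 := h.2.1
    have h2 := size_le_of_mem h.2.2
    change (enc p.2.1).size + (enc p.2.2).size + 1 ≤ _
    omega)

/-- Repeating a polynomial-time step can square the size in every round, hence the explicit bound
`S` on the accumulator after each prefix. -/
theorem Comp.foldlBdd {l : I → List α} {s : I → β} {f : I → β → α → β} {S : I → ℕ}
    (hl : Γ.Comp l) (hs : Γ.Comp s) (_ : Γ.Bdd S)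
    (hsize : ∀ w i pre, Γ.dom w i → pre <+: l i → (enc (pre.foldl (f i) (s i))).size ≤ S i)
    (hf : (Γ.push (FoldQ l S)).Comp fun p => f p.1 p.2.1 p.2.2) :
    Γ.Comp fun i => (l i).foldl (f i) (s i) := by
  refine Comp.foldl hl hs hf ?_
  rintro w i ⟨b, x⟩ hi ⟨pre, post, h, rfl⟩
  exact ⟨hsize w i pre hi ⟨_, h.symm⟩, by simp only at h ⊢; simp [h]⟩

theorem Bdd.length {l : I → List α} (hl : Γ.Comp l) : Γ.Bdd fun i => (l i).length :=
  hl.1.mono fun _ i _ => length_le_size (l i)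

theorem Bdd.nat {m : I → ℕ} (hm : Γ.Comp m) : Γ.Bdd m :=
  hm.1.mono fun _ i _ => (size_enc_nat (m i)).ge

theorem Comp.reverse {l : I → List α} (hl : Γ.Comp l) : Γ.Comp fun i => (l i).reverse := by
  have : Γ.Comp fun i => (l i).foldl (fun acc x => x :: acc) [] := by
    refine Comp.foldlBdd hl (Comp.const []) hl.1 ?_ ?_
    · rintro w i pre _ ⟨post, h⟩
      rw [← h, List.foldl_flip_cons_eq_append']
      simp only [size_enc_list, List.map_append, List.sum_append, List.map_reverse,
        List.sum_reverse]
      simp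
    · exact (Comp.varFold hl hl.1).snd.cons (Comp.varFold hl hl.1).fst
  exact this.congr fun w i _ => by simp

theorem Comp.map {l : I → List α} {f : I → α → β} (hl : Γ.Comp l)
    (hf : (Γ.push fun i x => x ∈ l i).Comp fun p => f p.1 p.2) :
    Γ.Comp fun i => (l i).map (f i) := by
  have hS : Γ.Bdd fun i => (enc ((l i).map (f i))).size := by
    intro w
    obtain ⟨p, hp⟩ := hf.1 w
    obtain ⟨q, hq⟩ := Bdd.length hl w
    refine ⟨q * (p + 1), fun i hi => ?_⟩
    refine (size_enc_list_le _ (p.eval (Γ.sz i)) ?_).trans ?_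
    · intro y hy
      obtain ⟨x, hx, rfl⟩ := List.mem_map.1 hy
      exact hp (i, x) ⟨hi, hx⟩
    · simp only [List.length_map, Polynomial.eval_mul, Polynomial.eval_add, Polynomial.eval_one]
      exact Nat.mul_le_mul_right _ (hq i hi)
  have aux : ∀ i (pre : List α), pre.foldl (fun acc x => f i x :: acc) [] =
      (pre.map (f i)).reverse := by
    intro i pre
    induction pre using List.reverseRecOn with
    | nil => rfl
    | append_singleton pre x ih => simp [ih]
  have : Γ.Comp fun i => (l i).foldl (fun acc x => f i x :: acc) [] := by
    refine Comp.foldlBdd (f := fun i acc x => f i x :: acc) hl (Comp.const []) hS ?_ ?_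
    · rintro w i pre _ ⟨post, h⟩
      rw [← h, aux]
      simp only [size_enc_list, List.map_append, List.sum_append, List.map_reverse,
        List.sum_reverse]
      simp
    · refine Comp.cons ?_ (Comp.varFold hl hS).fst
      exact hf.subst (Comp.varFold hl hS).snd fun w i x _ h => h.2
  exact this.reverse.congr fun w i _ => by simp [aux]

theorem Comp.append {l m : I → List α} (hl : Γ.Comp l) (hm : Γ.Comp m) :
    Γ.Comp fun i => l i ++ m i := by
  have hS : Γ.Bdd fun i => (enc (l i)).size + (enc (m i)).size := hl.1.add hm.1
  have : Γ.Comp fun i => (l i).reverse.foldl (fun acc x => x :: acc) (m i) := by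
    refine Comp.foldlBdd hl.reverse hm hS ?_ ?_
    · rintro w i pre _ ⟨post, h⟩
      have h' : l i = post.reverse ++ pre.reverse := by
        rw [← List.reverse_append, h, List.reverse_reverse]
      rw [h', List.foldl_flip_cons_eq_append']
      simp only [size_enc_list, List.map_append, List.sum_append, List.map_reverse,
        List.sum_reverse]
      omega
    · exact (Comp.varFold hl.reverse hS).snd.cons (Comp.varFold hl.reverse hS).fst
  exact this.congr fun w i _ => by simp

theorem Comp.flatten {l : I → List (List α)} (hl : Γ.Comp l) : Γ.Comp fun i => (l i).flatten := by
  have aux : ∀ pre : List (List α), pre.foldl (· ++ ·) [] = pre.flatten := by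
    intro pre
    induction pre using List.reverseRecOn with
    | nil => rfl
    | append_singleton pre x ih => simp [ih]
  have hle : ∀ l : List (List α), (enc l.flatten).size ≤ (enc l).size := by
    intro l
    induction l with
    | nil => simp
    | cons x l ih =>
      rw [enc_cons, Data.size, List.flatten_cons, size_enc_list, List.map_append, List.sum_append,
        ← size_enc_list, ← size_enc_list]
      omega
  have : Γ.Comp fun i => (l i).foldl (· ++ ·) [] := by
    refine Comp.foldlBdd hl (Comp.const []) hl.1 ?_ ?_
    · rintro w i pre _ ⟨post, h⟩
      rw [aux, ← h]
      refine (hle _).trans ?_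
      simp only [size_enc_list, List.map_append, List.sum_append]
      omega
    · exact (Comp.varFold hl hl.1).fst.append (Comp.varFold hl hl.1).snd
  exact this.congr fun w i _ => (aux _).symm

theorem Comp.flatMap {l : I → List α} {f : I → α → List β} (hl : Γ.Comp l)
    (hf : (Γ.push fun i x => x ∈ l i).Comp fun p => f p.1 p.2) :
    Γ.Comp fun i => (l i).flatMap (f i) :=
  (hl.map hf).flatten.congr fun _ _ _ => List.flatMap_def

theorem Comp.or {a b : I → Bool} (ha : Γ.Comp a) (hb : Γ.Comp b) : Γ.Comp fun i => a i || b i :=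
  (ha.ite (Comp.const true) hb).congr fun w i _ => by cases a i <;> rfl

theorem Comp.and {a b : I → Bool} (ha : Γ.Comp a) (hb : Γ.Comp b) : Γ.Comp fun i => a i && b i :=
  (ha.ite hb (Comp.const false)).congr fun w i _ => by cases a i <;> rfl

theorem Comp.not {a : I → Bool} (ha : Γ.Comp a) : Γ.Comp fun i => !a i :=
  (ha.ite (Comp.const false) (Comp.const true)).congr fun w i _ => by cases a i <;> rfl

theorem Comp.any {l : I → List α} {f : I → α → Bool} (hl : Γ.Comp l)
    (hf : (Γ.push fun i x => x ∈ l i).Comp fun p => f p.1 p.2) :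
    Γ.Comp fun i => (l i).any (f i) := by
  have hm := hl.map hf
  have hS : Γ.Bdd fun _ => 1 := Bdd.const 1
  have : Γ.Comp fun i => ((l i).map (f i)).foldl (fun a b => a || b) false := by
    refine Comp.foldlBdd hm (Comp.const false) hS ?_ ?_
    · intro w i pre _ _
      cases pre.foldl (fun a b => a || b) false <;> simp [Data.size]
    · exact (Comp.varFold hm hS).fst.or (Comp.varFold hm hS).snd
  refine this.congr fun w i _ => ?_
  have aux : ∀ (m : List Bool) b, m.foldl (fun a b => a || b) b = (b || m.any fun x => x) := by
    intro m
    induction m with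
    | nil => simp
    | cons x m ih => intro b; simp [ih, Bool.or_assoc]
  simp [aux, List.any_map, Function.comp_def]

theorem Comp.all {l : I → List α} {f : I → α → Bool} (hl : Γ.Comp l)
    (hf : (Γ.push fun i x => x ∈ l i).Comp fun p => f p.1 p.2) :
    Γ.Comp fun i => (l i).all (f i) :=
  (hl.any (f := fun i x => !f i x) hf.not).not.congr fun w i _ => by simp [List.all_eq_not_any_not]

theorem Comp.filter {l : I → List α} {f : I → α → Bool} (hl : Γ.Comp l)
    (hf : (Γ.push fun i x => x ∈ l i).Comp fun p => f p.1 p.2) :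
    Γ.Comp fun i => (l i).filter (f i) := by
  refine (hl.flatMap (f := fun i x => if f i x then [x] else [])
    (hf.ite (hl.varMem.cons (Comp.const [])) (Comp.const []))).congr fun w i _ => ?_
  induction l i with
  | nil => rfl
  | cons x l ih => by_cases h : f i x <;> simp [h, ih]

/-! Natural numbers -/

/-- Iteration `m` times, with intermediate results of size at most `S`. -/
theorem Comp.iterate {m : I → ℕ} {s : I → β} {f : I → β → β} {S : I → ℕ}
    (hm : Γ.Comp m) (hs : Γ.Comp s) (hS : Γ.Bdd S)
    (hsize : ∀ w i j, Γ.dom w i → j ≤ m i → (enc ((f i)^[j] (s i))).size ≤ S i)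
    (hf : (Γ.push fun i b => (enc b).size ≤ S i).Comp fun p => f p.1 p.2) :
    Γ.Comp fun i => (f i)^[m i] (s i) := by
  have aux : ∀ i (l : List Unit), l.foldl (fun b _ => f i b) (s i) = (f i)^[l.length] (s i) := by
    intro i l
    induction l using List.reverseRecOn with
    | nil => rfl
    | append_singleton l x ih => simp [ih, Function.iterate_succ_apply']
  have hl : Γ.Comp fun i => List.replicate (m i) () := hm.of_enc fun _ i _ => (enc_nat (m i)).symm
  have : Γ.Comp fun i => (List.replicate (m i) ()).foldl (fun b _ => f i b) (s i) := by
    refine Comp.foldlBdd (f := fun i b _ => f i b) hl hs hS ?_ ?_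
    · intro w i pre hi hpre
      rw [aux]
      exact hsize w i _ hi (by simpa using hpre.length_le)
    · exact hf.subst (Comp.varFold hl hS).fst fun w i x _ h => h.1
  exact this.congr fun w i _ => by simp [aux]

theorem Comp.varSize {S : I → ℕ} (hS : Γ.Bdd S) :
    (Γ.push fun i (b : β) => (enc b).size ≤ S i).Comp fun p => p.2 :=
  Comp.var (hS.push.mono fun _ _ h => h.2)

theorem Comp.length {l : I → List α} (hl : Γ.Comp l) : Γ.Comp fun i => (l i).length := by
  have aux : ∀ pre : List α, pre.foldl (fun n _ => n + 1) 0 = pre.length := fun pre => by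
    simp
  have : Γ.Comp fun i => (l i).foldl (fun n _ => n + 1) 0 := by
    refine Comp.foldlBdd hl (Comp.const 0) (Bdd.length hl) ?_ (Comp.varFold hl (Bdd.length hl)).fst.succ
    intro w i pre _ h
    rw [size_enc_nat, aux]
    exact h.length_le
  exact this.congr fun w i _ => (aux _).symm

theorem Comp.range {m : I → ℕ} (hm : Γ.Comp m) : Γ.Comp fun i => List.range (m i) := by
  have aux : ∀ j, (fun l : List ℕ => l ++ [l.length])^[j] [] = List.range j := by
    intro j
    induction j with
    | zero => rfl
    | succ j ih => rw [Function.iterate_succ_apply', ih, List.range_succ, List.length_range]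
  have hS : Γ.Bdd fun i => m i * (m i + 1) := (Bdd.nat hm).mul ((Bdd.nat hm).add (Bdd.const 1))
  have : Γ.Comp fun i => (fun l : List ℕ => l ++ [l.length])^[m i] [] := by
    refine Comp.iterate (f := fun _ (l : List ℕ) => l ++ [l.length]) hm (Comp.const []) hS ?_ ?_
    · intro w i j _ hj
      rw [aux]
      refine (size_enc_list_le _ (m i) ?_).trans ?_
      · intro x hx
        rw [size_enc_nat]
        have := List.mem_range.1 hx
        omega
      · rw [List.length_range]
        exact Nat.mul_le_mul_right _ hj
    · exact (Comp.varSize hS).append ((Comp.varSize hS).length.cons (Comp.const []))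
  exact this.congr fun w i _ => (aux _).symm

theorem Comp.add {m n : I → ℕ} (hm : Γ.Comp m) (hn : Γ.Comp n) : Γ.Comp fun i => m i + n i := by
  have hS : Γ.Bdd fun i => m i + n i := (Bdd.nat hm).add (Bdd.nat hn)
  have aux : ∀ j k, Nat.succ^[j] k = j + k := fun j k => by rw [Nat.succ_iterate]; omega
  have : Γ.Comp fun i => Nat.succ^[m i] (n i) := by
    refine Comp.iterate (f := fun _ => Nat.succ) hm hn hS ?_ (Comp.varSize hS).succ
    intro w i j _ hj
    rw [size_enc_nat, aux]
    omega
  exact this.congr fun w i _ => (aux _ _).symm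

theorem Comp.sub {m n : I → ℕ} (hm : Γ.Comp m) (hn : Γ.Comp n) : Γ.Comp fun i => m i - n i := by
  have hS : Γ.Bdd m := Bdd.nat hm
  have aux : ∀ j k, Nat.pred^[j] k = k - j := fun j k => by rw [Nat.pred_iterate]
  have : Γ.Comp fun i => Nat.pred^[n i] (m i) := by
    refine Comp.iterate (f := fun _ => Nat.pred) hn hm hS ?_ ?_
    · intro w i j _ hj
      rw [size_enc_nat, aux]
      omega
    · refine (Comp.natCases (Comp.varSize hS) (Comp.const 0) (g := fun _ x => x)
        (Comp.varPred (Comp.varSize hS))).congr fun w p _ => ?_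
      rcases p.2 <;> rfl
  exact this.congr fun w i _ => (aux _ _).symm

theorem Comp.min {m n : I → ℕ} (hm : Γ.Comp m) (hn : Γ.Comp n) : Γ.Comp fun i => Min.min (m i) (n i) :=
  (hm.sub (hm.sub hn)).congr fun w i _ => by omega

theorem Comp.eqZero {m : I → ℕ} (hm : Γ.Comp m) : Γ.Comp fun i => decide (m i = 0) :=
  (Comp.natCases hm (Comp.const true) (g := fun _ _ => false) (Comp.const false)).congr fun w i _ => by
    rcases m i <;> rfl

theorem Comp.drop {l : I → List α} {m : I → ℕ} (hl : Γ.Comp l) (hm : Γ.Comp m) :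
    Γ.Comp fun i => (l i).drop (m i) := by
  have hS : Γ.Bdd fun i => (enc (l i)).size := hl.1
  have aux : ∀ j (l : List α), List.tail^[j] l = l.drop j := fun j l => by
    induction j generalizing l with
    | zero => rfl
    | succ j ih => rw [Function.iterate_succ_apply, ih]; simp
  have : Γ.Comp fun i => List.tail^[m i] (l i) := by
    refine Comp.iterate (f := fun _ => List.tail) hm hl hS ?_ ?_
    · intro w i j _ hj
      rw [aux]
      conv_rhs => rw [← List.take_append_drop j (l i)]
      simp only [size_enc_list, List.map_append, List.sum_append]
      omega
    · refine (Comp.listCases (Comp.varSize hS) (Comp.const [])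
        (g := fun _ p => p.2) (Comp.varCons (Comp.varSize hS)).snd).congr fun w p _ => ?_
      rcases p.2 <;> rfl
  exact this.congr fun w i _ => (aux _ _).symm

theorem Comp.getD {l : I → List α} {m : I → ℕ} (hl : Γ.Comp l) (hm : Γ.Comp m) (d : α) :
    Γ.Comp fun i => (l i).getD (m i) d := by
  have h := hl.drop hm
  refine (Comp.listCases h (Comp.const d) (g := fun _ p => p.1) (Comp.varCons h).fst).congr
    fun w i _ => ?_
  rw [List.getD_eq_getElem?_getD, ← Nat.add_zero (m i), ← List.getElem?_drop, Nat.add_zero]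
  rcases (l i).drop (m i) <;> rfl

/-- Types with an equality test that runs in polynomial time. -/
class EqComp (α : Type) [Enc α] [DecidableEq α] : Prop where
  eq : ∀ {I : Type} {Γ : Ctx I} {a b : I → α}, Γ.Comp a → Γ.Comp b →
    Γ.Comp fun i => decide (a i = b i)

instance : EqComp ℕ := ⟨fun ha hb =>
  ((ha.sub hb).eqZero.and (hb.sub ha).eqZero).congr fun w i _ => by
    rw [← Bool.decide_and]
    exact decide_eq_decide.2 (by omega)⟩

instance [DecidableEq α] [DecidableEq β] [EqComp α] [EqComp β] : EqComp (α × β) := ⟨fun ha hb =>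
  ((EqComp.eq ha.fst hb.fst).and (EqComp.eq ha.snd hb.snd)).congr fun w i _ => by
    rw [← Bool.decide_and]
    exact decide_eq_decide.2 Prod.ext_iff⟩

/-- Equality is tested on the lengths and then index by index; all indices are in range, so the
default value plays no role. -/
instance [DecidableEq α] [Inhabited α] [EqComp α] : EqComp (List α) := ⟨fun {I Γ a b} ha hb => by
  refine ((EqComp.eq ha.length hb.length).and (Comp.all ha.length.range
    (f := fun i j => decide ((a i).getD j default = (b i).getD j default))
    (EqComp.eq (ha.weaken.getD (Comp.varMem ha.length.range) _)
      (hb.weaken.getD (Comp.varMem ha.length.range) _)))).congr fun w i _ => ?_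
  rw [Bool.eq_iff_iff]
  simp only [decide_eq_true_eq, Bool.and_eq_true, List.all_eq_true, List.mem_range]
  constructor
  · intro h
    simp [h]
  · rintro ⟨h1, h2⟩
    refine List.ext_getElem h1 fun j hj hj' => ?_
    simpa [hj, hj'] using h2 j hj⟩

theorem Comp.eq [DecidableEq α] [EqComp α] {a b : I → α} [∀ i, Decidable (a i = b i)]
    (ha : Γ.Comp a) (hb : Γ.Comp b) : Γ.Comp fun i => decide (a i = b i) :=
  (EqComp.eq ha hb).congr fun w i _ => by congr

theorem Comp.mem [DecidableEq α] [EqComp α] {x : I → α} {l : I → List α}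
    [∀ i, Decidable (x i ∈ l i)] (hx : Γ.Comp x) (hl : Γ.Comp l) :
    Γ.Comp fun i => decide (x i ∈ l i) :=
  (hl.any (f := fun i y => decide (x i = y)) (EqComp.eq hx.weaken hl.varMem)).congr fun w i _ => by
    rw [Bool.eq_iff_iff]
    simp

end Ctx

/-- Remove duplicates. -/
def nub {α : Type} [DecidableEq α] (l : List α) : List α :=
  l.foldl (fun acc x => if decide (x ∈ acc) then acc else x :: acc) []

theorem nub_spec {α : Type} [DecidableEq α] (l : List α) :
    (nub l).Nodup ∧ ∀ x, x ∈ nub l ↔ x ∈ l := by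
  unfold nub
  induction l using List.reverseRecOn with
  | nil => simp
  | append_singleton l x ih =>
    obtain ⟨h1, h2⟩ := ih
    rw [List.foldl_append, List.foldl_cons, List.foldl_nil]
    split_ifs with h
    · refine ⟨h1, fun y => ?_⟩
      have := (h2 x).1 (by simpa using h)
      rw [h2, List.mem_append, List.mem_singleton]
      constructor
      · exact Or.inl
      · rintro (h | rfl) <;> assumption
    · refine ⟨List.nodup_cons.2 ⟨by simpa using h, h1⟩, fun y => ?_⟩
      rw [List.mem_cons, h2, List.mem_append, List.mem_singleton, or_comm]

theorem nodup_nub {α : Type} [DecidableEq α] (l : List α) : (nub l).Nodup := (nub_spec l).1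

@[simp] theorem mem_nub {α : Type} [DecidableEq α] {l : List α} {x : α} : x ∈ nub l ↔ x ∈ l :=
  (nub_spec l).2 x

namespace Ctx

variable {I : Type} {Γ : Ctx I} {α : Type} [Enc α]

/-- An intermediate result is a duplicate-free list of elements of `l i`, hence up to order a
sublist, and not larger than `l i`. -/
theorem Comp.nub [DecidableEq α] [EqComp α] {l : I → List α} (hl : Γ.Comp l) :
    Γ.Comp fun i => nub (l i) := by
  refine Comp.foldlBdd hl (Comp.const []) hl.1 ?_ ?_
  · intro w i pre _ hpre
    have h : (LC.nub pre).Subperm (l i) :=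
      (nodup_nub pre).subperm fun x hx => hpre.subset (mem_nub.1 hx)
    obtain ⟨m, hm, hs⟩ := h
    change (enc (LC.nub pre)).size ≤ _
    rw [size_enc_list, size_enc_list, ← (hm.map _).sum_eq]
    exact (hs.map _).sum_le_sum (by simp)
  · have hv := Comp.varFold (β := List α) hl hl.1
    exact (Comp.mem hv.snd hv.fst).ite hv.fst (hv.snd.cons hv.fst)

end Ctx
end LC

namespace LC

/-! ## The dynamic programming algorithm -/

/-- The table of a function of a vertex below `n` and a colour below `q`. -/
def tab (n q : ℕ) (f : ℕ → ℕ → ℕ) : List (List ℕ) :=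
  (List.range n).map fun u => (List.range q).map fun a => f u a

/-- Positions outside the table read as 0. -/
def entry (s : List (List ℕ)) (u a : ℕ) : ℕ := (s.getD u []).getD a 0

theorem entry_tab {n q u a : ℕ} (f : ℕ → ℕ → ℕ) (hu : u < n) (ha : a < q) :
    entry (tab n q f) u a = f u a := by
  simp [entry, tab, hu, ha]

theorem tab_congr {n q : ℕ} {f g : ℕ → ℕ → ℕ} (h : ∀ u < n, ∀ a < q, f u a = g u a) :
    tab n q f = tab n q g := by
  refine List.map_congr_left fun u hu => List.map_congr_left fun a ha => ?_
  exact h u (List.mem_range.1 hu) a (List.mem_range.1 ha)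

theorem tab_inj {n q : ℕ} {f g : ℕ → ℕ → ℕ} (h : tab n q f = tab n q g) {u a : ℕ} (hu : u < n)
    (ha : a < q) : f u a = g u a := by
  rw [← entry_tab f hu ha, h, entry_tab g hu ha]

/-- The sum of two signatures, truncated at `d` and restricted to `Y`. -/
def addOn (n q d : ℕ) (Y : List ℕ) (s t : List (List ℕ)) : List (List ℕ) :=
  tab n q fun u a => if decide (u ∈ Y) then min d (entry s u a + entry t u a) else 0

/-- Adjacency according to the adjacency matrix `A`. -/
def adjB (A : List (List Bool)) (u v : ℕ) : Bool := (A.getD u []).getD v false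

/-- The signature on `Y` of a single vertex `v` of colour `a`. -/
def single (A : List (List Bool)) (q : ℕ) (Y : List ℕ) (v a : ℕ) : List (List ℕ) :=
  tab A.length q fun u b => if decide (u ∈ Y) && (adjB A v u && decide (a = b)) then 1 else 0

/-- All signatures on `Y` of colourings of `X`. -/
def signatures (A : List (List Bool)) (q d : ℕ) (Y X : List ℕ) : List (List (List ℕ)) :=
  X.foldl (fun L x => nub (L.flatMap fun s => (List.range q).map fun a =>
    addOn A.length q d Y s (single A q Y x a))) [tab A.length q fun _ _ => 0]

/-- The vertices that are not in `S`. -/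
def compl (n : ℕ) (S : List ℕ) : List ℕ := (List.range n).filter fun u => !decide (u ∈ S)

/-- Missing components count as 0, so adding `[]` pads or cuts a vector to length `r`. -/
def addStat (r : ℕ) (K L : List ℕ) : List ℕ :=
  (List.range r).map fun j => K.getD j 0 + L.getD j 0

/-- An inner signature, an outer signature, and a statistic. -/
abbrev Entry := List (List ℕ) × List (List ℕ) × List ℕ

/-- A table of the dynamic programme: the vertices below a node of the tree, and the entries. -/
abbrev Item := List ℕ × List Entry

/-- All colours of `v` are combined with all signatures on `v` of the other vertices. Row `v` of
such a signature contains the truncated neighbour counts of `v`, which is what `allowed` is about.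
-/
def leafItem (A : List (List Bool)) (q d r : ℕ) (allowed : List (ℕ × List ℕ)) (W : List (List ℕ))
    (v : ℕ) : Item :=
  ([v], nub ((List.range q).flatMap fun a =>
    (signatures A q d [v] (compl A.length [v])).flatMap fun τ =>
      if decide ((a, τ.getD v []) ∈ allowed) then
        [(single A q (compl A.length [v]) v a, τ, addStat r (W.getD a []) [])]
      else []))

/-- The entry for the union of two sets `S` and `T` with outer signature `τ` that results from
entries for `S` and `T`, if they are compatible. -/
def joinEntry (A : List (List Bool)) (q d r : ℕ) (S T : List ℕ) (e f : Entry)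
    (τ : List (List ℕ)) : List Entry :=
  if decide (e.2.1 = addOn A.length q d S τ f.1) && decide (f.2.1 = addOn A.length q d T τ e.1) then
    [(addOn A.length q d (compl A.length (S ++ T)) e.1 f.1, τ, addStat r e.2.2 f.2.2)]
  else []

/-- The outer signature of the union is not determined by the two entries, so all of them are tried;
`joinEntry` keeps those from which both outer signatures can be recovered. -/
def joinItem (A : List (List Bool)) (q d r : ℕ) (x y : Item) : Item :=
  (x.1 ++ y.1, nub (x.2.flatMap fun e => y.2.flatMap fun f =>
    (signatures A q d (x.1 ++ y.1) (compl A.length (x.1 ++ y.1))).flatMap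
      (joinEntry A q d r x.1 y.1 e f)))

def treeItem (A : List (List Bool)) (q d r : ℕ) (allowed : List (ℕ × List ℕ)) (W : List (List ℕ)) :
    DTree ℕ → Item
  | .leaf v => leafItem A q d r allowed W v
  | .node s t => joinItem A q d r (treeItem A q d r allowed W s) (treeItem A q d r allowed W t)

/-- The number of vertices in `X` of colour `a` that are adjacent to `u`. -/
def cnt (A : List (List Bool)) (X : List ℕ) (c : ℕ → ℕ) (u a : ℕ) : ℕ :=
  X.countP fun x => adjB A x u && decide (c x = a)

/-- The signature on `Y` of the colouring `c` of `X`. -/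
def sig (A : List (List Bool)) (q d : ℕ) (X : List ℕ) (c : ℕ → ℕ) (Y : List ℕ) : List (List ℕ) :=
  tab A.length q fun u a => if decide (u ∈ Y) then min d (cnt A X c u a) else 0

/-- `W` assigns to each colour a vector of weights, and its first `r` components are summed over
`X`. A colour or component that `W` lacks has weight 0. -/
def stat (r : ℕ) (W : List (List ℕ)) (X : List ℕ) (c : ℕ → ℕ) : List ℕ :=
  (List.range r).map fun j => (X.map fun v => (W.getD (c v) []).getD j 0).sum

/-- The truncated numbers of neighbours of `v` of all colours. -/
def row (A : List (List Bool)) (q d : ℕ) (c : ℕ → ℕ) (v : ℕ) : List ℕ :=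
  (List.range q).map fun a => min d (cnt A (List.range A.length) c v a)

variable {A : List (List Bool)} {q d r : ℕ} {allowed : List (ℕ × List ℕ)} {W : List (List ℕ)}

/-! ### Correctness of the tables. -/

theorem cnt_append (X X' : List ℕ) (c : ℕ → ℕ) (u a : ℕ) :
    cnt A (X ++ X') c u a = cnt A X c u a + cnt A X' c u a := List.countP_append

theorem cnt_perm {X X' : List ℕ} (h : X.Perm X') (c : ℕ → ℕ) (u a : ℕ) :
    cnt A X c u a = cnt A X' c u a := h.countP_eq _

theorem cnt_congr {X : List ℕ} {c c' : ℕ → ℕ} (h : ∀ x ∈ X, c x = c' x) (u a : ℕ) :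
    cnt A X c u a = cnt A X c' u a :=
  List.countP_congr fun x hx => by rw [h x hx]

theorem sig_congr {X : List ℕ} {c c' : ℕ → ℕ} (h : ∀ x ∈ X, c x = c' x) (Y : List ℕ) :
    sig A q d X c Y = sig A q d X c' Y :=
  tab_congr fun u _ a _ => by rw [cnt_congr h]

theorem stat_congr {X : List ℕ} {c c' : ℕ → ℕ} (h : ∀ x ∈ X, c x = c' x) :
    stat r W X c = stat r W X c' := by
  refine List.map_congr_left fun j _ => ?_
  rw [List.map_congr_left fun x hx => by rw [h x hx]]

/-- A single vertex contributes 0 or 1 to each count, and truncation at `d ≥ 1` leaves these alone.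
-/
theorem single_eq_sig (hd : 1 ≤ d) (Y : List ℕ) (v : ℕ) (c : ℕ → ℕ) :
    single A q Y v (c v) = sig A q d [v] c Y := by
  refine tab_congr fun u _ a _ => ?_
  simp only [cnt, List.countP_singleton]
  cases decide (u ∈ Y) <;> cases adjB A v u && decide (c v = a) <;> simp [hd]

/-- Truncating the summands first does no harm: `min d (min d a + min d b) = min d (a + b)`. -/
theorem addOn_sig {X X' Y Y' Z : List ℕ} (c c' : ℕ → ℕ) (h : ∀ u ∈ Z, u ∈ Y)
    (h' : ∀ u ∈ Z, u ∈ Y') :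
    addOn A.length q d Z (sig A q d X c Y) (sig A q d X' c' Y') =
      tab A.length q fun u a => if decide (u ∈ Z) then
        min d (cnt A X c u a + cnt A X' c' u a) else 0 := by
  refine tab_congr fun u hu a ha => ?_
  rw [sig, sig, entry_tab _ hu ha, entry_tab _ hu ha]
  by_cases hz : u ∈ Z
  · simp only [hz, h u hz, h' u hz, decide_true, if_true]
    omega
  · simp [hz]

theorem addOn_sig_same {X X' Y Y' Z X'' : List ℕ} (c : ℕ → ℕ) (h : ∀ u ∈ Z, u ∈ Y)
    (h' : ∀ u ∈ Z, u ∈ Y') (hX : X''.Perm (X ++ X')) :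
    addOn A.length q d Z (sig A q d X c Y) (sig A q d X' c Y') = sig A q d X'' c Z := by
  rw [addOn_sig c c h h']
  exact tab_congr fun u _ a _ => by rw [cnt_perm hX, cnt_append]

/-- The fold adds the last vertex to a prefix, so the induction is from the right. A new vertex `x`
does not occur in the prefix, and giving it any colour leaves the signature of the prefix unchanged.
-/
theorem mem_signatures (hd : 1 ≤ d) (Y : List ℕ) {X : List ℕ} (hX : X.Nodup)
    {s : List (List ℕ)} :
    s ∈ signatures A q d Y X ↔ ∃ c : ℕ → ℕ, (∀ x ∈ X, c x < q) ∧ s = sig A q d X c Y := by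
  induction X using List.reverseRecOn generalizing s with
  | nil => simp [signatures, sig, cnt]
  | append_singleton X x ih =>
    have hx : x ∉ X := fun h => List.disjoint_of_nodup_append hX h (List.mem_singleton_self x)
    have ih := @ih (List.Nodup.of_append_left hX)
    rw [signatures, List.foldl_append, ← signatures, List.foldl_cons, List.foldl_nil, mem_nub]
    simp only [List.mem_flatMap, List.mem_map, List.mem_range]
    constructor
    · rintro ⟨s, hs, a, ha, rfl⟩
      obtain ⟨c, hc, rfl⟩ := ih.1 hs
      have hne : ∀ y ∈ X, y ≠ x := fun y hy h => hx (h ▸ hy)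
      refine ⟨Function.update c x a, ?_, ?_⟩
      · intro y hy
        rcases List.mem_append.1 hy with hy | hy
        · rw [Function.update_of_ne (hne y hy)]
          exact hc y hy
        · rw [List.mem_singleton.1 hy, Function.update_self]
          exact ha
      · rw [sig_congr (c' := Function.update c x a)
          fun y hy => by rw [Function.update_of_ne (hne y hy)]]
        have : single A q Y x a = sig A q d [x] (Function.update c x a) Y := by
          rw [← single_eq_sig hd, Function.update_self]
        rw [this]
        exact addOn_sig_same _ (fun _ h => h) (fun _ h => h) (.refl _)
    · rintro ⟨c, hc, rfl⟩
      refine ⟨sig A q d X c Y, ih.2 ⟨c, fun y hy => hc y (by simp [hy]), rfl⟩, c x,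
        hc x (by simp), ?_⟩
      rw [single_eq_sig hd]
      exact addOn_sig_same _ (fun _ h => h) (fun _ h => h) (.refl _)

theorem mem_compl {n u : ℕ} {S : List ℕ} : u ∈ compl n S ↔ u < n ∧ u ∉ S := by
  simp [compl]

theorem nodup_compl (n : ℕ) (S : List ℕ) : (compl n S).Nodup := List.nodup_range.filter _

theorem range_perm {n : ℕ} {S : List ℕ} (hS : S.Nodup) (hn : ∀ u ∈ S, u < n) :
    (List.range n).Perm (compl n S ++ S) := by
  refine (List.perm_ext_iff_of_nodup List.nodup_range ?_).2 fun u => ?_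
  · exact (nodup_compl n S).append hS fun u h h' => (mem_compl.1 h).2 h'
  · rw [List.mem_append, mem_compl, List.mem_range]
    by_cases h : u ∈ S
    · simp [h, hn u h]
    · simp [h]

theorem compl_perm {n : ℕ} {S T : List ℕ} (hST : (S ++ T).Nodup) (hn : ∀ u ∈ T, u < n) :
    (compl n S).Perm (compl n (S ++ T) ++ T) := by
  refine (List.perm_ext_iff_of_nodup (nodup_compl n S) ?_).2 fun u => ?_
  · exact (nodup_compl n _).append (List.Nodup.of_append_right hST) fun u h h' =>
      (mem_compl.1 h).2 (List.mem_append_right S h')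
  · rw [List.mem_append, mem_compl, mem_compl, List.mem_append]
    by_cases h : u ∈ T
    · simp only [h, hn u h, true_and, or_true, iff_true]
      exact fun h' => List.disjoint_of_nodup_append hST h' h
    · simp [h]

theorem addStat_stat (X X' : List ℕ) (c c' : ℕ → ℕ) :
    addStat r (stat r W X c) (stat r W X' c') = (List.range r).map fun j =>
      (X.map fun v => (W.getD (c v) []).getD j 0).sum +
      (X'.map fun v => (W.getD (c' v) []).getD j 0).sum := by
  refine List.map_congr_left fun j hj => ?_
  have hj := List.mem_range.1 hj
  simp [stat, hj]

theorem addStat_stat_same (X X' : List ℕ) (c : ℕ → ℕ) :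
    addStat r (stat r W X c) (stat r W X' c) = stat r W (X ++ X') c := by
  rw [addStat_stat]
  refine List.map_congr_left fun j _ => ?_
  rw [List.map_append, List.sum_append]

/-- The item `x` is the table for the set `S` of vertices: its entries stem from the colourings of
all vertices that satisfy the constraints at the vertices in `S`. -/
def IsTable (A : List (List Bool)) (q d r : ℕ) (allowed : List (ℕ × List ℕ)) (W : List (List ℕ))
    (S : List ℕ) (x : Item) : Prop :=
  x.1 = S ∧ x.2.Nodup ∧ ∀ e, e ∈ x.2 ↔ ∃ c : ℕ → ℕ, (∀ u < A.length, c u < q) ∧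
    (∀ v ∈ S, (c v, row A q d c v) ∈ allowed) ∧
    e = (sig A q d S c (compl A.length S), sig A q d (compl A.length S) c S, stat r W S c)

theorem isTable_leafItem (hd : 1 ≤ d) (hA : ∀ u, adjB A u u = false) {v : ℕ} (hv : v < A.length) :
    IsTable A q d r allowed W [v] (leafItem A q d r allowed W v) := by
  refine ⟨rfl, nodup_nub _, fun e => ?_⟩
  -- Since `v` is not adjacent to itself, all its neighbours lie in the complement, and the outer
  -- signature holds its complete row.
  have hrow : ∀ c : ℕ → ℕ, (sig A q d (compl A.length [v]) c [v]).getD v [] = row A q d c v := by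
    intro c
    have hp := range_perm (List.nodup_singleton v) (n := A.length) (by simpa using hv)
    simp only [sig, tab, List.getD_eq_getElem?_getD, List.getElem?_map, List.getElem?_range hv,
      Option.map_some, Option.getD_some]
    refine List.map_congr_left fun a _ => ?_
    rw [cnt_perm hp, cnt_append]
    simp [cnt, hA]
  have hstat : ∀ c : ℕ → ℕ, addStat r (W.getD (c v) []) [] = stat r W [v] c := by
    intro c
    refine List.map_congr_left fun j _ => ?_
    simp
  simp only [leafItem, mem_nub, List.mem_flatMap, List.mem_range]
  constructor
  · rintro ⟨a, ha, τ, hτ, he⟩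
    obtain ⟨c, hc, rfl⟩ := (mem_signatures hd _ (nodup_compl _ _)).1 hτ
    -- The vertex `v` is not in the complement, so it can be given the colour `a` without changing
    -- the outer signature.
    have hcc : ∀ x ∈ compl A.length [v], c x = Function.update c v a x := by
      intro x hx
      rw [Function.update_of_ne]
      simpa using (mem_compl.1 hx).2
    rw [sig_congr hcc, hrow] at he
    split_ifs at he with hal
    · rw [decide_eq_true_eq] at hal
      rw [List.mem_singleton] at he
      refine ⟨Function.update c v a, ?_, ?_, ?_⟩
      · intro u hu
        rcases eq_or_ne u v with rfl | h
        · simpa using ha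
        · have hm : u ∈ compl A.length [v] := mem_compl.2 ⟨hu, by simpa using h⟩
          rw [← hcc u hm]
          exact hc u hm
      · intro u hu
        rw [List.mem_singleton.1 hu, Function.update_self]
        exact hal
      · rw [he, ← single_eq_sig hd, ← hstat, Function.update_self]
    · simp at he
  · rintro ⟨c, hc, hal, rfl⟩
    refine ⟨c v, hc v hv, _, (mem_signatures hd _ (nodup_compl _ _)).2
      ⟨c, fun x hx => hc x (mem_compl.1 hx).1, rfl⟩, ?_⟩
    rw [hrow, if_pos (by simpa using hal v (by simp)), single_eq_sig hd, hstat, List.mem_singleton]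

/-- The constraint at `v ∈ S` depends only on the colouring of `S` and the outer signature. -/
theorem row_eq {c c' : ℕ → ℕ} {S : List ℕ} (hS : S.Nodup) (hn : ∀ u ∈ S, u < A.length) {v : ℕ}
    (hcc : ∀ x ∈ S, c x = c' x)
    (h : ∀ a < q, min d (cnt A (compl A.length S) c v a) = min d (cnt A (compl A.length S) c' v a)) :
    row A q d c v = row A q d c' v := by
  refine List.map_congr_left fun a ha => ?_
  have := h a (List.mem_range.1 ha)
  rw [cnt_perm (range_perm hS hn), cnt_perm (range_perm hS hn), cnt_append, cnt_append,
    cnt_congr hcc]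
  omega

/-- What a vertex of `S` sees outside `S` splits into its neighbours in `T` and those outside `S ++
T`; hence the outer signature of `S` must be the truncated sum of the inner signature of `T` and the
outer signature of the union. If this holds on both sides, colourings that realise the three pieces
separately can be glued: the constraints in `S` depend only on the colours in `S` and the outer
signature (`row_eq`), and likewise for `T`. -/
theorem isTable_joinItem (hd : 1 ≤ d) {S T : List ℕ} (hST : (S ++ T).Nodup)
    (hn : ∀ u ∈ S ++ T, u < A.length) {x y : Item} (hx : IsTable A q d r allowed W S x)
    (hy : IsTable A q d r allowed W T y) :
    IsTable A q d r allowed W (S ++ T) (joinItem A q d r x y) := by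
  obtain ⟨hx1, -, hx⟩ := hx
  obtain ⟨hy1, -, hy⟩ := hy
  refine ⟨by rw [joinItem, hx1, hy1], nodup_nub _, fun e => ?_⟩
  have hS := List.Nodup.of_append_left hST
  have hT := List.Nodup.of_append_right hST
  have hdisj : ∀ u ∈ S, u ∉ T := fun u h h' => List.disjoint_of_nodup_append hST h h'
  have hnS : ∀ u ∈ S, u < A.length := fun u h => hn u (List.mem_append_left T h)
  have hnT : ∀ u ∈ T, u < A.length := fun u h => hn u (List.mem_append_right S h)
  have hSsub : ∀ u ∈ S, u ∈ S ++ T := fun u h => List.mem_append_left T h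
  have hTsub : ∀ u ∈ T, u ∈ S ++ T := fun u h => List.mem_append_right S h
  have hST' : ∀ u ∈ S, u ∈ compl A.length T := fun u h => mem_compl.2 ⟨hnS u h, hdisj u h⟩
  have hTS' : ∀ u ∈ T, u ∈ compl A.length S :=
    fun u h => mem_compl.2 ⟨hnT u h, fun h' => hdisj u h' h⟩
  have hcS : ∀ u ∈ compl A.length (S ++ T), u ∈ compl A.length S := fun u h =>
    mem_compl.2 ⟨(mem_compl.1 h).1, fun h' => (mem_compl.1 h).2 (hSsub u h')⟩
  have hcT : ∀ u ∈ compl A.length (S ++ T), u ∈ compl A.length T := fun u h =>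
    mem_compl.2 ⟨(mem_compl.1 h).1, fun h' => (mem_compl.1 h).2 (hTsub u h')⟩
  have hpS := compl_perm hST hnT
  have hpT : (compl A.length T).Perm (compl A.length (S ++ T) ++ S) := by
    have h := compl_perm (n := A.length) (List.nodup_append_comm.1 hST) hnS
    have h' : compl A.length (T ++ S) = compl A.length (S ++ T) := by
      simp [compl, or_comm]
    rwa [h'] at h
  simp only [joinItem, joinEntry, mem_nub, List.mem_flatMap]
  rw [hx1, hy1]
  constructor
  · rintro ⟨e1, he1, e2, he2, τ, hτ, he⟩
    obtain ⟨c1, hc1, hal1, rfl⟩ := (hx e1).1 he1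
    obtain ⟨c2, hc2, hal2, rfl⟩ := (hy e2).1 he2
    obtain ⟨c3, hc3, rfl⟩ := (mem_signatures hd _ (nodup_compl _ _)).1 hτ
    simp only [Bool.and_eq_true, decide_eq_true_eq] at he
    split_ifs at he with hcond
    · obtain ⟨h1, h2⟩ := hcond
      rw [addOn_sig _ _ hSsub hST'] at h1
      rw [addOn_sig _ _ hTsub hTS'] at h2
      rw [List.mem_singleton] at he
      -- The glued colouring: `c1` on `S`, `c2` on `T`, and `c3`, which realises the outer
      -- signature, elsewhere.
      obtain ⟨c, e1, e2, e3⟩ : ∃ c : ℕ → ℕ, (∀ u ∈ S, c1 u = c u) ∧ (∀ u ∈ T, c2 u = c u) ∧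
          ∀ u ∈ compl A.length (S ++ T), c3 u = c u := by
        refine ⟨fun u => if u ∈ S then c1 u else if u ∈ T then c2 u else c3 u, ?_, ?_, ?_⟩
        · intro u hu; simp [hu]
        · intro u hu
          have h : u ∉ S := fun h => hdisj u h hu
          simp [hu, h]
        · intro u hu
          have := (mem_compl.1 hu).2
          rw [List.mem_append, not_or] at this
          simp [this]
      refine ⟨c, ?_, ?_, ?_⟩
      · intro u hu
        by_cases hS : u ∈ S
        · rw [← e1 u hS]; exact hc1 u hu
        by_cases hT : u ∈ T
        · rw [← e2 u hT]; exact hc2 u hu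
        have hm : u ∈ compl A.length (S ++ T) := mem_compl.2 ⟨hu, by simp [hS, hT]⟩
        rw [← e3 u hm]
        exact hc3 u hm
      · intro v hv
        rcases List.mem_append.1 hv with hv | hv
        -- The constraint at `v` holds for `c1`. It carries over to `c` because `h1` says that both
        -- show the same truncated counts outside `S`.
        · rw [← e1 v hv, ← row_eq hS hnS e1]
          · exact hal1 v hv
          · intro a ha
            have := tab_inj h1 (hnS v hv) ha
            simp only [hv, decide_true, if_true] at this
            rw [this, cnt_perm hpS, cnt_append, cnt_congr e3, cnt_congr e2]
        · rw [← e2 v hv, ← row_eq hT hnT e2]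
          · exact hal2 v hv
          · intro a ha
            have := tab_inj h2 (hnT v hv) ha
            simp only [hv, decide_true, if_true] at this
            rw [this, cnt_perm hpT, cnt_append, cnt_congr e3, cnt_congr e1]
      · rw [he, sig_congr e1, sig_congr e2, sig_congr e3, stat_congr e1, stat_congr e2,
          addOn_sig_same _ hcS hcT (.refl _), addStat_stat_same]
    · simp at he
  -- Conversely, the entries of one colouring `c` for `S`, for `T` and its signature outside are
  -- compatible.
  · rintro ⟨c, hc, hal, rfl⟩
    refine ⟨_, (hx _).2 ⟨c, hc, fun v hv => hal v (hSsub v hv), rfl⟩,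
      _, (hy _).2 ⟨c, hc, fun v hv => hal v (hTsub v hv), rfl⟩,
      _, (mem_signatures hd _ (nodup_compl _ _)).2 ⟨c, fun u hu => hc u (mem_compl.1 hu).1, rfl⟩, ?_⟩
    rw [addOn_sig_same _ hSsub hST' hpS, addOn_sig_same _ hTsub hTS' hpT,
      addOn_sig_same _ hcS hcT (.refl _), addStat_stat_same]
    simp

theorem isTable_treeItem (hd : 1 ≤ d) (hA : ∀ u, adjB A u u = false) (t : DTree ℕ)
    (ht : t.leaves.Nodup) (hn : ∀ u ∈ t.leaves, u < A.length) :
    IsTable A q d r allowed W t.leaves (treeItem A q d r allowed W t) := by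
  induction t with
  | leaf v => exact isTable_leafItem hd hA (hn v (by simp [DTree.leaves]))
  | node s t hs ht' =>
    rw [DTree.leaves] at ht hn ⊢
    exact isTable_joinItem hd ht hn
      (hs (List.Nodup.of_append_left ht) fun u h => hn u (List.mem_append_left _ h))
      (ht' (List.Nodup.of_append_right ht) fun u h => hn u (List.mem_append_right _ h))

end LC

namespace LC

/-! ## The number of signatures -/

/-- Induced matchings between `X` and `Y` have at most `w` edges. -/
def MatchingLE {V : Type*} (adj : V → V → Prop) (X Y : V → Prop) (w : ℕ) : Prop :=
  ∀ R : Finset V, (∀ x ∈ R, X x) → ∀ f : V → V, (∀ x ∈ R, Y (f x) ∧ adj x (f x)) →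
    (∀ x ∈ R, ∀ x' ∈ R, x ≠ x' → ¬ adj x (f x')) → R.card ≤ w

theorem MatchingLE.mono {V : Type*} {adj : V → V → Prop} {X X' Y Y' : V → Prop} {w : ℕ}
    (h : MatchingLE adj X Y w) (hX : ∀ x, X' x → X x) (hY : ∀ x, Y' x → Y x) :
    MatchingLE adj X' Y' w :=
  fun R hR f hf hi => h R (fun x hx => hX x (hR x hx)) f
    (fun x hx => ⟨hY _ (hf x hx).1, (hf x hx).2⟩) hi

/-- An induced matching can be read from its other end: `f` is injective on `R`, since `f x = f x'`
would make `x` adjacent to the partner of `x'`. Its inverse on the image is the reversed matching.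
-/
theorem MatchingLE.swap {V : Type*} {adj : V → V → Prop} {X Y : V → Prop} {w : ℕ}
    (hs : ∀ x y, adj x y → adj y x) (h : MatchingLE adj X Y w) : MatchingLE adj Y X w := by
  classical
  intro R hR f hf hi
  have hinj : Set.InjOn f R := by
    intro x hx x' hx' he
    by_contra hne
    exact hi x hx x' hx' hne (he ▸ (hf x hx).2)
  rw [← Finset.card_image_of_injOn hinj]
  rcases R.eq_empty_or_nonempty with rfl | ⟨x0, hx0⟩
  · simp
  have : Nonempty V := ⟨x0⟩
  have hg : ∀ x ∈ R, Function.invFunOn f R (f x) = x := fun x hx =>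
    hinj (Function.invFunOn_mem ⟨x, hx, rfl⟩) hx (Function.invFunOn_eq ⟨x, hx, rfl⟩)
  refine h (R.image f) ?_ (Function.invFunOn f R) ?_ ?_
  · intro y hy
    obtain ⟨x, hx, rfl⟩ := Finset.mem_image.1 hy
    exact (hf x hx).1
  · intro y hy
    obtain ⟨x, hx, rfl⟩ := Finset.mem_image.1 hy
    rw [hg x hx]
    exact ⟨hR x hx, hs _ _ (hf x hx).2⟩
  · intro y hy y' hy' hne
    obtain ⟨x, hx, rfl⟩ := Finset.mem_image.1 hy
    obtain ⟨x', hx', rfl⟩ := Finset.mem_image.1 hy'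
    rw [hg x' hx']
    exact fun ha => hi x' hx' x hx (fun e => hne (by rw [e])) (hs _ _ ha)

section
open Classical
variable {V : Type*} {adj : V → V → Prop} {X Y : V → Prop} {w : ℕ}

/-- Some small subset of `A` dominates everything in `Y` that `A` dominates. -/
theorem MatchingLE.exists_dominating (h : MatchingLE adj X Y w) (A : Finset V)
    (hA : ∀ x ∈ A, X x) :
    ∃ R ⊆ A, R.card ≤ w ∧ ∀ y, Y y → (∃ x ∈ A, adj x y) → ∃ x ∈ R, adj x y := by
  let F := A.powerset.filter fun R => ∀ y, Y y → (∃ x ∈ A, adj x y) → ∃ x ∈ R, adj x y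
  -- A dominating subset with as few elements as possible.
  obtain ⟨R, hR, hmin⟩ := Finset.exists_min_image F Finset.card
    ⟨A, Finset.mem_filter.2 ⟨Finset.mem_powerset_self A, fun _ _ h => h⟩⟩
  obtain ⟨hRA, hdom⟩ := Finset.mem_filter.1 hR
  rw [Finset.mem_powerset] at hRA
  refine ⟨R, hRA, ?_, hdom⟩
  -- By minimality no `x` can be dropped, so each has a private neighbour in `Y`. The private
  -- neighbours match `R` by an induced matching, which bounds its size by `w`.
  have hpriv : ∀ x ∈ R, ∃ y, Y y ∧ adj x y ∧ ∀ x' ∈ R, x' ≠ x → ¬ adj x' y := by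
    intro x hx
    by_contra! hno
    have hmem : R.erase x ∈ F := by
      refine Finset.mem_filter.2 ⟨Finset.mem_powerset.2 ((Finset.erase_subset _ _).trans hRA), ?_⟩
      intro y hy hex
      obtain ⟨x', hx', hadj⟩ := hdom y hy hex
      rcases eq_or_ne x' x with rfl | hne
      · obtain ⟨x'', h1, h2, h3⟩ := hno y hy hadj
        exact ⟨x'', Finset.mem_erase.2 ⟨h2, h1⟩, h3⟩
      · exact ⟨x', Finset.mem_erase.2 ⟨hne, hx'⟩, hadj⟩
    have := hmin _ hmem
    have := Finset.card_erase_lt_of_mem hx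
    omega
  choose! f hf using hpriv
  exact h R (fun x hx => hA x (hRA hx)) f (fun x hx => ⟨(hf x hx).1, (hf x hx).2.1⟩)
    fun x hx x' hx' hne => (hf x' hx').2.2 x hx hne

/-- Some small subset of `A` has the same numbers of neighbours in `Y`, up to truncation at `d`. -/
theorem MatchingLE.exists_representative (h : MatchingLE adj X Y w) (d : ℕ) (A : Finset V)
    (hA : ∀ x ∈ A, X x) :
    ∃ R ⊆ A, R.card ≤ d * w ∧ ∀ y, Y y →
      min d (A.filter (adj · y)).card = min d (R.filter (adj · y)).card := by
  -- The reverse inequality is automatic, because `R` is a subset of `A`.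
  suffices ∃ R ⊆ A, R.card ≤ d * w ∧ ∀ y, Y y →
      min d (A.filter (adj · y)).card ≤ (R.filter (adj · y)).card by
    obtain ⟨R, hR, hc, hy⟩ := this
    refine ⟨R, hR, hc, fun y hY => ?_⟩
    have := hy y hY
    have := Finset.card_le_card (Finset.filter_subset_filter (adj · y) hR)
    omega
  induction d with
  | zero => exact ⟨∅, by simp, by simp, by simp⟩
  | succ d ih =>
    obtain ⟨R, hR, hc, hy⟩ := ih
    -- A dominating set for what `R` left over. A vertex `y` with a neighbour in `A \ R` gains a new
    -- neighbour from it; any other `y` already has all its neighbours from `A` in `R`.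
    obtain ⟨R', hR', hc', hy'⟩ := h.exists_dominating (A \ R) fun x hx =>
      hA x (Finset.sdiff_subset hx)
    refine ⟨R ∪ R', Finset.union_subset hR (hR'.trans Finset.sdiff_subset), ?_, fun y hY => ?_⟩
    · have := Finset.card_union_le R R'
      rw [Nat.succ_mul]
      omega
    · have h1 := hy y hY
      have hsub : R.filter (adj · y) ⊆ (R ∪ R').filter (adj · y) :=
        Finset.filter_subset_filter _ Finset.subset_union_left
      by_cases hex : ∃ x ∈ A \ R, adj x y
      · obtain ⟨x, hx, hadj⟩ := hy' y hY hex
        have hlt : (R.filter (adj · y)).card < ((R ∪ R').filter (adj · y)).card := by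
          refine Finset.card_lt_card ⟨hsub, fun hss => ?_⟩
          have := hss (Finset.mem_filter.2 ⟨Finset.mem_union_right _ hx, hadj⟩)
          exact (Finset.mem_sdiff.1 (hR' hx)).2 (Finset.mem_filter.1 this).1
        omega
      · push Not at hex
        have : A.filter (adj · y) ⊆ R.filter (adj · y) := by
          intro x hx
          obtain ⟨hxA, hadj⟩ := Finset.mem_filter.1 hx
          refine Finset.mem_filter.2 ⟨?_, hadj⟩
          by_contra hxR
          exact hex x (Finset.mem_sdiff.2 ⟨hxA, hxR⟩) hadj
        have := Finset.card_le_card (this.trans hsub)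
        omega

end

/-- `mim` bounds the induced matchings between `S` and its complement. -/
theorem matchingLE_mim {V : Type*} [Fintype V] (G : SimpleGraph V) (S : Set V) :
    MatchingLE G.Adj (· ∈ S) (· ∉ S) (mim G S) := by
  classical
  intro R hR f hf hi
  have hinj : Set.InjOn f R := by
    intro x hx x' hx' he
    by_contra hne
    exact hi x hx x' hx' hne (he ▸ (hf x hx).2)
  -- The supremum in `mim` is one of natural numbers, so it dominates its members only once the set
  -- is known to be bounded.
  have hbdd : BddAbove {m | ∃ M : (G.between S Sᶜ).Subgraph,
      M.IsMatching ∧ M.IsInduced ∧ m = M.edgeSet.ncard} := by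
    refine ⟨Nat.card (Sym2 V), ?_⟩
    rintro m ⟨M, -, -, rfl⟩
    exact Set.ncard_le_card _
  -- The subgraph with vertices `R` and `f '' R` and edges `s(x, f x)`. It is induced because two
  -- vertices on the same side of the cut are never adjacent in the bipartite graph.
  refine le_csSup hbdd ⟨⟨{v | v ∈ R ∨ ∃ x ∈ R, v = f x},
    fun u v => (u ∈ R ∧ v = f u) ∨ (v ∈ R ∧ u = f v), ?_, ?_, ?_⟩, ?_, ?_, ?_⟩
  · rintro u v (⟨hu, rfl⟩ | ⟨hv, rfl⟩)
    · exact SimpleGraph.between_adj.2 ⟨(hf u hu).2, .inl ⟨hR u hu, (hf u hu).1⟩⟩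
    · exact SimpleGraph.between_adj.2 ⟨(hf v hv).2.symm, .inr ⟨(hf v hv).1, hR v hv⟩⟩
  · rintro u v (⟨hu, rfl⟩ | ⟨hv, rfl⟩)
    · exact .inl hu
    · exact .inr ⟨v, hv, rfl⟩
  · exact ⟨fun u v h => h.symm⟩
  · rintro u (hu | ⟨x, hx, rfl⟩)
    · refine ⟨f u, .inl ⟨hu, rfl⟩, ?_⟩
      rintro v (⟨-, h⟩ | ⟨hv, rfl⟩)
      · exact h
      · exact absurd (hR _ hu) (hf v hv).1
    · refine ⟨x, .inr ⟨hx, rfl⟩, ?_⟩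
      rintro v (⟨hv, rfl⟩ | ⟨hv, h⟩)
      · exact absurd (hR _ hv) (hf x hx).1
      · exact (hinj hx hv h).symm
  · rintro u hu v hv huv
    obtain ⟨hadj, hS⟩ := SimpleGraph.between_adj.1 huv
    rcases hu with hu | ⟨x, hx, rfl⟩ <;> rcases hv with hv | ⟨y, hy, rfl⟩
    · have h1 := hR u hu
      have h2 := hR v hv
      simp [h1, h2] at hS
    · rcases eq_or_ne u y with rfl | hne
      · exact .inl ⟨hu, rfl⟩
      · exact absurd hadj (hi u hu y hy hne)
    · rcases eq_or_ne v x with rfl | hne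
      · exact .inr ⟨hv, rfl⟩
      · exact absurd hadj.symm (hi v hv x hx hne)
    · have h1 := (hf x hx).1
      have h2 := (hf y hy).1
      simp [h1, h2] at hS
  · have hedge : ∀ M : (G.between S Sᶜ).Subgraph, (∀ u v, M.Adj u v ↔
        (u ∈ R ∧ v = f u) ∨ (v ∈ R ∧ u = f v)) → M.edgeSet = (fun x => s(x, f x)) '' (R : Set V) := by
      intro M hM
      ext e
      induction e using Sym2.ind with
      | _ u v =>
        rw [SimpleGraph.Subgraph.mem_edgeSet, hM]
        constructor
        · rintro (⟨hu, rfl⟩ | ⟨hv, rfl⟩)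
          · exact ⟨u, hu, rfl⟩
          · exact ⟨v, hv, Sym2.eq_swap⟩
        · rintro ⟨x, hx, he⟩
          rcases Sym2.eq_iff.1 he with ⟨rfl, rfl⟩ | ⟨rfl, rfl⟩
          · exact .inl ⟨hx, rfl⟩
          · exact .inr ⟨hx, rfl⟩
    rw [hedge _ fun _ _ => Iff.rfl, Set.InjOn.ncard_image, Set.ncard_coe_finset]
    intro x hx y hy he
    rcases Sym2.eq_iff.1 he with ⟨h, -⟩ | ⟨h, -⟩
    · exact h
    · exact absurd (hR x hx) (h ▸ (hf y hy).1)

/-- The bound on the number of signatures of colourings with `q` colours and `n` vertices. -/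
def sigBound (q d w n : ℕ) : ℕ := ((d * w + 1) * (n + 1) ^ (d * w)) ^ q

theorem card_small_subsets (n m : ℕ) :
    ((Finset.range (m + 1)).biUnion fun i => (Finset.range n).powersetCard i).card ≤
      (m + 1) * (n + 1) ^ m := by
  refine Finset.card_biUnion_le.trans ?_
  rw [← Finset.card_range (m + 1), ← smul_eq_mul, Finset.card_range]
  refine (Finset.sum_le_card_nsmul _ _ ((n + 1) ^ m) fun i hi => ?_).trans (by simp)
  rw [Finset.card_powersetCard, Finset.card_range]
  calc n.choose i ≤ n ^ i := Nat.choose_le_pow _ _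
    _ ≤ (n + 1) ^ i := Nat.pow_le_pow_left (Nat.le_succ n) i
    _ ≤ (n + 1) ^ m := Nat.pow_le_pow_right (Nat.succ_pos n)
        (Nat.lt_succ_iff.1 (Finset.mem_range.1 hi))

theorem cnt_eq_card {A : List (List Bool)} {X : List ℕ} (hX : X.Nodup) (c : ℕ → ℕ) (u a : ℕ) :
    cnt A X c u a =
      ((X.toFinset.filter fun x => c x = a).filter fun x => adjB A x u = true).card := by
  rw [cnt, List.countP_eq_length_filter, ← List.toFinset_card_of_nodup (hX.filter _),
    List.toFinset_filter, Finset.filter_filter]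
  congr 1
  ext x
  simp [and_comm]

/-- There are few signatures of colourings of `X` on `Y` if there are no large induced matchings. -/
theorem exists_signatures_finset (A : List (List Bool)) (q d w : ℕ) {X Y : List ℕ} (hX : X.Nodup)
    (hn : ∀ x ∈ X, x < A.length)
    (h : MatchingLE (fun x y => adjB A x y = true) (· ∈ X) (· ∈ Y) w) :
    ∃ F : Finset (List (List ℕ)), F.card ≤ sigBound q d w A.length ∧
      ∀ c : ℕ → ℕ, sig A q d X c Y ∈ F := by
  classical
  let S := (Finset.range (d * w + 1)).biUnion fun i => (Finset.range A.length).powersetCard i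
  -- A signature is reconstructed from one small representative set for each colour.
  let Φ : (Fin q → Finset ℕ) → List (List ℕ) := fun g => tab A.length q fun u a =>
    if decide (u ∈ Y) then
      min d ((if h : a < q then g ⟨a, h⟩ else ∅).filter fun x => adjB A x u = true).card
    else 0
  refine ⟨(Fintype.piFinset fun _ : Fin q => S).image Φ, ?_, fun c => ?_⟩
  · refine Finset.card_image_le.trans ?_
    rw [Fintype.card_piFinset, Finset.prod_const, Finset.card_univ, Fintype.card_fin]
    exact Nat.pow_le_pow_left (card_small_subsets _ _) q
  · have hrep := fun a : ℕ => h.exists_representative d (X.toFinset.filter fun x => c x = a)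
      fun x hx => by simpa using (Finset.mem_filter.1 hx).1
    choose R hR hc hy using hrep
    refine Finset.mem_image.2 ⟨fun a => R a, ?_, ?_⟩
    · refine Fintype.mem_piFinset.2 fun a => Finset.mem_biUnion.2 ⟨(R a).card, ?_, ?_⟩
      · exact Finset.mem_range.2 (Nat.lt_succ_iff.2 (hc a))
      · refine Finset.mem_powersetCard.2 ⟨fun x hx => ?_, rfl⟩
        have := (Finset.mem_filter.1 (hR a hx)).1
        exact Finset.mem_range.2 (hn x (by simpa using this))
    · refine tab_congr fun u hu a ha => ?_
      by_cases hY : u ∈ Y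
      · simp only [hY, decide_true, if_true, ha, dite_true]
        rw [cnt_eq_card hX]
        convert (hy a u hY).symm
      · simp [hY]

theorem List.length_le_of_mem_finset {α : Type*} [DecidableEq α] {l : List α} (hl : l.Nodup)
    {F : Finset α} (h : ∀ x ∈ l, x ∈ F) : l.length ≤ F.card := by
  rw [← List.toFinset_card_of_nodup hl]
  exact Finset.card_le_card fun x hx => h x (by simpa using hx)

theorem nodup_signatures (A : List (List Bool)) (q d : ℕ) (Y X : List ℕ) :
    (signatures A q d Y X).Nodup := by
  rcases List.eq_nil_or_concat X with rfl | ⟨X, x, rfl⟩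
  · simp [signatures]
  · rw [signatures, List.concat_eq_append, List.foldl_append, List.foldl_cons, List.foldl_nil]
    exact nodup_nub _

theorem length_signatures_le {A : List (List Bool)} {q d w : ℕ} (hd : 1 ≤ d) {X Y : List ℕ}
    (hX : X.Nodup) (hn : ∀ x ∈ X, x < A.length)
    (h : MatchingLE (fun x y => adjB A x y = true) (· ∈ X) (· ∈ Y) w) :
    (signatures A q d Y X).length ≤ sigBound q d w A.length := by
  obtain ⟨F, hF, hmem⟩ := exists_signatures_finset A q d w hX hn h
  refine (List.length_le_of_mem_finset (nodup_signatures A q d Y X) (F := F) ?_).trans hF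
  intro s hs
  obtain ⟨c, -, rfl⟩ := (mem_signatures hd Y hX).1 hs
  exact hmem c

theorem stat_entry_le {n M : ℕ} {W : List (List ℕ)} (hW : ∀ l ∈ W, ∀ x ∈ l, x ≤ M) {X : List ℕ}
    (hX : X.length ≤ n) (c : ℕ → ℕ) (j : ℕ) :
    (X.map fun v => (W.getD (c v) []).getD j 0).sum ≤ n * M := by
  refine (List.sum_le_card_nsmul _ M ?_).trans (by simpa using Nat.mul_le_mul_right M hX)
  intro y hy
  obtain ⟨v, -, rfl⟩ := List.mem_map.1 hy
  rw [List.getD_eq_getElem?_getD]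
  rcases hj : (W.getD (c v) [])[j]? with _ | z
  · simp
  · have hz := List.mem_of_getElem? hj
    rw [List.getD_eq_getElem?_getD] at hz
    rcases hl : W[c v]? with _ | l
    · simp [hl] at hz
    · rw [hl] at hz
      exact hW l (List.mem_of_getElem? hl) z hz

/-- The statistics of colourings have few values. -/
theorem exists_stat_finset (r n M : ℕ) (W : List (List ℕ))
    (hW : ∀ l ∈ W, ∀ x ∈ l, x ≤ M) (X : List ℕ) (hX : X.length ≤ n) :
    ∃ F : Finset (List ℕ), F.card ≤ (n * M + 1) ^ r ∧ ∀ c : ℕ → ℕ, stat r W X c ∈ F := by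
  classical
  refine ⟨(Fintype.piFinset fun _ : Fin r => Finset.range (n * M + 1)).image
    fun g => List.ofFn g, Finset.card_image_le.trans (by simp), fun c => ?_⟩
  refine Finset.mem_image.2 ⟨fun j => (X.map fun v => (W.getD (c v) []).getD j 0).sum, ?_, ?_⟩
  · exact Fintype.mem_piFinset.2 fun j =>
      Finset.mem_range.2 (Nat.lt_succ_iff.2 (stat_entry_le hW hX c j))
  · apply List.ext_getElem
    · simp [stat]
    · intro j h1 h2
      simp [stat]

/-- The entries are distinct triples, so their number is at most the product of the numbers of inner
signatures, outer signatures and statistics. The outer ones need the matching bound for the reversed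
cut. -/
theorem IsTable.length_le {A : List (List Bool)} {q d r w M : ℕ} {allowed : List (ℕ × List ℕ)}
    {W : List (List ℕ)} {S : List ℕ} {x : Item} (hx : IsTable A q d r allowed W S x)
    (hS : S.Nodup) (hn : ∀ u ∈ S, u < A.length) (hW : ∀ l ∈ W, ∀ x ∈ l, x ≤ M)
    (hA : ∀ u v, adjB A u v = true → adjB A v u = true)
    (h : MatchingLE (fun x y => adjB A x y = true) (· ∈ S) (· ∈ compl A.length S) w) :
    x.2.length ≤ sigBound q d w A.length *
      (sigBound q d w A.length * (A.length * M + 1) ^ r) := by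
  obtain ⟨F1, h1, hF1⟩ := exists_signatures_finset A q d w hS hn h
  obtain ⟨F2, h2, hF2⟩ := exists_signatures_finset A q d w (nodup_compl A.length S)
    (fun u hu => (mem_compl.1 hu).1) (h.swap hA)
  have hlen : S.length ≤ A.length := by
    have := (range_perm hS hn).length_eq
    rw [List.length_range, List.length_append] at this
    omega
  obtain ⟨F3, h3, hF3⟩ := exists_stat_finset r A.length M W hW S hlen
  refine (List.length_le_of_mem_finset hx.2.1 (F := F1 ×ˢ F2 ×ˢ F3) ?_).trans ?_
  · intro e he
    obtain ⟨c, -, -, rfl⟩ := (hx.2.2 e).1 he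
    simp [hF1, hF2, hF3]
  · rw [Finset.card_product, Finset.card_product]
    gcongr

end LC

namespace LC

/-! ## Running time of the algorithm -/

namespace Ctx

variable {I : Type} {Γ : Ctx I} {α β : Type} [Enc α] [Enc β]

/-- A fold whose intermediate results have polynomial size. -/
theorem Comp.foldlPrefix {l : I → List α} {s : I → β} {f : I → β → α → β}
    (hl : Γ.Comp l) (hs : Γ.Comp s)
    (hf : (Γ.push fun i => FoldState (l i) (s i) (f i)).Comp fun p => f p.1 p.2.1 p.2.2) :
    Γ.Comp fun i => (l i).foldl (f i) (s i) :=
  Comp.foldl hl hs hf fun _ _ _ _ h => h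

/-- A fold state comes with a next element, so only proper prefixes need a size bound. -/
theorem Comp.varFoldState {l : I → List α} {s : I → β} {f : I → β → α → β} (hl : Γ.Comp l)
    (hsize : ∀ w, ∃ p : Polynomial ℕ, ∀ i, Γ.dom w i → ∀ pre, pre <+: l i → pre ≠ l i →
      (enc (pre.foldl (f i) (s i))).size ≤ p.eval (Γ.sz i)) :
    (Γ.push fun i => FoldState (l i) (s i) (f i)).Comp fun p => p.2 := by
  refine Comp.var fun w => ?_
  obtain ⟨p, hp⟩ := hsize w
  obtain ⟨q, hq⟩ := hl.1 w
  refine ⟨p + q + 1, ?_⟩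
  rintro ⟨i, b, x⟩ ⟨hi, pre, post, h, hb⟩
  simp only at h hb hi
  have h1 := hp i hi pre ⟨_, h.symm⟩ (fun e => by rw [e] at h; simp at h)
  rw [← hb] at h1
  have h2 := (size_le_of_mem (show x ∈ l i by simp [h])).trans (hq i hi)
  simp only [Polynomial.eval_add, Polynomial.eval_one]
  change (enc b).size + (enc x).size + 1 ≤ p.eval (Γ.sz i) + q.eval (Γ.sz i) + 1
  omega

theorem Comp.tab {n : I → ℕ} {q : ℕ} {f : I → ℕ → ℕ → ℕ} (hn : Γ.Comp n)
    (hf : ((Γ.push fun i u => u ∈ List.range (n i)).push fun _ a => a ∈ List.range q).Comp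
      fun p => f p.1.1 p.1.2 p.2) :
    Γ.Comp fun i => tab (n i) q (f i) :=
  hn.range.map (f := fun i u => (List.range q).map fun a => f i u a)
    ((Comp.const (List.range q)).map (f := fun (p : I × ℕ) a => f p.1 p.2 a) hf)

theorem Comp.entry {s : I → List (List ℕ)} {u a : I → ℕ} (hs : Γ.Comp s) (hu : Γ.Comp u)
    (ha : Γ.Comp a) : Γ.Comp fun i => entry (s i) (u i) (a i) :=
  (hs.getD hu []).getD ha 0

theorem Comp.addOn {n : I → ℕ} {q d : ℕ} {Y : I → List ℕ} {s t : I → List (List ℕ)}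
    (hn : Γ.Comp n) (hY : Γ.Comp Y) (hs : Γ.Comp s) (ht : Γ.Comp t) :
    Γ.Comp fun i => addOn (n i) q d (Y i) (s i) (t i) := by
  refine Comp.tab (f := fun i u a => if decide (u ∈ Y i) then
    Min.min d (LC.entry (s i) u a + LC.entry (t i) u a) else 0) hn ?_
  have hu := (Comp.varMem hn.range).weaken
    (Q := fun (_ : I × ℕ) (a : ℕ) => a ∈ List.range q)
  have ha : ((Γ.push fun i u => u ∈ List.range (n i)).push fun _ a => a ∈ List.range q).Comp
    fun p => p.2 := Comp.varMem (Comp.const (List.range q))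
  exact (Comp.mem hu hY.weaken.weaken).ite
    (Comp.min (Comp.const d) ((hs.weaken.weaken.entry hu ha).add (ht.weaken.weaken.entry hu ha)))
    (Comp.const 0)

theorem Comp.adjB {A : I → List (List Bool)} {u v : I → ℕ} (hA : Γ.Comp A) (hu : Γ.Comp u)
    (hv : Γ.Comp v) : Γ.Comp fun i => adjB (A i) (u i) (v i) :=
  (hA.getD hu []).getD hv false

theorem Comp.single {A : I → List (List Bool)} {q : ℕ} {Y : I → List ℕ} {v a : I → ℕ}
    (hA : Γ.Comp A) (hY : Γ.Comp Y) (hv : Γ.Comp v) (ha : Γ.Comp a) :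
    Γ.Comp fun i => single (A i) q (Y i) (v i) (a i) := by
  refine Comp.tab (f := fun i u b => if decide (u ∈ Y i) && (LC.adjB (A i) (v i) u &&
    decide (a i = b)) then 1 else 0) hA.length ?_
  have hu := (Comp.varMem hA.length.range).weaken
    (Q := fun (_ : I × ℕ) (a : ℕ) => a ∈ List.range q)
  have hb : ((Γ.push fun i u => u ∈ List.range (A i).length).push
    fun _ a => a ∈ List.range q).Comp fun p => p.2 := Comp.varMem (Comp.const (List.range q))
  exact ((Comp.mem hu hY.weaken.weaken).and ((hA.weaken.weaken.adjB hv.weaken.weaken hu).and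
    (Comp.eq ha.weaken.weaken hb))).ite (Comp.const 1) (Comp.const 0)

theorem Comp.compl {n : I → ℕ} {S : I → List ℕ} (hn : Γ.Comp n) (hS : Γ.Comp S) :
    Γ.Comp fun i => compl (n i) (S i) :=
  hn.range.filter (f := fun i u => !decide (u ∈ S i))
    (Comp.mem (Comp.varMem hn.range) hS.weaken).not

theorem Comp.addStat {r : ℕ} {K L : I → List ℕ} (hK : Γ.Comp K) (hL : Γ.Comp L) :
    Γ.Comp fun i => addStat r (K i) (L i) :=
  have hr : Γ.Comp fun _ => List.range r := Comp.const _
  hr.map (f := fun i j => (K i).getD j 0 + (L i).getD j 0)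
    ((hK.weaken.getD hr.varMem 0).add (hL.weaken.getD hr.varMem 0))

end Ctx

theorem size_tab_le {n q d : ℕ} {f : ℕ → ℕ → ℕ} (h : ∀ u a, f u a ≤ d) :
    (enc (tab n q f)).size ≤ n * (q * (d + 1) + 1) := by
  refine (size_enc_list_le _ (q * (d + 1)) fun l hl => ?_).trans (by simp [tab])
  obtain ⟨u, -, rfl⟩ := List.mem_map.1 hl
  refine (size_enc_list_le _ d fun x hx => ?_).trans (by simp)
  obtain ⟨a, -, rfl⟩ := List.mem_map.1 hx
  rw [size_enc_nat]
  exact h u a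

theorem size_signature_le {A : List (List Bool)} {q d : ℕ} {Y X : List ℕ} {s : List (List ℕ)}
    (hs : s ∈ signatures A q d Y X) : (enc s).size ≤ A.length * (q * (d + 1) + 1) := by
  rcases List.eq_nil_or_concat X with rfl | ⟨X, x, rfl⟩
  · rw [signatures, List.foldl_nil, List.mem_singleton] at hs
    rw [hs]
    exact size_tab_le fun _ _ => Nat.zero_le _
  · rw [signatures, List.concat_eq_append, List.foldl_append, List.foldl_cons, List.foldl_nil,
      mem_nub] at hs
    obtain ⟨t, -, hs⟩ := List.mem_flatMap.1 hs
    obtain ⟨a, -, rfl⟩ := List.mem_map.1 hs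
    refine size_tab_le fun u b => ?_
    split
    · exact min_le_left _ _
    · exact Nat.zero_le _

namespace Ctx

variable {I : Type} {Γ : Ctx I}

/-- There are polynomially many signatures on `Y` of colourings of prefixes of `X`. -/
def SigBdd (Γ : Ctx I) (A : I → List (List Bool)) (q d : ℕ) (Y X : I → List ℕ) : Prop :=
  ∀ w, ∃ p : Polynomial ℕ, ∀ i, Γ.dom w i → ∀ pre, pre <+: X i →
    (signatures (A i) q d (Y i) pre).length ≤ p.eval (Γ.sz i)

variable {A : I → List (List Bool)} {q d r : ℕ} {allowed : List (ℕ × List ℕ)} {W : List (List ℕ)}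

/-- Duplicates are removed after each vertex, so every intermediate list consists of the signatures
of a prefix of `X`; `SigBdd` bounds their number and `size_signature_le` the size of each. -/
theorem Comp.signatures {X Y : I → List ℕ} (hA : Γ.Comp A) (hY : Γ.Comp Y) (hX : Γ.Comp X)
    (hB : Γ.SigBdd A q d Y X) : Γ.Comp fun i => signatures (A i) q d (Y i) (X i) := by
  refine Comp.foldlPrefix (f := fun i L x => LC.nub (L.flatMap fun s => (List.range q).map fun a =>
    LC.addOn (A i).length q d (Y i) s (LC.single (A i) q (Y i) x a)))
    (s := fun i => [LC.tab (A i).length q fun _ _ => 0]) hX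
    ((Comp.tab (f := fun _ _ _ => 0) hA.length (Comp.const 0)).cons (Comp.const [])) ?_
  refine Comp.nub ?_
  have hv := Comp.varFoldState (Γ := Γ) (f := fun i L x => LC.nub (L.flatMap fun s =>
    (List.range q).map fun a => LC.addOn (A i).length q d (Y i) s (LC.single (A i) q (Y i) x a)))
    (s := fun i => [LC.tab (A i).length q fun _ _ => 0]) hX (by
      intro w
      obtain ⟨p, hp⟩ := hB w
      obtain ⟨p', hp'⟩ := Bdd.length hA w
      refine ⟨p * (p' * Polynomial.C (q * (d + 1) + 1) + 1), fun i hi pre hpre _ => ?_⟩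
      refine (size_enc_list_le _ _ fun s hs => size_signature_le hs).trans ?_
      simp only [Polynomial.eval_mul, Polynomial.eval_add, Polynomial.eval_one, Polynomial.eval_C]
      exact Nat.mul_le_mul (hp i hi pre hpre)
        (Nat.add_le_add_right (Nat.mul_le_mul_right _ (hp' i hi)) 1))
  refine hv.fst.flatMap (f := fun (p : I × List (List (List ℕ)) × ℕ) s => (List.range q).map fun a =>
    LC.addOn (A p.1).length q d (Y p.1) s (LC.single (A p.1) q (Y p.1) p.2.2 a)) ?_
  refine Comp.map (Comp.const (List.range q)) (f := fun (p : (I × List (List (List ℕ)) × ℕ) × List (List ℕ)) a =>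
    LC.addOn (A p.1.1).length q d (Y p.1.1) p.2 (LC.single (A p.1.1) q (Y p.1.1) p.1.2.2 a)) ?_
  exact hA.length.weaken.weaken.weaken.addOn hY.weaken.weaken.weaken hv.fst.varMem.weaken
    (Comp.single hA.weaken.weaken.weaken hY.weaken.weaken.weaken hv.snd.weaken.weaken
      (Comp.varMem (Comp.const (List.range q))))

theorem Comp.leafItem {v : I → ℕ} (hA : Γ.Comp A) (hv : Γ.Comp v)
    (hB : Γ.SigBdd A q d (fun i => [v i]) fun i => LC.compl (A i).length [v i]) :
    Γ.Comp fun i => leafItem (A i) q d r allowed W (v i) := by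
  have hS : Γ.Comp fun i => [v i] := hv.cons (Comp.const [])
  have hC := hA.length.compl hS
  have hO := Comp.signatures hA hS hC hB
  refine hS.pair (Comp.nub ?_)
  have hq : Γ.Comp fun _ => List.range q := Comp.const _
  refine hq.flatMap (f := fun i a => (LC.signatures (A i) q d [v i]
    (LC.compl (A i).length [v i])).flatMap fun τ =>
      if decide ((a, τ.getD (v i) []) ∈ allowed) then
        [(LC.single (A i) q (LC.compl (A i).length [v i]) (v i) a, τ, LC.addStat r (W.getD a []) [])]
      else []) ?_
  refine hO.weaken.flatMap (f := fun p τ => if decide ((p.2, τ.getD (v p.1) []) ∈ allowed) then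
        [(LC.single (A p.1) q (LC.compl (A p.1).length [v p.1]) (v p.1) p.2, τ,
          LC.addStat r (W.getD p.2 []) [])]
      else []) ?_
  have ha := hq.varMem.weaken (Q := fun p τ => τ ∈ LC.signatures (A p.1) q d [v p.1]
    (LC.compl (A p.1).length [v p.1]))
  have hτ := (hO.weaken (Q := fun i a => a ∈ List.range q)).varMem
  refine Comp.ite (Comp.mem (ha.pair (hτ.getD hv.weaken.weaken [])) (Comp.const allowed)) ?_
    (Comp.const [])
  exact ((Comp.single hA.weaken.weaken hC.weaken.weaken hv.weaken.weaken ha).pair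
    (hτ.pair (Comp.addStat (Comp.getD (Comp.const W) ha []) (Comp.const [])))).cons (Comp.const [])

theorem Comp.joinEntry {S T : I → List ℕ} {e f : I → Entry} {τ : I → List (List ℕ)}
    (hA : Γ.Comp A) (hS : Γ.Comp S) (hT : Γ.Comp T) (he : Γ.Comp e) (hf : Γ.Comp f)
    (hτ : Γ.Comp τ) : Γ.Comp fun i => joinEntry (A i) q d r (S i) (T i) (e i) (f i) (τ i) :=
  have hn := hA.length
  Comp.ite ((Comp.eq he.snd.fst (Comp.addOn hn hS hτ hf.fst)).and
      (Comp.eq hf.snd.fst (Comp.addOn hn hT hτ he.fst)))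
    (((Comp.addOn hn (hn.compl (hS.append hT)) he.fst hf.fst).pair
      (hτ.pair (Comp.addStat he.snd.snd hf.snd.snd))).cons (Comp.const []))
    (Comp.const [])

theorem Comp.joinItem {x y : I → Item} (hA : Γ.Comp A) (hx : Γ.Comp x) (hy : Γ.Comp y)
    (hB : Γ.SigBdd A q d (fun i => (x i).1 ++ (y i).1)
      fun i => LC.compl (A i).length ((x i).1 ++ (y i).1)) :
    Γ.Comp fun i => joinItem (A i) q d r (x i) (y i) := by
  have hS := hx.fst.append hy.fst
  have hO := Comp.signatures hA hS (hA.length.compl hS) hB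
  refine hS.pair (Comp.nub ?_)
  refine hx.snd.flatMap (f := fun i e => (y i).2.flatMap fun f =>
    (LC.signatures (A i) q d ((x i).1 ++ (y i).1)
      (LC.compl (A i).length ((x i).1 ++ (y i).1))).flatMap
      (LC.joinEntry (A i) q d r (x i).1 (y i).1 e f)) ?_
  refine hy.snd.weaken.flatMap (f := fun (p : I × Entry) f =>
    (LC.signatures (A p.1) q d ((x p.1).1 ++ (y p.1).1)
      (LC.compl (A p.1).length ((x p.1).1 ++ (y p.1).1))).flatMap
      (LC.joinEntry (A p.1) q d r (x p.1).1 (y p.1).1 p.2 f)) ?_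
  refine hO.weaken.weaken.flatMap (f := fun (p : (I × Entry) × Entry) =>
      LC.joinEntry (A p.1.1) q d r (x p.1.1).1 (y p.1.1).1 p.1.2 p.2) ?_
  exact Comp.joinEntry hA.weaken.weaken.weaken hx.fst.weaken.weaken.weaken
    hy.fst.weaken.weaken.weaken hx.snd.varMem.weaken.weaken hy.snd.weaken.varMem.weaken
    hO.weaken.weaken.varMem

end Ctx
end LC

namespace LC

/-! ## Traversal of the decomposition tree -/

/-- The layout is that of `Data.ofTree`. Labels in `ℕ` give a single type of trees for all graphs.
-/
def encTree : DTree ℕ → Data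
  | .leaf v => Data.cons Data.nil (enc v)
  | .node l r => Data.cons (Data.cons Data.nil Data.nil) (Data.cons (encTree l) (encTree r))

instance : Enc (DTree ℕ) := ⟨encTree⟩

theorem enc_leaf (v : ℕ) : enc (DTree.leaf v) = Data.cons Data.nil (enc v) := rfl
theorem enc_node (l r : DTree ℕ) :
    enc (DTree.node l r) = Data.cons (Data.cons Data.nil Data.nil) (enc (l, r)) := rfl

namespace DTree

def isNode : DTree ℕ → Bool
  | leaf _ => false
  | node _ _ => true

def label : DTree ℕ → ℕ
  | leaf v => v
  | node _ _ => 0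

def children : DTree ℕ → DTree ℕ × DTree ℕ
  | leaf v => (leaf v, leaf v)
  | node l r => (l, r)

/-- The nodes in postorder: a leaf with label `v` is represented by `v + 1`, an inner node by `0`. -/
def postorder : DTree ℕ → List ℕ
  | leaf v => [v + 1]
  | node l r => l.postorder ++ r.postorder ++ [0]

def subtrees : DTree ℕ → List (DTree ℕ)
  | leaf v => [leaf v]
  | node l r => node l r :: (l.subtrees ++ r.subtrees)

theorem self_mem_subtrees (t : DTree ℕ) : t ∈ t.subtrees := by
  cases t <;> simp [subtrees]

theorem postorder_ne_nil (t : DTree ℕ) : 1 ≤ t.postorder.length := by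
  cases t <;> simp [postorder]; omega

theorem length_postorder (t : DTree ℕ) : t.postorder.length + 1 = 2 * t.leaves.length := by
  induction t with
  | leaf v => rfl
  | node l r hl hr => simp only [postorder, leaves, List.length_append, List.length_singleton]; omega

theorem leaves_sublist_of_mem_subtrees {s t : DTree ℕ} (h : s ∈ t.subtrees) :
    s.leaves.Sublist t.leaves := by
  induction t with
  | leaf v => rw [List.mem_singleton.1 h]
  | node l r hl hr =>
    rcases List.mem_cons.1 h with rfl | h
    · exact .refl _
    · rcases List.mem_append.1 h with h | h
      · exact (hl h).trans (List.sublist_append_left _ _)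
      · exact (hr h).trans (List.sublist_append_right _ _)

/-- One step of the traversal of a tree; the state consists of a stack of trees and the output. -/
def postStep (p : List (DTree ℕ) × List ℕ) : List (DTree ℕ) × List ℕ :=
  match p.1 with
  | [] => p
  -- The output grows at its front, so the postorder is produced from its end: the symbol of the
  -- node comes first, and the right child is on top of the stack.
  | t :: s => if t.isNode then (t.children.2 :: t.children.1 :: s, 0 :: p.2)
      else (s, (t.label + 1) :: p.2)

theorem postStep_iterate (t : DTree ℕ) (s : List (DTree ℕ)) (out : List ℕ) :
    postStep^[t.postorder.length] (t :: s, out) = (s, t.postorder ++ out) := by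
  induction t generalizing s out with
  | leaf v => rfl
  | node l r hl hr =>
    have : (node l r).postorder.length = l.postorder.length + (r.postorder.length + 1) := by
      simp [postorder]
    rw [this, Function.iterate_add_apply, Function.iterate_succ_apply]
    have h1 : postStep (node l r :: s, out) = (r :: l :: s, 0 :: out) := rfl
    rw [h1, hr, hl, postorder]
    simp

/-- Surplus iterations are harmless because a state with empty stack is fixed, so an upper bound on
the length suffices. -/
theorem postStep_iterate_of_le {t : DTree ℕ} {m : ℕ} (h : t.postorder.length ≤ m) :
    (postStep^[m] ([t], [])).2 = t.postorder := by
  obtain ⟨j, rfl⟩ := Nat.exists_eq_add_of_le h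
  rw [add_comm, Function.iterate_add_apply, postStep_iterate, List.append_nil]
  have : ∀ j, postStep^[j] ([], t.postorder) = ([], t.postorder) := by
    intro j
    induction j with
    | zero => rfl
    | succ j ih => rw [Function.iterate_succ_apply', ih]; rfl
  rw [this]

/-- Each step only rearranges parts of the state, so its size never grows and any number of
iterations stays polynomial. -/
theorem size_postStep_le (p : List (DTree ℕ) × List ℕ) :
    (enc (postStep p)).size ≤ (enc p).size := by
  rcases p with ⟨_ | ⟨t, s⟩, out⟩
  · exact le_rfl
  · rcases t with v | ⟨l, r⟩
    · change (enc (s, (v + 1) :: out)).size ≤ _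
      simp only [enc_pair, enc_cons, enc_leaf, enc_succ, Data.size]
      omega
    · change (enc (r :: l :: s, 0 :: out)).size ≤ _
      simp only [enc_pair, enc_cons, enc_node, enc_zero, Data.size]
      omega

end DTree

namespace Ctx

variable {I : Type} {Γ : Ctx I}

theorem Comp.isNode {t : I → DTree ℕ} (ht : Γ.Comp t) : Γ.Comp fun i => (t i).isNode := by
  obtain ⟨hs, P, hP⟩ := ht
  refine ⟨(Bdd.const 1).mono fun w i _ => ?_, Prog.comp Prog.hd P, ?_⟩
  · beta_reduce
    rcases t i <;> simp [DTree.isNode, Data.size]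
  · have h := hP.comp (Timed.hd _)
    -- The tags of leaves and nodes are the encodings of `false` and `true`.
    have e : (fun i => (enc (t i)).hd) = fun i => enc (t i).isNode := by
      funext i
      rcases t i <;> rfl
    rw [e] at h
    exact h

/-- The untyped contents of the root: the label for a leaf, the pair of children for a node. After a
test with `isNode` it is reinterpreted by `Comp.of_enc`. -/
theorem Comp.encTail {t : I → DTree ℕ} (ht : Γ.Comp t) : Γ.Comp fun i => (enc (t i)).tl := by
  obtain ⟨hs, P, hP⟩ := ht
  refine ⟨hs.mono fun w i _ => ?_, _, hP.comp (Timed.tl _)⟩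
  beta_reduce
  rcases t i with v | ⟨l, r⟩
  · simp only [enc_leaf, Data.tl, enc_data, Data.size]; omega
  · simp only [enc_node, Data.tl, enc_data, Data.size]; omega

theorem Comp.postStep {p : I → List (DTree ℕ) × List ℕ} (hp : Γ.Comp p) :
    Γ.Comp fun i => DTree.postStep (p i) := by
  refine (Comp.listCases hp.fst hp (g := fun i x => if x.1.isNode then
    (x.1.children.2 :: x.1.children.1 :: x.2, 0 :: (p i).2)
      else (x.2, (x.1.label + 1) :: (p i).2)) ?_).congr fun w i _ => ?_
  swap
  · rw [DTree.postStep]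
    rcases (p i).1 <;> rfl
  have hv := hp.fst.varCons
  refine hv.fst.isNode.iteRestrict ?_ ?_
  · have hc : ((Γ.push fun i (x : DTree ℕ × List (DTree ℕ)) => (p i).1 = x.1 :: x.2).restrict
        fun x => x.2.1.isNode = true).Comp fun x => x.2.1.children := by
      refine hv.fst.encTail.restrict.of_enc fun w x hx => ?_
      have h : x.2.1.isNode = true := hx.2
      rcases hx' : x.2.1 with v | ⟨l, r⟩
      · rw [hx'] at h; cases h
      · rfl
    exact (hc.snd.cons (hc.fst.cons hv.snd.restrict)).pair
      ((Comp.const 0).cons hp.snd.weaken.restrict)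
  · have hl : ((Γ.push fun i (x : DTree ℕ × List (DTree ℕ)) => (p i).1 = x.1 :: x.2).restrict
        fun x => x.2.1.isNode = false).Comp fun x => x.2.1.label := by
      refine hv.fst.encTail.restrict.of_enc fun w x hx => ?_
      have h : x.2.1.isNode = false := hx.2
      rcases hx' : x.2.1 with v | ⟨l, r⟩
      · rfl
      · rw [hx'] at h; cases h
    exact hv.snd.restrict.pair (hl.succ.cons hp.snd.weaken.restrict)

theorem Comp.postorder {t : I → DTree ℕ} {m : I → ℕ} (ht : Γ.Comp t) (hm : Γ.Comp m)
    (h : ∀ w i, Γ.dom w i → (t i).postorder.length ≤ m i) : Γ.Comp fun i => (t i).postorder := by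
  have hs : Γ.Comp fun i => (([t i], []) : List (DTree ℕ) × List ℕ) :=
    (ht.cons (Comp.const [])).pair (Comp.const [])
  have := Comp.iterate (f := fun _ => DTree.postStep) hm hs hs.1 (fun w i j _ _ => ?_)
    (Comp.varSize hs.1).postStep
  · exact this.snd.congr fun w i hi => (DTree.postStep_iterate_of_le (h w i hi)).symm
  · induction j with
    | zero => exact le_rfl
    | succ j ih =>
      rw [Function.iterate_succ_apply']
      exact (DTree.size_postStep_le _).trans (ih (by omega))

end Ctx

/-! ## The stack machine -/

/-- One step of the evaluation of a tree in postorder. -/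
def stackStep (A : List (List Bool)) (q d r : ℕ) (allowed : List (ℕ × List ℕ)) (W : List (List ℕ))
    (st : List Item) (x : ℕ) : List Item :=
  if decide (x = 0) then
    match st with
    | [] => []
    | b :: s =>
      match s with
      | [] => []
      | a :: s' => joinItem A q d r a b :: s'
  else leafItem A q d r allowed W (x - 1) :: st

variable {A : List (List Bool)} {q d r : ℕ} {allowed : List (ℕ × List ℕ)} {W : List (List ℕ)}

theorem treeItem_fst (t : DTree ℕ) : (treeItem A q d r allowed W t).1 = t.leaves := by
  induction t with
  | leaf v => rfl
  | node s t hs ht => rw [treeItem, joinItem, hs, ht, DTree.leaves]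

theorem foldl_stackStep (t : DTree ℕ) (st : List Item) :
    t.postorder.foldl (stackStep A q d r allowed W) st = treeItem A q d r allowed W t :: st := by
  induction t generalizing st with
  | leaf v => rfl
  | node s t hs ht =>
    rw [DTree.postorder, List.foldl_append, List.foldl_append, hs, ht]
    rfl

/-- The stack consists of tables for subtrees, and the operands of the next operation are on top. -/
theorem stack_state (t : DTree ℕ) (st : List Item) (pre : List ℕ) (x : ℕ) (post : List ℕ)
    (h : t.postorder = pre ++ x :: post) :
    ∃ ts : List (DTree ℕ), (∀ s ∈ ts, s ∈ t.subtrees) ∧ ts.length ≤ pre.length ∧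
      pre.foldl (stackStep A q d r allowed W) st = ts.map (treeItem A q d r allowed W) ++ st ∧
      ((∃ v, x = v + 1 ∧ DTree.leaf v ∈ t.subtrees) ∨
        (x = 0 ∧ ∃ a b rest, DTree.node a b ∈ t.subtrees ∧ ts = b :: a :: rest)) := by
  -- The initial stack has to be arbitrary, as the right subtree is evaluated with the table of the
  -- left one below it. For a node, `x` is the final 0 or lies in the postorder of the right or of
  -- the left subtree.
  induction t generalizing st pre x post with
  | leaf v =>
    have h' : pre = [] ∧ x = v + 1 := by
      rcases pre with _ | ⟨y, pre⟩
      · simp [DTree.postorder] at h; simp [h]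
      · simp [DTree.postorder] at h
    obtain ⟨rfl, rfl⟩ := h'
    exact ⟨[], by simp, by simp, rfl, .inl ⟨v, rfl, by simp [DTree.subtrees]⟩⟩
  | node a b ha hb =>
    have hsa : ∀ s ∈ a.subtrees, s ∈ (DTree.node a b).subtrees := fun s hs => by
      simp [DTree.subtrees, hs]
    have hsb : ∀ s ∈ b.subtrees, s ∈ (DTree.node a b).subtrees := fun s hs => by
      simp [DTree.subtrees, hs]
    rw [DTree.postorder] at h
    rcases List.eq_nil_or_concat post with rfl | ⟨post', z, rfl⟩
    · obtain ⟨h1, h2⟩ := List.append_inj' h rfl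
      obtain rfl : x = 0 := by simpa using h2.symm
      refine ⟨[b, a], ?_, ?_, ?_, .inr ⟨rfl, a, b, [], DTree.self_mem_subtrees _, rfl⟩⟩
      · intro s hs
        simp only [List.mem_cons, List.not_mem_nil, or_false] at hs
        rcases hs with rfl | rfl
        · exact hsb _ (DTree.self_mem_subtrees _)
        · exact hsa _ (DTree.self_mem_subtrees _)
      · have := a.postorder_ne_nil
        have := b.postorder_ne_nil
        simp only [← h1, List.length_append, List.length_cons, List.length_nil]
        omega
      · rw [← h1, List.foldl_append, foldl_stackStep, foldl_stackStep]
        rfl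
    · rw [List.concat_eq_append, ← List.cons_append, ← List.append_assoc] at h
      have h1 := (List.append_inj' h rfl).1
      have hright : ∀ pre', pre = a.postorder ++ pre' → b.postorder = pre' ++ x :: post' →
          ∃ ts : List (DTree ℕ), (∀ s ∈ ts, s ∈ (DTree.node a b).subtrees) ∧
            ts.length ≤ pre.length ∧
            pre.foldl (stackStep A q d r allowed W) st =
              ts.map (treeItem A q d r allowed W) ++ st ∧
            ((∃ v, x = v + 1 ∧ DTree.leaf v ∈ (DTree.node a b).subtrees) ∨
              (x = 0 ∧ ∃ a' b' rest, DTree.node a' b' ∈ (DTree.node a b).subtrees ∧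
                ts = b' :: a' :: rest)) := by
        rintro pre' rfl h2
        obtain ⟨ts, h3, h4, h5, h6⟩ := hb (treeItem A q d r allowed W a :: st) pre' x post' h2
        refine ⟨ts ++ [a], ?_, ?_, ?_, ?_⟩
        · intro s hs
          rcases List.mem_append.1 hs with hs | hs
          · exact hsb s (h3 s hs)
          · rw [List.mem_singleton.1 hs]
            exact hsa _ (DTree.self_mem_subtrees _)
        · have := a.postorder_ne_nil
          simp only [List.length_append, List.length_singleton]
          omega
        · rw [List.foldl_append, foldl_stackStep, h5]
          simp
        · rcases h6 with ⟨v, hv, hm⟩ | ⟨hx, a', b', rest, hm, rfl⟩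
          · exact .inl ⟨v, hv, hsb _ hm⟩
          · exact .inr ⟨hx, a', b', rest ++ [a], hsb _ hm, by simp⟩
      rcases List.append_eq_append_iff.1 h1 with ⟨pre', h2, h3⟩ | ⟨c, h2, h3⟩
      · exact hright pre' h2 h3
      -- If `c` is empty, then `x` is the first symbol of the right subtree.
      · rcases c with _ | ⟨y, c⟩
        · exact hright [] (by simpa using h2.symm) (by simpa using h3.symm)
        · obtain ⟨rfl, h3⟩ := List.cons_eq_cons.1 h3
          obtain ⟨ts, h4, h5, h6, h7⟩ := ha st pre x c h2
          refine ⟨ts, fun s hs => hsa s (h4 s hs), h5, h6, ?_⟩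
          rcases h7 with ⟨v, hv, hm⟩ | ⟨hx, a', b', rest, hm, he⟩
          · exact .inl ⟨v, hv, hsa _ hm⟩
          · exact .inr ⟨hx, a', b', rest, hsa _ hm, he⟩

end LC

/-! ### Polynomial bounds for the tables and for the whole dynamic programme. -/

namespace LC

theorem size_sig_le (A : List (List Bool)) (q d : ℕ) (X : List ℕ) (c : ℕ → ℕ) (Y : List ℕ) :
    (enc (sig A q d X c Y)).size ≤ A.length * (q * (d + 1) + 1) := by
  refine size_tab_le fun u a => ?_
  split
  · exact min_le_left _ _
  · exact Nat.zero_le _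

theorem length_le_of_nodup {n : ℕ} {S : List ℕ} (hS : S.Nodup) (hn : ∀ u ∈ S, u < n) :
    S.length ≤ n := by
  have := (range_perm hS hn).length_eq
  rw [List.length_range, List.length_append] at this
  omega

/-- A bound on the size of tables. -/
def itemBound (q d r w M n : ℕ) : ℕ :=
  n * (n + 1) + sigBound q d w n * (sigBound q d w n * (n * M + 1) ^ r) *
    (2 * (n * (q * (d + 1) + 1)) + r * (n * M + 1) + 3) + 1

theorem IsTable.size_le {A : List (List Bool)} {q d r w M : ℕ} {allowed : List (ℕ × List ℕ)}
    {W : List (List ℕ)} {S : List ℕ} {x : Item} (hx : IsTable A q d r allowed W S x)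
    (hS : S.Nodup) (hn : ∀ u ∈ S, u < A.length) (hW : ∀ l ∈ W, ∀ x ∈ l, x ≤ M)
    (hA : ∀ u v, adjB A u v = true → adjB A v u = true)
    (h : MatchingLE (fun x y => adjB A x y = true) (· ∈ S) (· ∈ compl A.length S) w) :
    (enc x).size ≤ itemBound q d r w M A.length := by
  have hlen := length_le_of_nodup hS hn
  have h1 : (enc x.1).size ≤ A.length * (A.length + 1) := by
    rw [hx.1]
    refine (size_enc_list_le S A.length fun u hu => ?_).trans (Nat.mul_le_mul_right _ hlen)
    rw [size_enc_nat]
    exact (hn u hu).le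
  have h2 : (enc x.2).size ≤ _ := size_enc_list_le x.2
    (2 * (A.length * (q * (d + 1) + 1)) + r * (A.length * M + 1) + 2) fun e he => by
      obtain ⟨c, -, -, rfl⟩ := (hx.2.2 e).1 he
      have h3 := size_sig_le A q d S c (compl A.length S)
      have h4 := size_sig_le A q d (compl A.length S) c S
      have h5 : (enc (stat r W S c)).size ≤ r * (A.length * M + 1) := by
        refine (size_enc_list_le _ (A.length * M) fun y hy => ?_).trans (by simp [stat])
        obtain ⟨j, -, rfl⟩ := List.mem_map.1 hy
        rw [size_enc_nat]
        exact stat_entry_le hW hlen c j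
      simp only [enc_pair, Data.size]
      omega
  have h6 := Nat.mul_le_mul_right
    (2 * (A.length * (q * (d + 1) + 1)) + r * (A.length * M + 1) + 3)
    (hx.length_le hS hn hW hA h)
  change (enc x.1).size + (enc x.2).size + 1 ≤ _
  unfold itemBound
  simp only [add_assoc, Nat.reduceAdd] at h2 h6 ⊢
  omega

namespace Ctx

variable {I : Type} {Γ : Ctx I} {q d r : ℕ} {allowed : List (ℕ × List ℕ)} {W : List (List ℕ)}

theorem exists_sigBound (q d w : ℕ) :
    ∃ p : Polynomial ℕ, ∀ n, sigBound q d w n = p.eval n :=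
  ⟨(Polynomial.C (d * w + 1) * (Polynomial.X + 1) ^ (d * w)) ^ q, fun n => by
    simp only [sigBound, Polynomial.eval_pow, Polynomial.eval_mul, Polynomial.eval_C,
      Polynomial.eval_add, Polynomial.eval_X, Polynomial.eval_one]⟩

theorem exists_itemBound (q d r w M : ℕ) :
    ∃ p : Polynomial ℕ, ∀ n, itemBound q d r w M n = p.eval n := by
  obtain ⟨p, hp⟩ := exists_sigBound q d w
  refine ⟨.X * (.X + 1) + p * (p * (.X * .C M + 1) ^ r) *
    (2 * (.X * .C (q * (d + 1) + 1)) + .C r * (.X * .C M + 1) + 3) + 1, fun n => ?_⟩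
  simp only [itemBound, hp, Polynomial.eval_pow, Polynomial.eval_mul, Polynomial.eval_C,
    Polynomial.eval_add, Polynomial.eval_X, Polynomial.eval_one, Polynomial.eval_ofNat]

/-- A prefix of the complement is a subset of it, and induced matchings of a part of a cut are
induced matchings of the cut. -/
theorem SigBdd.of_matchingLE {A : I → List (List Bool)} {S : I → List ℕ} (hd : 1 ≤ d)
    (hlen : ∀ w i, Γ.dom w i → (A i).length = Γ.sz i)
    (h : ∀ w i, Γ.dom w i → MatchingLE (fun x y => adjB (A i) x y = true)
      (· ∈ LC.compl (A i).length (S i)) (· ∈ S i) w) :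
    Γ.SigBdd A q d S fun i => LC.compl (A i).length (S i) := by
  intro w
  obtain ⟨p, hp⟩ := exists_sigBound q d w
  refine ⟨p, fun i hi pre hpre => ?_⟩
  rw [← hp, ← hlen w i hi]
  exact length_signatures_le hd (hpre.sublist.nodup (nodup_compl _ _))
    (fun x hx => (mem_compl.1 (hpre.subset hx)).1)
    ((h w i hi).mono (fun x hx => hpre.subset hx) fun x hx => hx)

/-- `A i` is the adjacency matrix of a graph, and `T i` is a decomposition tree of this graph; in
the domain for `w`, all induced matchings of the cuts have at most `w` edges. -/
structure Decomposed (Γ : Ctx I) (A : I → List (List Bool)) (T : I → DTree ℕ) : Prop where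
  length_eq : ∀ w i, Γ.dom w i → (A i).length = Γ.sz i
  irrefl : ∀ w i, Γ.dom w i → ∀ u, adjB (A i) u u = false
  symm : ∀ w i, Γ.dom w i → ∀ u v, adjB (A i) u v = true → adjB (A i) v u = true
  nodup : ∀ w i, Γ.dom w i → (T i).leaves.Nodup
  lt : ∀ w i, Γ.dom w i → ∀ u ∈ (T i).leaves, u < (A i).length
  matchingLE : ∀ w i, Γ.dom w i → ∀ t ∈ (T i).subtrees,
    MatchingLE (fun x y => adjB (A i) x y = true) (· ∈ t.leaves)
      (· ∈ LC.compl (A i).length t.leaves) w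

/-- At every moment the stack holds at most as many tables as symbols have been read, each of them
the table of a subtree. Hence its size is polynomial, and each step works at a cut of the tree,
where the matching bound applies. -/
theorem Comp.treeItem {A : I → List (List Bool)} {T : I → DTree ℕ} (hd : 1 ≤ d) (hA : Γ.Comp A)
    (hT : Γ.Comp T) (hΓ : Γ.Decomposed A T) :
    Γ.Comp fun i => treeItem (A i) q d r allowed W (T i) := by
  have hsw : ∀ w i, Γ.dom w i → ∀ t ∈ (T i).subtrees,
      MatchingLE (fun x y => LC.adjB (A i) x y = true) (· ∈ LC.compl (A i).length t.leaves)
        (· ∈ t.leaves) w :=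
    fun w i hi t ht => (hΓ.matchingLE w i hi t ht).swap (hΓ.symm w i hi)
  have hpost : Γ.Comp fun i => (T i).postorder := by
    refine Comp.postorder hT (hA.length.add hA.length) fun w i hi => ?_
    have h1 := (T i).length_postorder
    have h2 := length_le_of_nodup (hΓ.nodup w i hi) (hΓ.lt w i hi)
    omega
  have hv := Comp.varFoldState (f := fun i => stackStep (A i) q d r allowed W)
    (s := fun _ => ([] : List Item)) hpost (by
      intro w
      -- The sum of all entries of `W` serves as a crude upper bound for each of them.
      obtain ⟨p, hp⟩ := exists_itemBound q d r w W.flatten.sum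
      obtain ⟨p', hp'⟩ := Bdd.length hpost w
      refine ⟨p' * (p + 1), fun i hi pre hpre hne => ?_⟩
      obtain ⟨post, hpost⟩ := hpre
      rcases post with _ | ⟨x, post⟩
      · exact absurd (by simpa using hpost) hne
      obtain ⟨ts, h1, h2, h3, -⟩ := stack_state (A := A i) (q := q) (d := d) (r := r)
        (allowed := allowed) (W := W) (T i) [] pre x post hpost.symm
      rw [h3, List.append_nil]
      refine (size_enc_list_le _ (p.eval (Γ.sz i)) fun y hy => ?_).trans ?_
      · obtain ⟨s, hs, rfl⟩ := List.mem_map.1 hy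
        have hsub := DTree.leaves_sublist_of_mem_subtrees (h1 s hs)
        have hnd := hsub.nodup (hΓ.nodup w i hi)
        have hlt : ∀ u ∈ s.leaves, u < (A i).length :=
          fun u hu => hΓ.lt w i hi u (hsub.subset hu)
        rw [← hp, ← hΓ.length_eq w i hi]
        refine (isTable_treeItem hd (hΓ.irrefl w i hi) s hnd hlt).size_le hnd hlt ?_
          (hΓ.symm w i hi) (hΓ.matchingLE w i hi s (h1 s hs))
        exact fun l hl x hx => List.le_sum_of_mem (List.mem_flatten.2 ⟨l, hl, hx⟩)
      · have h4 := hp' i hi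
        simp only [← hpost, List.length_append] at h4
        simp only [List.length_map, Polynomial.eval_mul, Polynomial.eval_add, Polynomial.eval_one]
        exact Nat.mul_le_mul_right _ (by omega))
  have hfold : Γ.Comp fun i => (T i).postorder.foldl (stackStep (A i) q d r allowed W) [] := by
    refine Comp.foldlPrefix (f := fun i => stackStep (A i) q d r allowed W)
      (s := fun _ => ([] : List Item)) hpost (Comp.const []) ?_
    refine hv.snd.eqZero.iteRestrict ?_ ?_
    · refine Comp.listCases hv.fst.restrict (Comp.const []) (g := fun p (x : Item × List Item) =>
        match x.2 with
        | [] => []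
        | a :: s' => LC.joinItem (A p.1) q d r a x.1 :: s') ?_ |>.congr fun w p _ => by
          rcases p.2.1 <;> rfl
      have hv2 := Comp.varCons (hv.fst.restrict (D := fun p => decide (p.2.2 = 0) = true))
      refine Comp.listCases hv2.snd (Comp.const []) (g := fun p (x : Item × List Item) =>
        LC.joinItem (A p.1.1) q d r x.1 p.2.1 :: x.2) ?_ |>.congr fun w p _ => by
          rcases p.2.2 <;> rfl
      have hv3 := Comp.varCons hv2.snd
      refine (Comp.joinItem hA.weaken.restrict.weaken.weaken hv3.fst hv2.fst.weaken ?_).cons hv3.snd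
      refine SigBdd.of_matchingLE hd (fun w p hp => hΓ.length_eq w _ hp.1.1.1.1) ?_
      -- The two topmost items are the tables of the children of some node of the tree, so the union
      -- of their vertex sets is the set below that node.
      rintro w ⟨⟨⟨i, st, x⟩, b, s⟩, a, s'⟩ ⟨⟨⟨⟨hi, pre, post, hpp, hst⟩, hx⟩, h1⟩, h2⟩
      simp only [decide_eq_true_eq] at hi hpp hst hx h1 h2 ⊢
      obtain ⟨ts, -, -, h3, h4⟩ := stack_state (A := A i) (q := q) (d := d) (r := r)
        (allowed := allowed) (W := W) (T i) [] pre x post hpp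
      rcases h4 with ⟨v, rfl, -⟩ | ⟨-, a', b', rest, hm, rfl⟩
      · cases hx
      · rw [← hst, h1, h2] at h3
        simp only [List.map_cons, List.cons_append, List.cons.injEq] at h3
        obtain ⟨rfl, rfl, -⟩ := h3
        rw [treeItem_fst, treeItem_fst]
        exact hsw w i hi _ hm
    · refine (Comp.leafItem hA.weaken.restrict (hv.snd.sub (Comp.const 1)).restrict ?_).cons
        hv.fst.restrict
      refine SigBdd.of_matchingLE hd (fun w p hp => hΓ.length_eq w _ hp.1.1) ?_
      rintro w ⟨i, st, x⟩ ⟨⟨hi, pre, post, hpp, hst⟩, hx⟩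
      simp only [decide_eq_false_iff_not] at hi hpp hst hx ⊢
      obtain ⟨ts, -, -, -, h4⟩ := stack_state (A := A i) (q := q) (d := d) (r := r)
        (allowed := allowed) (W := W) (T i) [] pre x post hpp
      rcases h4 with ⟨v, rfl, hm⟩ | ⟨rfl, -⟩
      · exact hsw w i hi _ hm
      · exact absurd rfl hx
  refine (Comp.listCases hfold (Comp.const ([], [])) (g := fun _ x => x.1)
    hfold.varCons.fst).congr fun w i _ => ?_
  rw [foldl_stackStep]

end Ctx
end LC

namespace LC

/-! ## The problems as locally checkable problems -/

section Problems

variable {V : Type*} [Fintype V]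

open Classical in
theorem sum_card_fibers {C : Type} [Fintype C] (c : V → C) :
    ∑ a, (Finset.univ.filter fun v => c v = a).card = Fintype.card V :=
  (Finset.card_eq_sum_card_fiberwise fun _ _ => Finset.mem_univ _).symm

theorem sum_mul_colorCount {C : Type} [Fintype C] (G : SimpleGraph V) (c : V → C) (v : V)
    (h : C → ℕ) : ∑ a, h a * colorCount G c v a = ∑ u ∈ nbrs G v, h (c u) := by
  classical
  rw [← Finset.sum_fiberwise (nbrs G v) c]
  refine Finset.sum_congr rfl fun a _ => ?_
  rw [Finset.sum_congr rfl (g := fun _ => h a) fun u hu => by rw [(Finset.mem_filter.1 hu).2],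
    Finset.sum_const, smul_eq_mul, mul_comm, colorCount]

theorem mem_nbrs {G : SimpleGraph V} {v u : V} : u ∈ nbrs G v ↔ G.Adj v u := by
  simp [nbrs]

theorem sum_closedNbrs (G : SimpleGraph V) (v : V) (h : V → ℕ) :
    ∑ u ∈ closedNbrs G v, h u = h v + ∑ u ∈ nbrs G v, h u := by
  classical
  rw [closedNbrs, Finset.sum_insert (by simp [mem_nbrs])]

/-! `[k]`-Roman domination -/

/-- Subtracting the number of neighbours of nonzero colour turns the coefficient `j` into `j - 1`;
for `j = 0` the truncated subtraction gives the correct value 0. -/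
theorem romanCheck_iff (k a : ℕ) (l : Fin (k + 2) → ℕ) :
    k + ∑ j ∈ Finset.univ.filter (fun j : Fin (k + 2) => 1 ≤ (j : ℕ)), l j ≤
      a + ∑ j : Fin (k + 2), (j : ℕ) * l j ↔ k ≤ a + ∑ j : Fin (k + 2), ((j : ℕ) - 1) * l j := by
  have : ∑ j : Fin (k + 2), (j : ℕ) * l j =
      ∑ j ∈ Finset.univ.filter (fun j : Fin (k + 2) => 1 ≤ (j : ℕ)), l j +
        ∑ j : Fin (k + 2), ((j : ℕ) - 1) * l j := by
    rw [Finset.sum_filter, ← Finset.sum_add_distrib]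
    refine Finset.sum_congr rfl fun j _ => ?_
    rcases Nat.eq_zero_or_pos (j : ℕ) with h | h
    · simp [h]
    · obtain ⟨m, hm⟩ := Nat.exists_eq_add_of_le' h
      rw [hm]
      simp
      ring
  omega

/-- If some count with positive coefficient `j - 1` is at least `k`, then that term alone satisfies
the check, truncated or not. Otherwise truncation at `k` changes no term that matters. -/
theorem romanLCP_checkStable (k : ℕ) (G : SimpleGraph V) : (romanLCP V k).CheckStable G k := by
  intro v c
  set l := colorCount G c v
  change k + _ ≤ (c v : ℕ) + _ ↔ k + _ ≤ (c v : ℕ) + _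
  rw [romanCheck_iff, romanCheck_iff k _ fun a => min k (l a)]
  constructor
  · intro h
    by_contra hlt
    refine hlt ?_
    rw [Finset.sum_congr rfl (g := fun j : Fin (k + 2) => ((j : ℕ) - 1) * l j)]
    · exact h
    intro j hj
    have hle := Finset.single_le_sum (f := fun j : Fin (k + 2) => ((j : ℕ) - 1) * min k (l j))
      (fun _ _ => Nat.zero_le _) hj
    rcases Nat.eq_zero_or_pos ((j : ℕ) - 1) with h0 | h0
    · simp [h0]
    · have := Nat.le_mul_of_pos_left (min k (l j)) h0
      congr 1
      change ((j : ℕ) - 1) * min k (l j) ≤ _ at hle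
      omega
  · intro h
    refine h.trans (Nat.add_le_add_left (Finset.sum_le_sum fun j _ => ?_) _)
    exact Nat.mul_le_mul_left _ (min_le_right _ _)

/-- The check is imposed at all vertices, not only where `f v < k`. For `f v ≥ k` it holds anyway,
because the neighbours with nonzero value contribute at least 1 each. -/
theorem romanLCP_isProper_iff (k : ℕ) (G : SimpleGraph V) (f : V → Fin (k + 2)) :
    (romanLCP V k).IsProper G f ↔ IsRoman k G f := by
  refine forall_congr' fun v => ?_
  change k + _ ≤ (f v : ℕ) + _ ↔ _
  have h1 := sum_mul_colorCount G f v fun j => (j : ℕ)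
  have h2 : ∑ j ∈ Finset.univ.filter (fun j : Fin (k + 2) => 1 ≤ (j : ℕ)), colorCount G f v j =
      ((nbrs G v).filter (fun u => 1 ≤ (f u : ℕ))).card := by
    rw [Finset.card_filter, ← sum_mul_colorCount G f v fun j => if 1 ≤ (j : ℕ) then 1 else 0,
      Finset.sum_filter]
    exact Finset.sum_congr rfl fun j _ => by split <;> simp
  rw [h1, h2, sum_closedNbrs G v fun u => (f u : ℕ)]
  have h3 : ((nbrs G v).filter (fun u => 1 ≤ (f u : ℕ))).card ≤ ∑ u ∈ nbrs G v, (f u : ℕ) := by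
    rw [Finset.card_filter]
    exact Finset.sum_le_sum fun u _ => by split <;> omega
  constructor
  · intro h _
    omega
  · intro h
    by_cases hk : (f v : ℕ) < k
    · have := h hk
      omega
    · omega

theorem romanLCP_satisfiesSizes (k : ℕ) (f : V → Fin (k + 2)) :
    (romanLCP V k).SatisfiesSizes f := sum_card_fibers f

theorem romanLCP_coloringWeight (k : ℕ) (G : SimpleGraph V) (f : V → Fin (k + 2)) :
    (romanLCP V k).coloringWeight G f = ((∑ v, (f v : ℕ) : ℕ) : ℕ∞) := by
  rw [Nat.cast_sum, Finset.sum_eq_fold]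
  rfl

theorem exists_isRoman (k : ℕ) (G : SimpleGraph V) :
    ∃ f : V → Fin (k + 2), IsRoman k G f :=
  ⟨fun _ => Fin.last _, fun v hv => absurd hv (by simp)⟩

theorem romanNumber_spec (k : ℕ) (G : SimpleGraph V) :
    (∃ f : V → Fin (k + 2), IsRoman k G f ∧ romanNumber k G = ∑ v, (f v : ℕ)) ∧
      ∀ f : V → Fin (k + 2), IsRoman k G f → romanNumber k G ≤ ∑ v, (f v : ℕ) := by
  obtain ⟨f, hf⟩ := exists_isRoman k G
  exact ⟨Nat.sInf_mem (s := {s | ∃ f : V → Fin (k + 2), IsRoman k G f ∧ s = ∑ v, (f v : ℕ)})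
    ⟨_, f, hf, rfl⟩, fun f hf => Nat.sInf_le ⟨f, hf, rfl⟩⟩

theorem romanLCP_opt (k : ℕ) (G : SimpleGraph V) :
    (romanLCP V k).opt G = (romanNumber k G : ℕ∞) := by
  classical
  obtain ⟨⟨f, hf, he⟩, hmin⟩ := romanNumber_spec k G
  apply le_antisymm
  · rw [he, ← romanLCP_coloringWeight]
    refine Finset.inf_le (Finset.mem_filter.2 ⟨Finset.mem_univ _, ?_, romanLCP_satisfiesSizes k f⟩)
    exact (romanLCP_isProper_iff k G f).2 hf
  · refine Finset.le_inf fun g hg => ?_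
    rw [romanLCP_coloringWeight]
    exact Nat.cast_le.2 (hmin g ((romanLCP_isProper_iff k G g).1 (Finset.mem_filter.1 hg).2.1))

/-! Decision problems -/

/-- The infimum over no colourings is the maximum, which is `1 ≠ 0` in `Fin 2`. -/
theorem LCP.opt_eq_zero_iff {C : Type} [Fintype C] (P : LCP V C (Fin 2)) (G : SimpleGraph V)
    (h : ∀ c, P.coloringWeight G c = 0) :
    P.opt G = 0 ↔ ∃ c, P.IsProper G c ∧ P.SatisfiesSizes c := by
  classical
  constructor
  · intro h0
    by_contra hne
    push Not at hne
    rw [LCP.opt, Finset.filter_false_of_mem fun c _ hc => hne c hc.1 hc.2, Finset.inf_empty] at h0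
    exact absurd h0 (by decide)
  · rintro ⟨c, hc⟩
    refine le_antisymm ?_ (Fin.zero_le _)
    rw [← h c]
    exact Finset.inf_le (Finset.mem_filter.2 ⟨Finset.mem_univ _, hc⟩)

theorem fold_max_zero {U : Type*} (s : Finset U) : s.fold (max : Fin 2 → Fin 2 → Fin 2) 0 (fun _ => 0) = 0 := by
  classical
  induction s using Finset.induction_on with
  | empty => rfl
  | insert a s ha ih => rw [Finset.fold_insert ha, ih]; rfl

theorem CFVariant.toLCP_coloringWeight (X : CFVariant) (k : ℕ) (G : SimpleGraph V)
    (c : V → Fin (X.numColors k)) : (X.toLCP V k).coloringWeight G c = 0 := fold_max_zero _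

theorem CFVariant.toLCP_satisfiesSizes (X : CFVariant) (k : ℕ) (c : V → Fin (X.numColors k)) :
    (X.toLCP V k).SatisfiesSizes c := sum_card_fibers c

theorem CFVariant.toLCP_isStable (X : CFVariant) (k : ℕ) (G : SimpleGraph V) :
    (X.toLCP V k).IsStable G 2 := by
  refine ⟨fun v c => exists_congr fun j => and_congr_right fun _ => ?_, fun _ _ => rfl⟩
  change colorCount G c v j + (if X.closed = true ∧ c v = j then 1 else 0) = 1 ↔
    min 2 (colorCount G c v j) + (if X.closed = true ∧ c v = j then 1 else 0) = 1
  by_cases h : X.closed = true ∧ c v = j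
  · simp only [h, and_self, if_true]
    omega
  · simp only [h, if_false]
    omega

/-- In both kinds of neighbourhood the number in the check is the size of the colour class within
the neighbourhood; a class of size 1 is the same as a vertex whose colour is unique there. -/
theorem CFVariant.toLCP_isProper_iff (X : CFVariant) (k : ℕ) (G : SimpleGraph V)
    (c : V → Fin (X.numColors k)) : (X.toLCP V k).IsProper G c ↔ X.IsColoring k G c := by
  classical
  refine forall_congr' fun v => ?_
  have hcard : ∀ j, colorCount G c v j + (if X.closed = true ∧ c v = j then 1 else 0) =
      ((X.nbhd G v).filter fun u => c u = j).card := by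
    intro j
    have h0 : colorCount G c v j = ((nbrs G v).filter fun u => c u = j).card := by
      rw [colorCount]; congr!
    rw [h0]
    have hc : closedNbrs G v = insert v (nbrs G v) := by rw [closedNbrs]
    by_cases hX : X.closed = true
    · rw [CFVariant.nbhd, if_pos hX, hc, Finset.filter_insert]
      by_cases hv : c v = j
      · rw [if_pos ⟨hX, hv⟩, if_pos hv, Finset.card_insert_of_notMem (by simp [mem_nbrs])]
      · rw [if_neg (fun h => hv h.2), if_neg hv, add_zero]
    · rw [CFVariant.nbhd, if_neg hX, if_neg (fun h => hX h.1), add_zero]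
  change (∃ j : Fin (X.numColors k), X.Usable j ∧
    colorCount G c v j + (if X.closed = true ∧ c v = j then 1 else 0) = 1) ↔ _
  simp only [hcard, Finset.card_eq_one]
  constructor
  · rintro ⟨j, hj, u, hu⟩
    have hmem : u ∈ (X.nbhd G v).filter fun u => c u = j := by rw [hu]; simp
    obtain ⟨h1, rfl⟩ := Finset.mem_filter.1 hmem
    refine ⟨u, h1, hj, fun u' hu' hne he => hne ?_⟩
    have : u' ∈ (X.nbhd G v).filter fun w => c w = c u := Finset.mem_filter.2 ⟨hu', he⟩
    rw [hu] at this
    exact Finset.mem_singleton.1 this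
  · rintro ⟨u, hu, hus, hun⟩
    refine ⟨c u, hus, u, Finset.eq_singleton_iff_unique_mem.2 ⟨by simp [hu], fun u' hu' => ?_⟩⟩
    obtain ⟨h1, h2⟩ := Finset.mem_filter.1 hu'
    by_contra hne
    exact hun u' h1 hne h2

theorem CFVariant.toLCP_opt (X : CFVariant) (k : ℕ) (G : SimpleGraph V) :
    (X.toLCP V k).opt G = 0 ↔ X.Colorable k G := by
  rw [LCP.opt_eq_zero_iff _ _ (X.toLCP_coloringWeight k G)]
  refine exists_congr fun c => ?_
  rw [X.toLCP_isProper_iff]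
  exact and_iff_left (X.toLCP_satisfiesSizes k c)

/-! b-colouring -/

theorem bLCP_isStable (k : ℕ) (G : SimpleGraph V) : (bLCP V k).IsStable G 1 := by
  refine ⟨fun v c => ?_, fun _ _ => rfl⟩
  change bCheck k (colorCount G c v) (c v) ↔
    bCheck k (fun a => min 1 (colorCount G c v a)) (c v)
  rcases c v with a | a
  · simp only [bCheck]
    omega
  · simp only [bCheck]
    refine and_congr (by omega) (forall_congr' fun i => imp_congr_right fun _ => by omega)

theorem colorCount_pos {C : Type} {G : SimpleGraph V} {c : V → C} {v : V} {a : C} :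
    1 ≤ colorCount G c v a ↔ ∃ u, G.Adj v u ∧ c u = a := by
  classical
  rw [Nat.succ_le_iff, colorCount, Finset.card_pos]
  constructor
  · rintro ⟨u, hu⟩
    obtain ⟨h1, h2⟩ := Finset.mem_filter.1 hu
    exact ⟨u, mem_nbrs.1 h1, h2⟩
  · rintro ⟨u, h1, h2⟩
    exact ⟨u, Finset.mem_filter.2 ⟨mem_nbrs.2 h1, h2⟩⟩

theorem absColor_eq_iff {k : ℕ} {x : Fin k ⊕ Fin k} {a : Fin k} :
    absColor x = a ↔ x = Sum.inl a ∨ x = Sum.inr a := by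
  rcases x with b | b <;> simp [absColor]

theorem colorCount_add_pos {k : ℕ} {G : SimpleGraph V} {c : V → Fin k ⊕ Fin k} {v : V}
    {a : Fin k} : 1 ≤ colorCount G c v (Sum.inl a) + colorCount G c v (Sum.inr a) ↔
      ∃ u, G.Adj v u ∧ absColor (c u) = a := by
  have h : 1 ≤ colorCount G c v (Sum.inl a) + colorCount G c v (Sum.inr a) ↔
      1 ≤ colorCount G c v (Sum.inl a) ∨ 1 ≤ colorCount G c v (Sum.inr a) := by omega
  rw [h, colorCount_pos, colorCount_pos, ← exists_or]
  exact exists_congr fun u => by rw [absColor_eq_iff, and_or_left]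

open Classical in
theorem card_fiber_pos {C : Type} (c : V → C) (a : C) :
    1 ≤ (Finset.univ.filter fun v => c v = a).card ↔ ∃ v, c v = a := by
  rw [Nat.succ_le_iff, Finset.card_pos]
  simp [Finset.Nonempty]

theorem bLCP_satisfiesSizes_iff (k : ℕ) (c : V → Fin k ⊕ Fin k) :
    (bLCP V k).SatisfiesSizes c ↔ ∀ a : Fin k, ∃ v, c v = Sum.inr a :=
  (and_iff_right (sum_card_fibers c)).trans (forall_congr' fun a => card_fiber_pos c (Sum.inr a))

theorem bLCP_coloringWeight (k : ℕ) (G : SimpleGraph V) (c : V → Fin k ⊕ Fin k) :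
    (bLCP V k).coloringWeight G c = 0 := fold_max_zero _

theorem bLCP_isProper_iff (k : ℕ) (G : SimpleGraph V) (c : V → Fin k ⊕ Fin k) :
    (bLCP V k).IsProper G c ↔ (∀ u v, G.Adj u v → absColor (c u) ≠ absColor (c v)) ∧
      ∀ v a, c v = Sum.inr a → ∀ b, b ≠ a → ∃ u, G.Adj v u ∧ absColor (c u) = b := by
  have hz : ∀ v a, colorCount G c v (Sum.inl a) + colorCount G c v (Sum.inr a) = 0 ↔
      ∀ u, G.Adj v u → a ≠ absColor (c u) := by
    intro v a
    rw [← Nat.lt_one_iff, ← not_le, colorCount_add_pos]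
    push Not
    exact forall_congr' fun u => imp_congr_right fun _ => ne_comm
  have hv : ∀ v, bCheck k (colorCount G c v) (c v) ↔
      (∀ u, G.Adj v u → absColor (c v) ≠ absColor (c u)) ∧
      ∀ a, c v = Sum.inr a → ∀ b, b ≠ a → ∃ u, G.Adj v u ∧ absColor (c u) = b := by
    intro v
    rcases h : c v with a | a
    · simp only [bCheck, hz, absColor, reduceCtorEq, false_imp_iff, implies_true, and_true]
    · simp only [bCheck, hz, colorCount_add_pos, absColor, Sum.inr.injEq, forall_eq']
  exact (forall_congr' hv).trans forall_and

theorem bLCP_iff_isBColoring (k : ℕ) (G : SimpleGraph V) (f : V → Fin k) :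
    (∃ c : V → Fin k ⊕ Fin k, (bLCP V k).IsProper G c ∧ (bLCP V k).SatisfiesSizes c ∧
      ∀ v, absColor (c v) = f v) ↔ IsBColoring k G f := by
  classical
  constructor
  · rintro ⟨c, hc, hs, hf⟩
    obtain ⟨h1, h2⟩ := (bLCP_isProper_iff k G c).1 hc
    rw [bLCP_satisfiesSizes_iff] at hs
    simp only [hf] at h1 h2
    refine ⟨h1, fun a => ?_⟩
    obtain ⟨v, hv⟩ := hs a
    exact ⟨v, by rw [← hf, hv]; rfl, h2 v a hv⟩
  · rintro ⟨h1, h2⟩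
    -- One witness `w a` is fixed for each class, and exactly these vertices get the negative sign.
    choose w hw hw' using h2
    have habs : ∀ v, absColor (if w (f v) = v then Sum.inr (f v) else Sum.inl (f v)) = f v := by
      intro v
      split <;> rfl
    refine ⟨fun v => if w (f v) = v then Sum.inr (f v) else Sum.inl (f v), ?_, ?_, habs⟩
    · rw [bLCP_isProper_iff]
      simp only [habs]
      refine ⟨h1, fun v a hv => ?_⟩
      split at hv
      next h =>
        obtain rfl := Sum.inr.inj hv
        have := hw' (f v)
        rwa [h] at this
      next => cases hv
    · rw [bLCP_satisfiesSizes_iff]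
      exact fun a => ⟨w a, by simp [hw]⟩

theorem bLCP_opt (k : ℕ) (G : SimpleGraph V) :
    (bLCP V k).opt G = 0 ↔ ∃ f : V → Fin k, IsBColoring k G f := by
  rw [LCP.opt_eq_zero_iff _ _ (bLCP_coloringWeight k G)]
  constructor
  · rintro ⟨c, h1, h2⟩
    exact ⟨_, (bLCP_iff_isBColoring k G _).1 ⟨c, h1, h2, fun _ => rfl⟩⟩
  · rintro ⟨f, hf⟩
    obtain ⟨c, h1, h2, -⟩ := (bLCP_iff_isBColoring k G f).2 hf
    exact ⟨c, h1, h2⟩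

end Problems

end LC

namespace LC

/-! ## Graphs with decomposition trees as inputs -/

/-- A graph on `Fin n` and a tree. -/
structure Input where
  n : ℕ
  graph : SimpleGraph (Fin n)
  tree : DTree (Fin n)

/-- The inputs of the algorithms: in the domain for `w` are the graphs with a decomposition tree of
mim-width at most `w`. -/
noncomputable def inputCtx : Ctx Input where
  dom w x := x.tree.IsDecomposition ∧ x.tree.mimWidth x.graph ≤ w
  sz x := x.n
  inp x := Data.cons (Data.ofGraph x.graph) (Data.ofTree x.tree)

open Classical in
noncomputable def matrix {n : ℕ} (G : SimpleGraph (Fin n)) : List (List Bool) :=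
  List.ofFn fun i => List.ofFn fun j => decide (G.Adj i j)

theorem enc_matrix {n : ℕ} (G : SimpleGraph (Fin n)) : enc (matrix G) = Data.ofGraph G := by
  change Data.ofList ((matrix G).map enc) = _
  rw [matrix, List.map_ofFn, Data.ofGraph]
  congr 2
  funext i
  change Data.ofList (List.map enc _) = _
  rw [List.map_ofFn]
  congr 2
  funext j
  by_cases h : G.Adj i j <;> simp [Data.ofProp, h]

theorem length_matrix {n : ℕ} (G : SimpleGraph (Fin n)) : (matrix G).length = n := by
  simp [matrix]

theorem adjB_matrix_iff {n : ℕ} (G : SimpleGraph (Fin n)) (u v : ℕ) :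
    adjB (matrix G) u v = true ↔ ∃ (hu : u < n) (hv : v < n), G.Adj ⟨u, hu⟩ ⟨v, hv⟩ := by
  by_cases hu : u < n
  · by_cases hv : v < n
    · simp [adjB, matrix, hu, hv]
    · simp [adjB, matrix, hu, hv]
  · simp [adjB, matrix, hu]

def DTree.toNat {n : ℕ} : DTree (Fin n) → DTree ℕ
  | leaf v => leaf v
  | node l r => node l.toNat r.toNat

theorem enc_toNat {n : ℕ} (T : DTree (Fin n)) : enc T.toNat = Data.ofTree T := by
  induction T with
  | leaf v => rfl
  | node l r hl hr =>
    rw [DTree.toNat, enc_node, enc_pair, hl, hr, Data.ofTree]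

theorem leaves_toNat {n : ℕ} (T : DTree (Fin n)) : T.toNat.leaves = T.leaves.map Fin.val := by
  induction T with
  | leaf v => rfl
  | node l r hl hr => rw [DTree.toNat, DTree.leaves, hl, hr, DTree.leaves, List.map_append]

/-- The summand 4 is what makes the induction close: a node adds three pairs to its children, and
two summands 4 are available for them and for the one that is required. A leaf needs `v + 5 ≤ n +
5`. -/
theorem size_tree_le {n : ℕ} (T : DTree (Fin n)) :
    (enc T.toNat).size + 4 ≤ (n + 5) * T.leaves.length := by
  induction T with
  | leaf v =>
    rw [DTree.toNat, enc_leaf, Data.size, size_enc_nat]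
    simp only [Data.size, DTree.leaves, List.length_singleton]
    omega
  | node l r hl hr =>
    rw [DTree.toNat, enc_node, enc_pair, DTree.leaves, List.length_append, Nat.mul_add]
    simp only [Data.size]
    omega

theorem mim_subtree_le {n : ℕ} (G : SimpleGraph (Fin n)) (T : DTree (Fin n)) {t : DTree ℕ}
    (ht : t ∈ T.toNat.subtrees) : ∃ S : Set (Fin n), mim G S ≤ T.mimWidth G ∧
      ∀ v : Fin n, v ∈ S ↔ (v : ℕ) ∈ t.leaves := by
  have self : ∀ T : DTree (Fin n), ∀ v : Fin n, v ∈ T.leaves ↔ (v : ℕ) ∈ T.toNat.leaves := by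
    intro T v
    rw [leaves_toNat]
    simp [Fin.val_inj]
  induction T with
  | leaf v =>
    rw [DTree.toNat, DTree.subtrees, List.mem_singleton] at ht
    exact ⟨{v}, le_rfl, fun u => by simp [ht, DTree.leaves, Fin.ext_iff]⟩
  | node l r hl hr =>
    rcases List.mem_cons.1 ht with rfl | ht
    · exact ⟨{v | v ∈ (DTree.node l r).leaves}, le_max_left _ _, fun v => self (.node l r) v⟩
    · rcases List.mem_append.1 ht with ht | ht
      · obtain ⟨S, h1, h2⟩ := hl ht
        exact ⟨S, h1.trans ((le_max_left _ _).trans (le_max_right _ _)), h2⟩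
      · obtain ⟨S, h1, h2⟩ := hr ht
        exact ⟨S, h1.trans ((le_max_right _ _).trans (le_max_right _ _)), h2⟩

/-- Transfers matchings from `Fin n` to `ℕ`. Vertices of a matching have neighbours and are thus
below `n`, so the fallback value in `f'` is never relevant. -/
theorem matchingLE_matrix {n : ℕ} (G : SimpleGraph (Fin n)) {X Y : ℕ → Prop} {w : ℕ}
    (hX : ∀ x, X x → x < n)
    (h : MatchingLE G.Adj (fun v => X (v : ℕ)) (fun v => Y (v : ℕ)) w) :
    MatchingLE (fun x y => adjB (matrix G) x y = true) X Y w := by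
  intro R hR f hf hi
  simp only [adjB_matrix_iff] at hf hi
  have hRn : ∀ x ∈ R, x < n := fun x hx => hX x (hR x hx)
  have hfn : ∀ x ∈ R, f x < n := fun x hx => (hf x hx).2.2.1
  let R' : Finset (Fin n) := Finset.univ.filter fun v => (v : ℕ) ∈ R
  let f' : Fin n → Fin n := fun v => if hv : f v < n then ⟨f v, hv⟩ else v
  have hf' : ∀ v ∈ R', (f' v : ℕ) = f v := by
    intro v hv
    simp only [f', dif_pos (hfn v (Finset.mem_filter.1 hv).2)]
  have hcard : R.card = R'.card := by
    rw [← Finset.card_map Fin.valEmbedding]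
    congr 1
    ext x
    simp only [Finset.mem_map, Fin.valEmbedding_apply, R', Finset.mem_filter, Finset.mem_univ,
      true_and]
    exact ⟨fun hx => ⟨⟨x, hRn x hx⟩, hx, rfl⟩, by rintro ⟨v, hv, rfl⟩; exact hv⟩
  rw [hcard]
  refine h R' (fun v hv => hR v (Finset.mem_filter.1 hv).2) f' (fun v hv => ?_) ?_
  · obtain ⟨h1, h2, h3, h4⟩ := hf v (Finset.mem_filter.1 hv).2
    refine ⟨by change Y (f' v : ℕ); rwa [hf' v hv], ?_⟩
    have : f' v = ⟨f v, h3⟩ := Fin.ext (hf' v hv)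
    rw [this]
    exact h4
  · intro v hv v' hv' hne hadj
    have hm := (Finset.mem_filter.1 hv').2
    refine hi v (Finset.mem_filter.1 hv).2 v' hm (fun e => hne (Fin.ext e)) ⟨v.2, hfn v' hm, ?_⟩
    have : f' v' = ⟨f v', hfn v' hm⟩ := Fin.ext (hf' v' hv')
    rwa [this] at hadj

theorem comp_matrix : inputCtx.Comp fun x => matrix x.graph := by
  refine ⟨?_, Prog.hd, ?_⟩
  · refine (Ctx.Bdd.sz.mul ((Ctx.Bdd.sz.mul (Ctx.Bdd.const 2)).add (Ctx.Bdd.const 1))).mono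
      fun w x _ => ?_
    refine (size_enc_list_le _ (x.n * 2) fun l hl => ?_).trans (by rw [length_matrix]; exact le_rfl)
    obtain ⟨i, rfl⟩ := List.mem_ofFn.1 hl
    refine (size_enc_list_le _ 1 fun b _ => ?_).trans (by simp)
    cases b <;> simp [Data.size]
  · simp only [enc_matrix]
    exact Ctx.Timed.hd _

theorem comp_tree : inputCtx.Comp fun x => x.tree.toNat := by
  refine ⟨?_, Prog.tl, ?_⟩
  · refine ((Ctx.Bdd.sz.add (Ctx.Bdd.const 5)).mul Ctx.Bdd.sz).mono fun w x hx => ?_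
    have h1 := size_tree_le x.tree
    have h2 : x.tree.leaves.length ≤ x.n := by
      simpa using List.Nodup.length_le_card hx.1.1
    have h3 := Nat.mul_le_mul_left (x.n + 5) h2
    change (enc x.tree.toNat).size ≤ (x.n + 5) * x.n
    omega
  · simp only [enc_toNat]
    exact Ctx.Timed.tl _

theorem decomposed_inputCtx :
    inputCtx.Decomposed (fun x => matrix x.graph) fun x => x.tree.toNat where
  length_eq w x _ := length_matrix x.graph
  irrefl w x _ u := by
    rw [← Bool.not_eq_true, adjB_matrix_iff]
    rintro ⟨_, _, h⟩
    exact x.graph.loopless.irrefl _ h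
  symm w x _ u v h := by
    rw [adjB_matrix_iff] at h ⊢
    obtain ⟨hu, hv, h⟩ := h
    exact ⟨hv, hu, h.symm⟩
  nodup w x hx := by
    rw [leaves_toNat]
    exact hx.1.1.map Fin.val_injective
  lt w x _ u hu := by
    rw [leaves_toNat] at hu
    obtain ⟨v, -, rfl⟩ := List.mem_map.1 hu
    rw [length_matrix]
    exact v.2
  matchingLE w x hx t ht := by
    obtain ⟨S, h1, h2⟩ := mim_subtree_le x.graph x.tree ht
    have h3 : MatchingLE x.graph.Adj (· ∈ S) (· ∉ S) w := fun R hR f hf hi =>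
      (matchingLE_mim x.graph S R hR f hf hi).trans (h1.trans hx.2)
    refine matchingLE_matrix x.graph (fun u hu => ?_) (h3.mono (fun v hv => (h2 v).2 hv) ?_)
    · have := (DTree.leaves_sublist_of_mem_subtrees ht).subset hu
      rw [leaves_toNat] at this
      obtain ⟨v, -, rfl⟩ := List.mem_map.1 this
      exact v.2
    · exact fun v hv hS => (mem_compl.1 hv).2 ((h2 v).1 hS)

/-! ## The statistics of proper colourings -/

section Stats

variable {C : Type} {q : ℕ}

open Classical in
/-- The pairs of a colour and truncated numbers of neighbours that satisfy the constraints. -/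
noncomputable def allowedList (e : C ≃ Fin q) (d : ℕ) (chk : C → (C → ℕ) → Prop) :
    List (ℕ × List ℕ) :=
  ((Finset.univ : Finset (Fin q × (Fin q → Fin (d + 1)))).filter fun p =>
    chk (e.symm p.1) fun a => p.2 (e a)).toList.map
      fun p => ((p.1 : ℕ), List.ofFn fun a => (p.2 a : ℕ))

/-- Colours and counts up to `d` have finitely many combinations, so an arbitrary check function
becomes a constant list in the program; stability is what makes truncated counts sufficient. -/
theorem mem_allowedList {e : C ≃ Fin q} {d : ℕ} {chk : C → (C → ℕ) → Prop} {a : C} {l : C → ℕ}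
    (hl : ∀ b, l b ≤ d) :
    ((e a : ℕ), List.ofFn fun b : Fin q => l (e.symm b)) ∈ allowedList e d chk ↔ chk a l := by
  classical
  simp only [allowedList, List.mem_map, Finset.mem_toList, Finset.mem_filter, Finset.mem_univ,
    true_and, Prod.mk.injEq]
  constructor
  · rintro ⟨⟨a', g⟩, h1, h2, h3⟩
    have h3 := List.ofFn_injective h3
    obtain rfl : a' = e a := Fin.ext h2
    have : (fun b => ((g (e b) : ℕ))) = l := by
      funext b
      have := congrFun h3 (e b)
      simpa using this
    simpa [this] using h1
  · intro h
    exact ⟨(e a, fun b => ⟨l (e.symm b), Nat.lt_succ_iff.2 (hl _)⟩), by simpa using h, rfl, rfl⟩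

noncomputable def weightList (e : C ≃ Fin q) (r : ℕ) (wt : C → ℕ → ℕ) : List (List ℕ) :=
  List.ofFn fun a => (List.range r).map (wt (e.symm a))

theorem weightList_getD {e : C ≃ Fin q} {r : ℕ} {wt : C → ℕ → ℕ} {j : ℕ} (hj : j < r) (a : C) :
    ((weightList e r wt).getD (e a) []).getD j 0 = wt a j := by
  simp [weightList, hj]

/-- The sums of the weights (with `r` components) of all proper colourings. -/
noncomputable def stats (e : C ≃ Fin q) (d r : ℕ) (chk : C → (C → ℕ) → Prop) (wt : C → ℕ → ℕ)
    (x : Input) : List (List ℕ) :=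
  (treeItem (matrix x.graph) q d r (allowedList e d chk) (weightList e r wt) x.tree.toNat).2.map
    fun p => p.2.2

theorem comp_stats (e : C ≃ Fin q) {d : ℕ} (hd : 1 ≤ d) (r : ℕ) (chk : C → (C → ℕ) → Prop)
    (wt : C → ℕ → ℕ) : inputCtx.Comp (stats e d r chk wt) := by
  have h := Ctx.Comp.treeItem (q := q) (r := r) (allowed := allowedList e d chk)
    (W := weightList e r wt) hd comp_matrix comp_tree decomposed_inputCtx
  exact h.snd.map (f := fun _ p => p.2.2) h.snd.varMem.snd.snd

variable {n : ℕ} (G : SimpleGraph (Fin n))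

theorem cnt_eq_colorCount {e : C ≃ Fin q} {c : ℕ → ℕ} {c' : Fin n → C}
    (h : ∀ v : Fin n, c v = e (c' v)) (v : Fin n) (a : C) :
    cnt (matrix G) (List.range n) c v (e a) = colorCount G c' v a := by
  classical
  rw [cnt_eq_card List.nodup_range, colorCount, ← Finset.card_map Fin.valEmbedding]
  congr 1
  ext x
  simp only [Finset.mem_filter, List.mem_toFinset, List.mem_range, Finset.mem_map, nbrs,
    Finset.mem_univ, true_and, Fin.valEmbedding_apply, adjB_matrix_iff]
  constructor
  · rintro ⟨⟨hx, hc⟩, _, _, hadj⟩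
    refine ⟨⟨x, hx⟩, ⟨hadj.symm, ?_⟩, rfl⟩
    have := h ⟨x, hx⟩
    rw [hc] at this
    exact (e.injective (Fin.ext this)).symm
  · rintro ⟨u, ⟨hadj, hu⟩, rfl⟩
    exact ⟨⟨u.2, by rw [h, hu]⟩, u.2, v.2, hadj.symm⟩

/-- At the root all vertices are below the node, so the table imposes every constraint. Colourings
on `ℕ` and on `Fin n` correspond; the colours of numbers from `n` on are irrelevant. -/
theorem mem_stats (e : C ≃ Fin q) {d r : ℕ} (hd : 1 ≤ d) {chk : C → (C → ℕ) → Prop}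
    {wt : C → ℕ → ℕ} {T : DTree (Fin n)} (hT : T.IsDecomposition) {K : List ℕ} :
    K ∈ stats e d r chk wt ⟨n, G, T⟩ ↔ ∃ c : Fin n → C,
      (∀ v, chk (c v) fun a => min d (colorCount G c v a)) ∧
      K = (List.range r).map fun j => ∑ v, wt (c v) j := by
  have hlen := length_matrix G
  have hlt : ∀ u ∈ T.toNat.leaves, u < (matrix G).length := by
    intro u hu
    rw [leaves_toNat] at hu
    obtain ⟨v, -, rfl⟩ := List.mem_map.1 hu
    rw [hlen]
    exact v.2
  have hmem : ∀ v : Fin n, (v : ℕ) ∈ T.toNat.leaves := fun v => by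
    rw [leaves_toNat]
    exact List.mem_map_of_mem (hT.2 v)
  have hirr : ∀ u, adjB (matrix G) u u = false := fun u => by
    rw [← Bool.not_eq_true, adjB_matrix_iff]
    rintro ⟨_, _, h⟩
    exact G.loopless.irrefl _ h
  have hnd : T.toNat.leaves.Nodup := by
    rw [leaves_toNat]
    exact hT.1.map Fin.val_injective
  obtain ⟨-, -, htab⟩ := isTable_treeItem (q := q) (r := r) (allowed := allowedList e d chk)
    (W := weightList e r wt) hd hirr T.toNat hnd hlt
  have hrow : ∀ (c : ℕ → ℕ) (c' : Fin n → C), (∀ v : Fin n, c v = e (c' v)) → ∀ v : Fin n,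
      (c v, row (matrix G) q d c v) ∈ allowedList e d chk ↔
        chk (c' v) fun a => min d (colorCount G c' v a) := by
    intro c c' h v
    rw [← mem_allowedList (e := e) (d := d) (chk := chk) (a := c' v)
      (l := fun a => min d (colorCount G c' v a)) (fun b => min_le_left _ _), h]
    have : row (matrix G) q d c v =
        List.ofFn fun b : Fin q => min d (colorCount G c' v (e.symm b)) := by
      apply List.ext_getElem
      · simp [row]
      · intro j h1 h2
        simp only [row, List.getElem_map, List.getElem_range, List.getElem_ofFn, hlen]
        rw [← cnt_eq_colorCount G h, Equiv.apply_symm_apply]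
    rw [this]
  have hstat : ∀ (c : ℕ → ℕ) (c' : Fin n → C), (∀ v : Fin n, c v = e (c' v)) →
      stat r (weightList e r wt) T.toNat.leaves c =
        (List.range r).map fun j => ∑ v, wt (c' v) j := by
    intro c c' h
    refine List.map_congr_left fun j hj => ?_
    rw [leaves_toNat, List.map_map]
    have hu : (Finset.univ : Finset (Fin n)) = T.leaves.toFinset := by
      ext v
      simp [hT.2 v]
    rw [hu, List.sum_toFinset _ hT.1]
    congr 1
    refine List.map_congr_left fun v _ => ?_
    simp only [Function.comp_apply, h]
    exact weightList_getD (List.mem_range.1 hj) _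
  simp only [stats, List.mem_map]
  constructor
  · rintro ⟨p, hp, rfl⟩
    obtain ⟨c, hc, hal, rfl⟩ := (htab p).1 hp
    have h : ∀ v : Fin n, c v = e (e.symm ⟨c v, hc v (by rw [hlen]; exact v.2)⟩) := fun v => by
      rw [Equiv.apply_symm_apply]
    exact ⟨_, fun v => (hrow c _ h v).1 (hal v (hmem v)), hstat c _ h⟩
  · rintro ⟨c', hc', rfl⟩
    let c : ℕ → ℕ := fun u => if hu : u < n then e (c' ⟨u, hu⟩) else 0
    have h : ∀ v : Fin n, c v = e (c' v) := fun v => by simp [c]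
    refine ⟨_, (htab _).2 ⟨c, ?_, ?_, rfl⟩, hstat c c' h⟩
    · intro u hu
      rw [hlen] at hu
      simp only [c, dif_pos hu, Fin.is_lt]
    · intro u hu
      have hun := hlt u hu
      rw [hlen] at hun
      exact (hrow c c' h ⟨u, hun⟩).2 (hc' _)

end Stats

/-! ## The algorithms -/

theorem PolyTimeOnBoundedMimWidth.of_comp {α : Type} [Enc α] {f : Input → α}
    {ans : {n : ℕ} → SimpleGraph (Fin n) → Data} (hf : inputCtx.Comp f)
    (h : ∀ (n : ℕ) (G : SimpleGraph (Fin n)) (T : DTree (Fin n)), T.IsDecomposition →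
      enc (f ⟨n, G, T⟩) = ans G) : PolyTimeOnBoundedMimWidth ans := by
  obtain ⟨-, P, hP⟩ := hf
  refine ⟨P, fun w => ?_⟩
  obtain ⟨p, hp⟩ := hP w
  refine ⟨p, fun n G T hT hw => ?_⟩
  have := hp ⟨n, G, T⟩ ⟨hT, hw⟩
  simp only [h n G T hT] at this
  exact this

theorem enc_decide (p : Prop) [Decidable p] : enc (decide p) = Data.ofProp p := by
  by_cases h : p <;> simp [Data.ofProp, h]

/-- Whether some proper colouring has only nonzero weights. -/
noncomputable def existsNonzero {C : Type} {q : ℕ} (e : C ≃ Fin q) (d r : ℕ)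
    (chk : C → (C → ℕ) → Prop) (wt : C → ℕ → ℕ) (x : Input) : Bool :=
  (stats e d r chk wt x).any fun K => K.all fun s => !decide (s = 0)

theorem comp_existsNonzero {C : Type} {q : ℕ} (e : C ≃ Fin q) {d : ℕ} (hd : 1 ≤ d) (r : ℕ)
    (chk : C → (C → ℕ) → Prop) (wt : C → ℕ → ℕ) :
    inputCtx.Comp (existsNonzero e d r chk wt) := by
  have h := comp_stats e hd r chk wt
  exact h.any (f := fun _ K => K.all fun s => !decide (s = 0))
    (h.varMem.all (f := fun _ s => !decide (s = 0)) h.varMem.varMem.eqZero.not)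

theorem existsNonzero_iff {C : Type} {q : ℕ} (e : C ≃ Fin q) {d r : ℕ} (hd : 1 ≤ d)
    {chk : C → (C → ℕ) → Prop} {wt : C → ℕ → ℕ} {n : ℕ} (G : SimpleGraph (Fin n))
    {T : DTree (Fin n)} (hT : T.IsDecomposition) :
    existsNonzero e d r chk wt ⟨n, G, T⟩ = true ↔ ∃ c : Fin n → C,
      (∀ v, chk (c v) fun a => min d (colorCount G c v a)) ∧ ∀ j < r, ∃ v, wt (c v) j ≠ 0 := by
  simp only [existsNonzero, List.any_eq_true, mem_stats G e hd hT]
  constructor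
  · rintro ⟨K, ⟨c, hc, rfl⟩, hK⟩
    refine ⟨c, hc, fun j hj => ?_⟩
    by_contra! h0
    simp only [List.all_map, List.all_eq_true, List.mem_range] at hK
    simpa [h0] using hK j hj
  · rintro ⟨c, hc, h⟩
    refine ⟨_, ⟨c, hc, rfl⟩, ?_⟩
    simp only [List.all_map, List.all_eq_true, List.mem_range]
    intro j hj
    obtain ⟨v, hv⟩ := h j hj
    simp only [Function.comp_apply, Bool.not_eq_true', decide_eq_false_iff_not]
    exact fun h0 => hv (Finset.sum_eq_zero_iff.1 h0 v (Finset.mem_univ v))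

/-! Conflict-free colouring -/

open Classical in
theorem CFVariant.comp_colorable (X : CFVariant) (k : ℕ) :
    ∃ f : Input → Bool, inputCtx.Comp f ∧ ∀ (n : ℕ) (G : SimpleGraph (Fin n)) (T : DTree (Fin n)),
      T.IsDecomposition → f ⟨n, G, T⟩ = decide (X.Colorable k G) := by
  -- With `r = 0` the statistics are empty and the test on them is vacuous, so only the existence of
  -- a proper colouring is decided.
  refine ⟨_, comp_existsNonzero (Equiv.refl (Fin (X.numColors k))) (d := 2) (by norm_num) 0
    (fun a l => ∃ j : Fin (X.numColors k), X.Usable j ∧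
      l j + (if X.closed = true ∧ a = j then 1 else 0) = 1) fun _ _ => 0, fun n G T hT => ?_⟩
  rw [Bool.eq_iff_iff, existsNonzero_iff _ (by norm_num) G hT, decide_eq_true_eq]
  refine exists_congr fun c => ?_
  rw [← X.toLCP_isProper_iff k G c]
  refine (and_iff_left (by simp)).trans (forall_congr' fun v => ?_)
  have := ((X.toLCP_isStable k G).1 v c).symm
  exact this

theorem CFVariant.polyTime_colorable (X : CFVariant) (k : ℕ) :
    PolyTimeOnBoundedMimWidth fun G => Data.ofProp (X.Colorable k G) := by
  classical
  obtain ⟨f, hf, h⟩ := X.comp_colorable k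
  exact .of_comp hf fun n G T hT => by rw [h n G T hT, enc_decide]

instance : Enc (Option ℕ) := ⟨Data.ofOption⟩

open Classical in
-- As `k` is fixed, the programs for the individual `j ≤ k`, which use different numbers of colours,
-- can be combined into one.
theorem CFVariant.comp_exists_colorable (X : CFVariant) (k : ℕ) :
    ∃ f : Input → Bool, inputCtx.Comp f ∧ ∀ (n : ℕ) (G : SimpleGraph (Fin n)) (T : DTree (Fin n)),
      T.IsDecomposition → f ⟨n, G, T⟩ = decide (∃ j ≤ k, X.Colorable j G) := by
  induction k with
  | zero =>
    obtain ⟨f, hf, h⟩ := X.comp_colorable 0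
    exact ⟨f, hf, fun n G T hT => by rw [h n G T hT]; simp⟩
  | succ k ih =>
    obtain ⟨f, hf, h⟩ := ih
    obtain ⟨g, hg, h'⟩ := X.comp_colorable (k + 1)
    refine ⟨_, hf.or hg, fun n G T hT => ?_⟩
    rw [h n G T hT, h' n G T hT, ← Bool.decide_or, decide_eq_decide]
    constructor
    · rintro (⟨j, hj, hc⟩ | hc)
      · exact ⟨j, by omega, hc⟩
      · exact ⟨k + 1, le_rfl, hc⟩
    · rintro ⟨j, hj, hc⟩
      rcases Nat.le_succ_iff.1 hj with hj | rfl
      · exact .inl ⟨j, hj, hc⟩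
      · exact .inr hc

theorem CFVariant.numberUpTo_succ (X : CFVariant) (k : ℕ) {n : ℕ} (G : SimpleGraph (Fin n))
    [Decidable (∃ j ≤ k, X.Colorable j G)] [Decidable (X.Colorable (k + 1) G)] :
    X.numberUpTo (k + 1) G = if ∃ j ≤ k, X.Colorable j G then X.numberUpTo k G else
      if X.Colorable (k + 1) G then some (k + 1) else none := by
  unfold CFVariant.numberUpTo
  by_cases h : ∃ j ≤ k, X.Colorable j G
  · have h' : ∃ j ≤ k + 1, X.Colorable j G := by
      obtain ⟨j, hj, hc⟩ := h
      exact ⟨j, by omega, hc⟩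
    rw [if_pos h', if_pos h, if_pos h]
  · rw [if_neg h]
    by_cases hc : X.Colorable (k + 1) G
    · rw [if_pos ⟨k + 1, le_rfl, hc⟩, if_pos hc]
      congr 1
      refine le_antisymm (Nat.sInf_le hc) ?_
      by_contra hlt
      exact h ⟨_, by omega, Nat.sInf_mem (s := {j | X.Colorable j G}) ⟨k + 1, hc⟩⟩
    · rw [if_neg hc, if_neg]
      rintro ⟨j, hj, hj'⟩
      rcases Nat.le_succ_iff.1 hj with hj | rfl
      · exact h ⟨j, hj, hj'⟩
      · exact hc hj'

theorem CFVariant.comp_numberUpTo (X : CFVariant) (k : ℕ) :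
    ∃ f : Input → Option ℕ, inputCtx.Comp f ∧
      ∀ (n : ℕ) (G : SimpleGraph (Fin n)) (T : DTree (Fin n)),
        T.IsDecomposition → f ⟨n, G, T⟩ = X.numberUpTo k G := by
  classical
  induction k with
  | zero =>
    obtain ⟨g, hg, h⟩ := X.comp_colorable 0
    refine ⟨_, hg.ite (Ctx.Comp.const (some 0)) (Ctx.Comp.const none), fun n G T hT => ?_⟩
    simp only [h n G T hT, decide_eq_true_eq, CFVariant.numberUpTo, Nat.le_zero, exists_eq_left]
    by_cases hc : X.Colorable 0 G
    · rw [if_pos hc, if_pos hc]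
      congr 1
      exact (Nat.le_zero.1 (Nat.sInf_le hc)).symm
    · rw [if_neg hc, if_neg hc]
  | succ k ih =>
    obtain ⟨f, hf, hf'⟩ := ih
    obtain ⟨b, hb, hb'⟩ := X.comp_exists_colorable k
    obtain ⟨g, hg, hg'⟩ := X.comp_colorable (k + 1)
    refine ⟨_, hb.ite hf (hg.ite (Ctx.Comp.const (some (k + 1))) (Ctx.Comp.const none)),
      fun n G T hT => ?_⟩
    rw [X.numberUpTo_succ]
    simp only [hf' n G T hT, hb' n G T hT, hg' n G T hT, decide_eq_true_eq]

theorem CFVariant.polyTime_numberUpTo (X : CFVariant) (k : ℕ) :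
    PolyTimeOnBoundedMimWidth fun G => Data.ofOption (X.numberUpTo k G) := by
  obtain ⟨f, hf, h⟩ := X.comp_numberUpTo k
  exact .of_comp hf fun n G T hT => by rw [h n G T hT]; rfl

/-! b-colouring -/

theorem polyTime_isBColoring (k : ℕ) : PolyTimeOnBoundedMimWidth
    fun {n} G => Data.ofProp (∃ f : Fin n → Fin k, IsBColoring k G f) := by
  classical
  -- Component `j` of the statistic counts the vertices of colour `Sum.inr j`, so the size
  -- constraints say that all `k` components are nonzero.
  refine .of_comp (comp_existsNonzero (finSumFinEquiv : Fin k ⊕ Fin k ≃ Fin (k + k)) (d := 1) le_rfl k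
    (fun a l => bCheck k l a) fun a j =>
      Sum.elim (fun _ : Fin k => 0) (fun i : Fin k => if (i : ℕ) = j then 1 else 0) a) fun n G T hT => ?_
  rw [← enc_decide]
  congr 1
  rw [Bool.eq_iff_iff, decide_eq_true_eq, existsNonzero_iff _ le_rfl G hT, ← bLCP_opt,
    LCP.opt_eq_zero_iff _ _ (bLCP_coloringWeight k G)]
  refine exists_congr fun c => and_congr (forall_congr' fun v => ?_) ?_
  · exact ((bLCP_isStable k G).1 v c).symm
  · rw [bLCP_satisfiesSizes_iff]
    constructor
    · intro h a
      obtain ⟨v, hv⟩ := h a a.2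
      refine ⟨v, ?_⟩
      rcases hc : c v with i | i
      · simp [hc] at hv
      · simp only [hc, Sum.elim_inr, ne_eq, ite_eq_right_iff, one_ne_zero, imp_false,
          not_not] at hv
        rw [Fin.ext hv]
    · intro h j hj
      obtain ⟨v, hv⟩ := h ⟨j, hj⟩
      exact ⟨v, by simp [hv]⟩

/-! `[k]`-Roman domination -/

theorem foldl_min_spec {α : Type} (g : α → ℕ) (l : List α) (m : ℕ) :
    l.foldl (fun m x => min m (g x)) m ≤ m ∧ (∀ x ∈ l, l.foldl (fun m x => min m (g x)) m ≤ g x) ∧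
      (l.foldl (fun m x => min m (g x)) m = m ∨
        ∃ x ∈ l, l.foldl (fun m x => min m (g x)) m = g x) := by
  induction l generalizing m with
  | nil => simp
  | cons x l ih =>
    obtain ⟨h1, h2, h3⟩ := ih (min m (g x))
    simp only [List.foldl_cons, List.mem_cons, forall_eq_or_imp, exists_eq_or_imp]
    refine ⟨h1.trans (min_le_left _ _), ⟨h1.trans (min_le_right _ _), h2⟩, ?_⟩
    rcases h3 with h3 | h3
    · rcases min_choice m (g x) with h | h
      · exact .inl (h3.trans h)
      · exact .inr (.inl (h3.trans h))
    · exact .inr (.inr h3)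

/-- The least first entry. -/
def minHead (l : List (List ℕ)) : ℕ :=
  match l with
  | [] => 0
  | K :: l => l.foldl (fun m L => min m (L.getD 0 0)) (K.getD 0 0)

theorem comp_minHead {I : Type} {Γ : Ctx I} {l : I → List (List ℕ)} (hl : Γ.Comp l) :
    Γ.Comp fun i => minHead (l i) := by
  refine (Ctx.Comp.listCases hl (Ctx.Comp.const 0) (g := fun _ x =>
    x.2.foldl (fun m L => min m (L.getD 0 0)) (x.1.getD 0 0)) ?_).congr fun w i _ => by
      rcases l i <;> rfl
  have hv := hl.varCons
  have h0 := hv.fst.getD (Ctx.Comp.const 0) 0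
  have hS := Ctx.Bdd.nat h0
  refine Ctx.Comp.foldlBdd (f := fun _ m L => min m (L.getD 0 0)) hv.snd h0 hS ?_ ?_
  · intro w i pre _ _
    rw [size_enc_nat]
    exact (foldl_min_spec (fun L : List ℕ => L.getD 0 0) pre _).1
  · have hf := Ctx.Comp.varFold (β := ℕ) hv.snd hS
    exact hf.fst.min (hf.snd.getD (Ctx.Comp.const 0) 0)

theorem polyTime_romanNumber (k : ℕ) (hk : 1 ≤ k) :
    PolyTimeOnBoundedMimWidth fun G => Data.ofNat (romanNumber k G) := by
  -- One component, the colour itself, sums to the weight of the function; the table contains all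
  -- attained weights, and the least is taken. The value 0 of `minHead` for an empty list does not
  -- occur, as there always is a Roman dominating function.
  refine .of_comp (comp_minHead (comp_stats (Equiv.refl (Fin (k + 2))) hk 1
    (fun a l => k + ∑ j ∈ Finset.univ.filter (fun j : Fin (k + 2) => 1 ≤ (j : ℕ)), l j ≤
      (a : ℕ) + ∑ j : Fin (k + 2), (j : ℕ) * l j) fun a _ => (a : ℕ))) fun n G T hT => ?_
  have hmem : ∀ K, K ∈ stats (Equiv.refl (Fin (k + 2))) k 1 (fun a l =>
      k + ∑ j ∈ Finset.univ.filter (fun j : Fin (k + 2) => 1 ≤ (j : ℕ)), l j ≤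
      (a : ℕ) + ∑ j : Fin (k + 2), (j : ℕ) * l j) (fun a _ => (a : ℕ)) ⟨n, G, T⟩ ↔
      ∃ f : Fin n → Fin (k + 2), IsRoman k G f ∧ K = [∑ v, (f v : ℕ)] := by
    intro K
    rw [mem_stats G _ hk hT]
    refine exists_congr fun c => and_congr ?_ (by simp)
    rw [← romanLCP_isProper_iff]
    exact forall_congr' fun v => ((romanLCP_checkStable k G) v c).symm
  suffices h : ∀ l : List (List ℕ), (∀ K, K ∈ l ↔ ∃ f : Fin n → Fin (k + 2), IsRoman k G f ∧
      K = [∑ v, (f v : ℕ)]) → minHead l = romanNumber k G by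
    rw [h _ hmem]
    rfl
  intro l hl
  obtain ⟨⟨f, hf, he⟩, hmin⟩ := romanNumber_spec k G
  have hle : ∀ K ∈ l, romanNumber k G ≤ K.getD 0 0 := by
    intro K hK
    obtain ⟨g, hg, rfl⟩ := (hl K).1 hK
    exact hmin g hg
  have hin := (hl _).2 ⟨f, hf, rfl⟩
  rcases l with _ | ⟨K, l⟩
  · cases hin
  obtain ⟨h1, h2, h3⟩ := foldl_min_spec (fun L : List ℕ => L.getD 0 0) l (K.getD 0 0)
  apply le_antisymm
  · rw [he]
    rcases List.mem_cons.1 hin with h | h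
    · simp only [← h] at h1 ⊢
      exact h1
    · exact h2 _ h
  · rcases h3 with h | ⟨L, hL, h⟩
    · exact (hle K List.mem_cons_self).trans h.ge
    · exact (hle L (List.mem_cons_of_mem _ hL)).trans h.ge

end LC

theorem mainTheorem8 (k : ℕ) (hk : 1 ≤ k) :
    -- `[k]`-Roman domination is a `k`-stable problem with `k + 2` colours
    (∀ (V : Type*) [Fintype V] (G : SimpleGraph V),
      Fintype.card (Fin (k + 2)) = k + 2 ∧
      (LC.romanLCP V k).IsStable G k ∧
      (LC.romanLCP V k).WeightStable G 1 ∧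
      (∀ f : V → Fin (k + 2),
        (((LC.romanLCP V k).IsProper G f ∧ (LC.romanLCP V k).SatisfiesSizes f) ↔
          LC.IsRoman k G f) ∧
        (LC.romanLCP V k).coloringWeight G f = ((∑ v, (f v : ℕ) : ℕ) : ℕ∞)) ∧
      (LC.romanLCP V k).opt G = (LC.romanNumber k G : ℕ∞)) ∧
    -- all variants of conflict-free `k`-colouring are `2`-stable problems with at most
    -- `k + 1` colours
    (∀ (X : LC.CFVariant) (V : Type*) [Fintype V] (G : SimpleGraph V),
      Fintype.card (Fin (X.numColors k)) ≤ k + 1 ∧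
      (X.toLCP V k).IsStable G 2 ∧
      (∀ c : V → Fin (X.numColors k),
        ((X.toLCP V k).IsProper G c ∧ (X.toLCP V k).SatisfiesSizes c) ↔ X.IsColoring k G c) ∧
      ((X.toLCP V k).opt G = 0 ↔ X.Colorable k G)) ∧
    -- b-colouring with `k` colours is a `1`-stable problem with `2 k` colours and size constraints
    (∀ (V : Type*) [Fintype V] (G : SimpleGraph V),
      Fintype.card (Fin k ⊕ Fin k) = 2 * k ∧
      (LC.bLCP V k).IsStable G 1 ∧
      (∀ f : V → Fin k,
        (∃ c : V → Fin k ⊕ Fin k, (LC.bLCP V k).IsProper G c ∧ (LC.bLCP V k).SatisfiesSizes c ∧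
          ∀ v, LC.absColor (c v) = f v) ↔ LC.IsBColoring k G f) ∧
      ((LC.bLCP V k).opt G = 0 ↔ ∃ f : V → Fin k, LC.IsBColoring k G f)) ∧
    -- all of them are solvable in polynomial time, given a decomposition of bounded mim-width
    LC.PolyTimeOnBoundedMimWidth (fun G => LC.Data.ofNat (LC.romanNumber k G)) ∧
    (∀ X : LC.CFVariant,
      LC.PolyTimeOnBoundedMimWidth (fun G => LC.Data.ofProp (X.Colorable k G)) ∧
      LC.PolyTimeOnBoundedMimWidth (fun G => LC.Data.ofOption (X.numberUpTo k G))) ∧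
    LC.PolyTimeOnBoundedMimWidth
      (fun {n} G => LC.Data.ofProp (∃ f : Fin n → Fin k, LC.IsBColoring k G f)) := by
  refine ⟨fun V _ G => ?_, fun X V _ G => ?_, fun V _ G => ?_, LC.polyTime_romanNumber k hk,
    fun X => ⟨X.polyTime_colorable k, X.polyTime_numberUpTo k⟩, LC.polyTime_isBColoring k⟩
  · refine ⟨Fintype.card_fin _, ⟨LC.romanLCP_checkStable k G, fun _ _ => rfl⟩, fun _ _ => rfl,
      fun f => ⟨?_, LC.romanLCP_coloringWeight k G f⟩, LC.romanLCP_opt k G⟩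
    rw [LC.romanLCP_isProper_iff]
    exact and_iff_left (LC.romanLCP_satisfiesSizes k f)
  · refine ⟨?_, X.toLCP_isStable k G, fun c => ?_, X.toLCP_opt k G⟩
    · rw [Fintype.card_fin]
      cases X <;> simp [LC.CFVariant.numColors]
    · rw [X.toLCP_isProper_iff]
      exact and_iff_left (X.toLCP_satisfiesSizes k c)
  · refine ⟨?_, LC.bLCP_isStable k G, LC.bLCP_iff_isBColoring k G, LC.bLCP_opt k G⟩
    rw [Fintype.card_sum, Fintype.card_fin, two_mul]
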